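/- Let $\mathbb T^2=\mathbb R^2/\mathbb Z^2$ be the flat torus with its Lebesgue probability measure $dx$, and let $V\in C^\infty(\mathbb T^2;\mathbb R)$. Let $\Omega_1$ be the set of $\xi\in\mathbb R^2\setminus\{0\}$ such that the geodesics $s\mapsto x+s\xi$ are periodic; the images of these curves are the closed geodesics of $\mathbb T^2$. Put $$\mathcal I(V)(x,\xi)=\lim_{T\to+\infty}\frac1T\int_0^T V(x+s\xi)\,ds,\qquad \mathcal C(V)=\{x_0\in\mathbb T^2:\ \exists\,\xi\in\Omega_1,\ \partial_x\mathcal I(V)(x_0,\xi)=0\}.$$ For a closed geodesic $\gamma$ let $\delta_\gamma$ be the normalized Lebesgue (length) measure along $\gamma$, and let $\mathcal N(V)$ be the closed convex hull, for the topology of weak convergence of measures, of $\{\delta_\gamma:\ \gamma \text{ a closed geodesic},\ \gamma\subset\mathcal C(V)\}$. **Theorem.** Let $\hbar\to0^+$ and $\varepsilon_\hbar>0$ with $\varepsilon_\hbar\to0$ and $\hbar\,\varepsilon_\hbar^{-1}\to0$. Let $(u_\hbar)$ be a sequence (or family) in $L^2(\mathbb T^2;\mathbb C)$ with $\|u_\hbar\|_{L^2}=1$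 such that, in the sense of distributions, $$-\frac{\hbar^2}{2}\Delta u_\hbar+\varepsilon_\hbar^2Vu_\hbar=\frac12u_\hbar+r_\hbar,\qquad r_\hbar\in L^2(\mathbb T^2),\quad \|r_\hbar\|_{L^2}=o(\hbar\varepsilon_\hbar).$$ Let $\nu$ be any accumulation point, for weak convergence of measures, of the probability measures $|u_\hbar(x)|^2dx$ as $\hbar\to0^+$. Then: 1. for every closed geodesic $\gamma$, if $\nu(\gamma)\neq0$ then $\gamma\subset\mathcal C(V)$; 2. $\nu=f\,dx+\nu_{\mathrm{sing}}$ with a real-valued $f\in L^1(\mathbb T^2)$ and $\nu_{\mathrm{sing}}\in\mathcal N(V)$; moreover, one can also write $\nu=g\,dx+\alpha\,\sigma$ with $0\le g\in L^1(\mathbb T^2)$, $\alpha\in[0,1]$ and $\sigma\in\mathcal N(V)$. -/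

import Mathlib

open MeasureTheory Filter Topology Set
open scoped NNReal ENNReal ContDiff

noncomputable section

/-- The flat torus `ℝ² / ℤ²`; `volume` on it is the Lebesgue (Haar) probability measure. -/
abbrev Torus : Type := UnitAddTorus (Fin 2)

/-- The Euclidean plane, universal cover of the torus. -/
abbrev Plane : Type := EuclideanSpace ℝ (Fin 2)

/-- The covering map `ℝ² → ℝ² / ℤ²`. -/
def toTorus (y : Plane) : Torus := fun i => ((y i : ℝ) : UnitAddCircle)

/-- Smooth functions on the torus: those whose lift to the plane is `C^∞`. -/
def SmoothOnTorus {F : Type*} [NormedAddCommGroup F] [NormedSpace ℝ F] (φ : Torus → F) : Prop :=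
  ContDiff ℝ ∞ (fun y : Plane => φ (toTorus y))

/-- The Laplacian of a function on the flat torus, computed in the chart `y ↦ x + y` at `x`. -/
def torusLaplacian (φ : Torus → ℂ) (x : Torus) : ℂ :=
  Laplacian.laplacian (fun y : Plane => φ (x + toTorus y)) 0

/-- The geodesic `s ↦ x + s ξ`. -/
def geodesic (x : Torus) (ξ : Plane) (s : ℝ) : Torus := x + toTorus (s • ξ)

/-- `T` is a (positive, not necessarily minimal) period of the geodesics with velocity `ξ`. -/
def IsPeriod (ξ : Plane) (T : ℝ) : Prop := 0 < T ∧ toTorus (T • ξ) = 0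

/-- `Ω₁`: the nonzero velocities that generate periodic geodesics. -/
def periodicVelocities : Set Plane := {ξ | ξ ≠ 0 ∧ ∃ T, IsPeriod ξ T}

/-- A closed geodesic, as a subset of the torus. -/
def IsClosedGeodesic (γ : Set Torus) : Prop :=
  ∃ x : Torus, ∃ ξ ∈ periodicVelocities, γ = range (geodesic x ξ)

/-- `𝓘(V)(x, ξ) = lim_{T → ∞} (1/T) ∫₀ᵀ V(x + s ξ) ds`. -/
def geodesicAverage (V : Torus → ℝ) (x : Torus) (ξ : Plane) : ℝ :=
  limUnder atTop (fun T : ℝ => T⁻¹ * ∫ s in (0 : ℝ)..T, V (geodesic x ξ s))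

/-- `𝓒(V)`: the points `x₀` at which `∂ₓ 𝓘(V)(x₀, ξ) = 0` for some `ξ ∈ Ω₁`. -/
def criticalSet (V : Torus → ℝ) : Set Torus :=
  {x₀ | ∃ ξ ∈ periodicVelocities,
    HasFDerivAt (fun y : Plane => geodesicAverage V (x₀ + toTorus y) ξ) (0 : Plane →L[ℝ] ℝ) 0}

/-- The law of `x + s ξ` with `s` uniform on `(0, T]`; when `T` is a period of `ξ ≠ 0`, this is the
normalized Lebesgue measure `δ_γ` along the closed geodesic `γ = {x + s ξ}`. -/
def uniformOnGeodesic (x : Torus) (ξ : Plane) (T : ℝ) : Measure Torus :=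
  (ProbabilityTheory.cond volume (Ioc 0 T)).map (geodesic x ξ)

/-- The measures `δ_γ`, where `γ` is a closed geodesic contained in `𝓒(V)`. -/
def criticalGeodesicMeasures (V : Torus → ℝ) : Set (FiniteMeasure Torus) :=
  {μ | ∃ x : Torus, ∃ ξ : Plane, ∃ T : ℝ, ξ ≠ 0 ∧ IsPeriod ξ T ∧
    range (geodesic x ξ) ⊆ criticalSet V ∧ (μ : Measure Torus) = uniformOnGeodesic x ξ T}

/-- `𝓝(V)`: the closed convex hull of the measures `δ_γ`, `γ ⊆ 𝓒(V)`, for the topology of weak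
convergence of measures. (Convex combinations with coefficients in `ℝ≥0` summing to one.) -/
def criticalHull (V : Torus → ℝ) : Set (FiniteMeasure Torus) :=
  closure (convexHull ℝ≥0 (criticalGeodesicMeasures V))

/-- The equation `(-h² Δ / 2 + e² V) u = u / 2 + r` on the torus, with `u, r ∈ L²`, in the sense of
distributions. -/
def SolvesWithRemainder (V : Torus → ℝ) (h e : ℝ)
    (u r : Lp ℂ 2 (volume : Measure Torus)) : Prop :=
  ∀ φ : Torus → ℂ, SmoothOnTorus φ →
    ∫ x, u x * (-((h : ℂ) ^ 2 / 2) * torusLaplacian φ x + (e : ℂ) ^ 2 * (V x : ℂ) * φ x) =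
      ∫ x, ((1 / 2 : ℂ) * u x + r x) * φ x

/-- `(u_i)` satisfies `(-h_i² Δ / 2 + e_i² V) u_i = u_i / 2 + o(h_i e_i)` along `l`, the remainder
being measured in `L²`. -/
def IsQuasimode {ι : Type*} (V : Torus → ℝ) (l : Filter ι) (h e : ι → ℝ)
    (u : ι → Lp ℂ 2 (volume : Measure Torus)) : Prop :=
  ∃ r : ι → Lp ℂ 2 (volume : Measure Torus),
    (∀ i, SolvesWithRemainder V (h i) (e i) (u i) (r i)) ∧
      (fun i => ‖r i‖) =o[l] (fun i => h i * e i)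

theorem lintegral_enorm_sq_eq_one (u : Lp ℂ 2 (volume : Measure Torus)) (hu : ‖u‖ = 1) :
    ∫⁻ x, ‖u x‖ₑ ^ 2 = 1 := by
  have h1 : eLpNorm u 2 volume = 1 := by
    rw [Lp.norm_def] at hu
    exact (ENNReal.toReal_eq_one_iff _).1 hu
  have h2 := eLpNorm_nnreal_pow_eq_lintegral (f := (u : Torus → ℂ)) (μ := volume)
    (p := 2) (by norm_num)
  have h3 : eLpNorm (u : Torus → ℂ) ((2 : ℝ≥0) : ℝ≥0∞) volume = 1 := by
    simpa using h1
  rw [h3] at h2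
  simpa using h2.symm

/-- The probability measure `|u(x)|² dx`, for `u` normalized in `L²`. -/
def positionMeasure (u : Lp ℂ 2 (volume : Measure Torus)) (hu : ‖u‖ = 1) :
    ProbabilityMeasure Torus :=
  ⟨volume.withDensity (fun x => ‖u x‖ₑ ^ 2),
    ⟨by rw [withDensity_apply _ MeasurableSet.univ, Measure.restrict_univ,
      lintegral_enorm_sq_eq_one u hu]⟩⟩

end

/-! ### Characters and Fourier coefficients on the torus -/

open UnitAddTorus
open scoped ComplexConjugate

/-! The argument is semiclassical second microlocalization, carried out on Fourier coefficients. Let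
c be the coefficients of u and η = ħ/ε. The basic objects are the correlations Σ m(n) c(n) conj
c(n+k), which for m = 1 are the Fourier coefficients of |u|² dx. Testing the equation against a
multiplier m (`corr_commutator`) and dividing by ħε gives, up to o(1) for bounded m, that the
correlation at k with multiplier m(n)·4π²η n·k equals η⁻¹ Σ_l v(l) times the correlation at k+l with
multiplier m(n+l) - m(n). If m is a Lipschitz function of η n·p, the right side stays bounded. Hence
at frequency k only the modes with η n·k bounded matter (`norm_corr_high_le`). On the other hand the
mass sits at |n| ~ 1/ħ, so η|n| tends to infinity, and η n·p, η n·q cannot both stay bounded when p,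
q are independent (`tendsto_corr_cutoff_mul_cutoff`).

Localizing to |η n·p| ≲ δ by a Lorentzian cutoff produces limit measures μ(p,δ). Their coefficients
live on the line of p, so they are invariant in the direction orthogonal to p; for distinct
primitive p (up to sign) their masses add up to at most 1; and the coefficients of ν and μ(p,δ) at
jp differ by O(‖p‖/(δ²|j|)). This is square summable in j, and in (p,j) jointly if δ = (1+‖p‖)².
Square summable differences are invisible to singular parts, so the singular part σ_p of μ(p,δ) does
not depend on δ, and the singular part of ν is Σ σ_p (`exists_scales`).

Criticality comes from a multiplier of size O(δ) whose derivative is the cutoff up to O(δ). It shows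
that, for D the derivative of the averaged potential across the direction orthogonal to p, the
integral of |D|² against μ(p,δ) is O(δ) (`integral_slope_sq_le`). Since σ_p ≤ μ(p,δ) for every δ, D
vanishes σ_p-almost everywhere. By invariance σ_p is an average of measures δ_γ with γ critical, so
the normalized singular part of ν is in the hull (`mem_criticalHull_of_sum`). Lebesgue measure is in
the hull too, as a limit of long critical geodesics, which settles the normalization of masses. For
the first claim, a closed geodesic orthogonal to q is null for dx and for σ_p with p ≠ q, so if ν
charges it then σ_q does, and it contains a point whose orbit is critical. -/

theorem UnitAddCircle.volume_eq_haar :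
    (volume : Measure UnitAddCircle) = AddCircle.haarAddCircle := by
  rw [AddCircle.volume_eq_smul_haarAddCircle]; simp

instance UnitAddCircle.isProbabilityMeasure_volume :
    IsProbabilityMeasure (volume : Measure UnitAddCircle) := by
  rw [UnitAddCircle.volume_eq_haar]; infer_instance

instance Torus.isProbabilityMeasure_volume : IsProbabilityMeasure (volume : Measure Torus) :=
  inferInstanceAs (IsProbabilityMeasure (Measure.pi fun _ : Fin 2 => (volume : Measure UnitAddCircle)))

namespace Torus

theorem norm_mFourier_apply (n : Fin 2 → ℤ) (x : Torus) : ‖mFourier n x‖ = 1 := by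
  simp [mFourier, fourier_apply, -map_zsmul, Circle.norm_coe]

theorem mFourier_add_point (n : Fin 2 → ℤ) (x y : Torus) :
    mFourier n (x + y) = mFourier n x * mFourier n y := by
  simp [mFourier, fourier_apply, AddCircle.toCircle_add]
  ring

theorem mFourier_toTorus (n : Fin 2 → ℤ) (y : Plane) :
    mFourier n (toTorus y) = Complex.exp (2 * Real.pi * Complex.I * (n 0 * y 0 + n 1 * y 1)) := by
  simp only [mFourier, toTorus, ContinuousMap.coe_mk, Fin.prod_univ_two, fourier_coe_apply,
    ← Complex.exp_add]
  congr 1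
  push_cast
  ring

theorem toTorus_add (y z : Plane) : toTorus (y + z) = toTorus y + toTorus z := by
  funext i
  simp [toTorus]

theorem toTorus_zero : toTorus 0 = 0 := by
  funext i
  simp [toTorus]

theorem continuous_toTorus : Continuous toTorus := by
  unfold toTorus
  refine continuous_pi fun i => ?_
  exact (AddCircle.continuous_mk' 1).comp (by fun_prop)

theorem toTorus_surjective : Function.Surjective toTorus := by
  intro x
  have h : ∀ i, ∃ t : ℝ, ((t : ℝ) : UnitAddCircle) = x i := fun i => QuotientAddGroup.mk_surjective (x i)
  choose t ht using h
  exact ⟨WithLp.toLp 2 t, funext fun i => by simpa [toTorus] using ht i⟩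

theorem integral_mFourier (n : Fin 2 → ℤ) :
    ∫ x : Torus, mFourier n x = if n = 0 then 1 else 0 := by
  split_ifs with h
  · subst h; simp [mFourier_zero]
  · obtain ⟨i, hi⟩ := Function.ne_iff.mp h
    -- Translation by half a wavelength along a coordinate with `n i ≠ 0` flips the sign of the
    -- character, so its integral equals its own opposite.
    have key : mFourier n (toTorus (EuclideanSpace.single i (1 / (2 * n i : ℝ)))) = -1 := by
      rw [mFourier_toTorus]
      have hi' : (n i : ℂ) ≠ 0 := by simpa using hi
      rw [← Complex.exp_pi_mul_I]
      congr 1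
      fin_cases i <;> simp at hi' ⊢ <;> field_simp
    have := integral_add_right_eq_self (μ := (volume : Measure Torus)) (fun x => mFourier n x)
      (toTorus (EuclideanSpace.single i (1 / (2 * n i : ℝ))))
    simp only [mFourier_add_point, key, mul_neg, mul_one, integral_neg] at this
    have h2 : (2 : ℂ) * ∫ x : Torus, mFourier n x = 0 := by linear_combination -this
    simpa using h2

theorem conj_mFourier (n : Fin 2 → ℤ) (x : Torus) : conj (mFourier n x) = mFourier (-n) x :=
  mFourier_neg.symm

/-- The characters, as elements of `L²`. -/
noncomputable abbrev character (n : Fin 2 → ℤ) : Lp ℂ 2 (volume : Measure Torus) :=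
  ContinuousMap.toLp (E := ℂ) 2 volume ℂ (mFourier n)

theorem orthonormal_character : Orthonormal ℂ character := by
  rw [orthonormal_iff_ite]
  intro m n
  rw [ContinuousMap.inner_toLp]
  have h : ∀ x : Torus, mFourier n x * conj (mFourier m x) = mFourier (n - m) x := fun x => by
    rw [conj_mFourier, ← mFourier_add, sub_eq_add_neg]
  simp only [h, integral_mFourier, sub_eq_zero, eq_comm]

theorem span_character_closure : (Submodule.span ℂ (range character)).topologicalClosure = ⊤ := by
  simpa only [Submodule.map_span, ContinuousLinearMap.coe_coe, ← range_comp, Function.comp_def]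
    using (ContinuousMap.toLp_denseRange ℂ (volume : Measure Torus) ℂ
      (by simp : (2 : ℝ≥0∞) ≠ ⊤)).topologicalClosure_map_submodule
      (span_mFourier_closure_eq_top (d := Fin 2))

/-- The Hilbert basis of characters. -/
noncomputable def basis : HilbertBasis (Fin 2 → ℤ) ℂ (Lp ℂ 2 (volume : Measure Torus)) :=
  HilbertBasis.mk orthonormal_character span_character_closure.ge

theorem coe_basis : ⇑basis = character := HilbertBasis.coe_mk _ _

/-- Fourier coefficients on the torus. -/
noncomputable def coeff (f : Torus → ℂ) (n : Fin 2 → ℤ) : ℂ := ∫ x, f x * mFourier (-n) x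

theorem basis_repr (f : Lp ℂ 2 (volume : Measure Torus)) (n : Fin 2 → ℤ) :
    basis.repr f n = coeff f n := by
  rw [basis.repr_apply_apply f n, MeasureTheory.L2.inner_def, coe_basis, coeff]
  apply integral_congr_ae
  filter_upwards [ContinuousMap.coeFn_toLp (p := 2) (𝕜 := ℂ) volume (mFourier n)] with x hx
  rw [hx]
  simp [conj_mFourier]

theorem hasSum_sq_coeff (f : Lp ℂ 2 (volume : Measure Torus)) :
    HasSum (fun n => ‖coeff f n‖ ^ 2) (‖f‖ ^ 2) := by
  have h := lp.hasSum_norm (p := 2) (by norm_num) (basis.repr f)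
  simpa [basis_repr] using h

theorem hasSum_inner_coeff (f g : Lp ℂ 2 (volume : Measure Torus)) :
    HasSum (fun n => coeff f n * conj (coeff g n)) (∫ x, f x * conj (g x)) := by
  have h := basis.hasSum_inner_mul_inner g f
  rw [MeasureTheory.L2.inner_def] at h
  simp only [RCLike.inner_apply] at h
  refine h.congr_fun fun n => ?_
  rw [← basis_repr, ← basis_repr, basis.repr_apply_apply, basis.repr_apply_apply, inner_conj_symm,
    mul_comm]

theorem exists_coeff_eq (a : (Fin 2 → ℤ) → ℂ) (ha : Summable fun n => ‖a n‖ ^ 2) :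
    ∃ f : Lp ℂ 2 (volume : Measure Torus), ∀ n, coeff f n = a n := by
  have hm : Memℓp a 2 := by
    refine memℓp_gen ?_
    simpa using ha
  refine ⟨basis.repr.symm ⟨a, hm⟩, fun n => ?_⟩
  rw [← basis_repr]
  simp

theorem coeff_toLp (f : C(Torus, ℂ)) (n : Fin 2 → ℤ) :
    coeff (ContinuousMap.toLp 2 (volume : Measure Torus) ℂ f) n = coeff f n :=
  integral_congr_ae ((ContinuousMap.coeFn_toLp (p := 2) (𝕜 := ℂ) volume f).mul ae_eq_rfl)

/-- Absolute summability gives uniform convergence of the series; the uniform limit is identified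
through the known `L²` limit. -/
theorem hasSum_of_summable_coeff {f : C(Torus, ℂ)} (h : Summable fun n => ‖coeff f n‖) :
    HasSum (fun n => coeff f n • mFourier n) f := by
  have h2 := basis.hasSum_repr (ContinuousMap.toLp 2 (volume : Measure Torus) ℂ f)
  simp only [basis_repr, coe_basis, coeff_toLp] at h2
  refine ContinuousMap.hasSum_of_hasSum_Lp (.of_norm ?_) h2
  simpa only [norm_smul, mFourier_norm, mul_one] using h

theorem hasSum_apply_of_summable_coeff {f : C(Torus, ℂ)} (h : Summable fun n => ‖coeff f n‖)
    (x : Torus) : HasSum (fun n => coeff f n * mFourier n x) (f x) := by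
  simpa only [map_smul, smul_eq_mul] using!
    (ContinuousMap.evalCLM ℂ x).hasSum (hasSum_of_summable_coeff h)

/-- A property of continuous functions that is linear, closed, and true for characters, is always
true. -/
theorem continuousMap_induction {P : C(Torus, ℂ) → Prop} (hchar : ∀ n, P (mFourier n))
    (hzero : P 0) (hadd : ∀ f g, P f → P g → P (f + g)) (hsmul : ∀ (a : ℂ) f, P f → P (a • f))
    (hclosed : IsClosed {f | P f}) (f : C(Torus, ℂ)) : P f := by
  let S : Submodule ℂ C(Torus, ℂ) :=
    { carrier := {f | P f}
      add_mem' := fun {a b} ha hb => hadd a b ha hb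
      zero_mem' := hzero
      smul_mem' := fun a f hf => hsmul a f hf }
  have h1 : Submodule.span ℂ (range (mFourier (d := Fin 2))) ≤ S :=
    Submodule.span_le.2 (by rintro _ ⟨n, rfl⟩; exact hchar n)
  have h2 := Submodule.topologicalClosure_minimal _ h1 (hclosed : IsClosed (S : Set C(Torus, ℂ)))
  rw [span_mFourier_closure_eq_top] at h2
  exact h2 (Submodule.mem_top (x := f))

theorem integrable_continuousMap (μ : Measure Torus) [IsFiniteMeasure μ] (f : C(Torus, ℂ)) :
    Integrable (fun x => f x) μ :=
  f.continuous.integrable_of_hasCompactSupport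
    (HasCompactSupport.of_compactSpace _)

theorem continuous_integral (μ : Measure Torus) [IsFiniteMeasure μ] :
    Continuous fun f : C(Torus, ℂ) => ∫ x, f x ∂μ := by
  refine LipschitzWith.continuous (K := (μ.real univ).toNNReal) ?_
  refine LipschitzWith.of_dist_le_mul fun f g => ?_
  rw [dist_eq_norm, ← integral_sub (integrable_continuousMap μ f) (integrable_continuousMap μ g),
    dist_eq_norm, Real.coe_toNNReal _ measureReal_nonneg, mul_comm]
  exact norm_integral_le_of_norm_le_const (Eventually.of_forall fun x => (f - g).norm_coe_le_norm x)

/-- Trigonometric polynomials are uniformly dense, and integration against a finite measure is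
uniformly continuous. -/
theorem measure_ext_of_coeff {μ ν : Measure Torus} [IsFiniteMeasure μ] [IsFiniteMeasure ν]
    (h : ∀ n, ∫ x, mFourier n x ∂μ = ∫ x, mFourier n x ∂ν) : μ = ν := by
  have key : ∀ f : C(Torus, ℂ), ∫ x, f x ∂μ = ∫ x, f x ∂ν := by
    refine continuousMap_induction h (by simp) ?_ ?_
      (isClosed_eq (continuous_integral μ) (continuous_integral ν))
    · intro f g hf hg
      simp only [ContinuousMap.add_apply]
      rw [integral_add (integrable_continuousMap μ f) (integrable_continuousMap μ g),
        integral_add (integrable_continuousMap ν f) (integrable_continuousMap ν g), hf, hg]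
    · intro a f hf
      simp only [ContinuousMap.smul_apply, integral_smul, hf]
  refine ext_of_forall_integral_eq_of_IsFiniteMeasure fun f => ?_
  have h2 := key ⟨fun x => (f x : ℂ), by fun_prop⟩
  simp only [ContinuousMap.coe_mk, integral_complex_ofReal] at h2
  exact_mod_cast h2

/-! ### Weighted correlations and the commutator identity -/

/-- The `ℓ²` norm of a sequence. -/
noncomputable def ellTwo (a : (Fin 2 → ℤ) → ℂ) : ℝ := √(∑' n, ‖a n‖ ^ 2)

theorem ellTwo_shift (a : (Fin 2 → ℤ) → ℂ) (k : Fin 2 → ℤ) :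
    ellTwo (fun n => a (n + k)) = ellTwo a := by
  unfold ellTwo
  rw [← (Equiv.addRight k).tsum_eq (fun n => ‖a n‖ ^ 2)]
  rfl

theorem summable_shift {E : Type*} [NormedAddCommGroup E] {f : (Fin 2 → ℤ) → E} (hf : Summable f)
    (k : Fin 2 → ℤ) : Summable fun n => f (n + k) :=
  (Equiv.addRight k).summable_iff.2 hf

theorem summable_norm_mul {a b : (Fin 2 → ℤ) → ℂ} (ha : Summable fun n => ‖a n‖ ^ 2)
    (hb : Summable fun n => ‖b n‖ ^ 2) : Summable fun n => ‖a n‖ * ‖b n‖ :=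
  Real.summable_mul_of_Lp_Lq_of_nonneg (p := 2) (q := 2) Real.HolderConjugate.two_two
    (fun _ => norm_nonneg _) (fun _ => norm_nonneg _) (by simpa using ha) (by simpa using hb)

theorem tsum_norm_mul_le {a b : (Fin 2 → ℤ) → ℂ} (ha : Summable fun n => ‖a n‖ ^ 2)
    (hb : Summable fun n => ‖b n‖ ^ 2) : ∑' n, ‖a n‖ * ‖b n‖ ≤ ellTwo a * ellTwo b := by
  have h := Real.inner_le_Lp_mul_Lq_tsum_of_nonneg (p := 2) (q := 2) Real.HolderConjugate.two_two
    (f := fun n => ‖a n‖) (g := fun n => ‖b n‖)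
    (fun _ => norm_nonneg _) (fun _ => norm_nonneg _) (by simpa using ha) (by simpa using hb)
  simpa [ellTwo, Real.sqrt_eq_rpow] using h

/-- The correlation `∑ m(n) a(n) conj(b(n+k))` of two sequences, weighted by a multiplier. -/
noncomputable def corr (a b : (Fin 2 → ℤ) → ℂ) (k : Fin 2 → ℤ) (m : (Fin 2 → ℤ) → ℝ) : ℂ :=
  ∑' n, (m n : ℂ) * a n * conj (b (n + k))

section corr

variable {a b : (Fin 2 → ℤ) → ℂ} (ha : Summable fun n => ‖a n‖ ^ 2)
  (hb : Summable fun n => ‖b n‖ ^ 2) (k : Fin 2 → ℤ) {m m' : (Fin 2 → ℤ) → ℝ} {A A' : ℝ}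
include ha hb

theorem summable_corr (hm : ∀ n, |m n| ≤ A) :
    Summable fun n => (m n : ℂ) * a n * conj (b (n + k)) := by
  refine Summable.of_norm_bounded (g := fun n => A * (‖a n‖ * ‖b (n + k)‖))
    ((summable_norm_mul ha (summable_shift hb k)).mul_left A) fun n => ?_
  rw [norm_mul, norm_mul, Complex.norm_real, RCLike.norm_conj, mul_assoc]
  exact mul_le_mul_of_nonneg_right (hm n) (by positivity)

/-- Cauchy–Schwarz, the shift by `k` being an isometry of `ℓ²`. This is the `L²` boundedness of
Fourier multipliers. -/
theorem norm_corr_le (hm : ∀ n, |m n| ≤ A) : ‖corr a b k m‖ ≤ A * (ellTwo a * ellTwo b) := by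
  have h0 : 0 ≤ A := (abs_nonneg _).trans (hm 0)
  have hs := summable_norm_mul ha (summable_shift hb k)
  refine (tsum_of_norm_bounded (g := fun n => A * (‖a n‖ * ‖b (n + k)‖))
    (hs.mul_left A).hasSum fun n => ?_).trans ?_
  · rw [norm_mul, norm_mul, Complex.norm_real, RCLike.norm_conj, mul_assoc]
    exact mul_le_mul_of_nonneg_right (hm n) (by positivity)
  · rw [tsum_mul_left]
    refine mul_le_mul_of_nonneg_left ?_ h0
    rw [← ellTwo_shift b k]
    exact tsum_norm_mul_le ha (summable_shift hb k)

theorem corr_add (hm : ∀ n, |m n| ≤ A) (hm' : ∀ n, |m' n| ≤ A') :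
    corr a b k (fun n => m n + m' n) = corr a b k m + corr a b k m' := by
  unfold corr
  rw [← (summable_corr ha hb k hm).tsum_add (summable_corr ha hb k hm')]
  refine tsum_congr fun n => ?_
  push_cast
  ring

theorem corr_sub (hm : ∀ n, |m n| ≤ A) (hm' : ∀ n, |m' n| ≤ A') :
    corr a b k (fun n => m n - m' n) = corr a b k m - corr a b k m' := by
  unfold corr
  rw [← (summable_corr ha hb k hm).tsum_sub (summable_corr ha hb k hm')]
  refine tsum_congr fun n => ?_
  push_cast
  ring

end corr

theorem corr_smul (a b : (Fin 2 → ℤ) → ℂ) (k : Fin 2 → ℤ) (m : (Fin 2 → ℤ) → ℝ) (t : ℝ) :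
    corr a b k (fun n => t * m n) = t * corr a b k m := by
  unfold corr
  rw [← tsum_mul_left]
  refine tsum_congr fun n => ?_
  push_cast
  ring

/-- Absolute convergence that justifies exchanging the sums over modes and over potential
frequencies in the commutator identity. -/
theorem summable_prod_translates {w : (Fin 2 → ℤ) → ℝ} (hw0 : ∀ l, 0 ≤ w l) (hw : Summable w)
    {a b : (Fin 2 → ℤ) → ℂ} (ha : Summable fun n => ‖a n‖ ^ 2)
    (hb : Summable fun n => ‖b n‖ ^ 2) (σ : (Fin 2 → ℤ) → (Fin 2 → ℤ)) :
    Summable fun x : (Fin 2 → ℤ) × (Fin 2 → ℤ) => w x.1 * (‖a x.2‖ * ‖b (x.2 + σ x.1)‖) := by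
  refine (summable_prod_of_nonneg fun x => by have := hw0 x.1; positivity).2 ⟨fun l => ?_, ?_⟩
  · exact (summable_norm_mul ha (summable_shift hb (σ l))).mul_left (w l)
  · refine Summable.of_nonneg_of_le (fun l => tsum_nonneg fun n => by have := hw0 l; positivity)
      (fun l => ?_) (hw.mul_right (ellTwo a * ellTwo b))
    dsimp only
    rw [tsum_mul_left]
    refine mul_le_mul_of_nonneg_left ?_ (hw0 l)
    rw [← ellTwo_shift b (σ l)]
    exact tsum_norm_mul_le ha (summable_shift hb (σ l))

/-- The commutator identity: testing `(p - 1/2) c + ε v * c = r` against a shifted multiplier. -/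
theorem corr_commutator {c r v : (Fin 2 → ℤ) → ℂ} {p : (Fin 2 → ℤ) → ℝ} {ε : ℝ}
    (hc : Summable fun n => ‖c n‖ ^ 2) (hr : Summable fun n => ‖r n‖ ^ 2)
    (hv : Summable fun n => ‖v n‖) (hvc : ∀ l, v (-l) = conj (v l))
    (heq : ∀ n, ((p n - 1 / 2 : ℝ) : ℂ) * c n + (ε : ℂ) * ∑' l, v l * c (n - l) = r n)
    (k : Fin 2 → ℤ) {m : (Fin 2 → ℤ) → ℝ} {A : ℝ} (hm : ∀ n, |m n| ≤ A) :
    corr c c k (fun n => m n * (p (n + k) - p n)) =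
      ε * ∑' l, v l * corr c c (k + l) (fun n => m (n + l) - m n) +
        (corr c r k m - corr r c k m) := by
  set q : (Fin 2 → ℤ) → ℂ := fun n => ∑' l, v l * c (n - l) with hq
  have hmn : ∀ n, ‖(m n : ℂ)‖ ≤ A := fun n => by rw [Complex.norm_real]; exact hm n
  have h0 : 0 ≤ A := (abs_nonneg _).trans (hm 0)
  have hvn : ∀ l, ‖v (-l)‖ = ‖v l‖ := fun l => by rw [hvc, RCLike.norm_conj]
  have hw : Summable fun l => A * ‖v l‖ := hv.mul_left A
  have hw0 : ∀ l, 0 ≤ A * ‖v l‖ := fun l => by positivity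
  have s1 : Summable (Function.uncurry fun l n => v l * ((m n : ℂ) * c n * conj (c (n + (k + l))))) := by
    refine Summable.of_norm_bounded (summable_prod_translates hw0 hw hc hc (fun l => k + l)) ?_
    rintro ⟨l, n⟩
    simp only [Function.uncurry, norm_mul, RCLike.norm_conj]
    have := mul_le_mul_of_nonneg_right (hmn n)
      (by positivity : 0 ≤ ‖v l‖ * (‖c n‖ * ‖c (n + (k + l))‖))
    linarith
  have s2 : Summable (Function.uncurry fun l n => v l * ((m n : ℂ) * c (n - l) * conj (c (n + k)))) := by
    refine Summable.of_norm_bounded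
      (summable_prod_translates hw0 hw (summable_shift hc k) hc (fun l => -l)) ?_
    rintro ⟨l, n⟩
    simp only [Function.uncurry, norm_mul, RCLike.norm_conj, ← sub_eq_add_neg]
    have := mul_le_mul_of_nonneg_right (hmn n)
      (by positivity : 0 ≤ ‖v l‖ * (‖c (n - l)‖ * ‖c (n + k)‖))
    linarith
  -- The potential is real: conjugating `v l` gives `v (-l)`, and the sum is then relabelled by `l ↦
  -- -l`.
  have q1 : ∀ n, ∑' l, v l * ((m n : ℂ) * c n * conj (c (n + (k + l)))) =
      (m n : ℂ) * c n * conj (q (n + k)) := fun n => by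
    rw [hq]
    simp only [Complex.conj_tsum, ← tsum_mul_left]
    rw [← (Equiv.neg (Fin 2 → ℤ)).tsum_eq]
    refine tsum_congr fun l => ?_
    simp only [Equiv.neg_apply, hvc, map_mul]
    rw [show n + (k + -l) = n + k - l by abel]
    ring
  have q2 : ∀ n, ∑' l, v l * ((m n : ℂ) * c (n - l) * conj (c (n + k))) =
      (m n : ℂ) * q n * conj (c (n + k)) := fun n => by
    rw [hq]
    simp only [← tsum_mul_left, ← tsum_mul_right]
    exact tsum_congr fun l => by ring
  have e1 : ∑' n, (m n : ℂ) * c n * conj (q (n + k)) = ∑' l, v l * corr c c (k + l) m := by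
    simp only [← q1]
    rw [s1.tsum_comm]
    simp only [tsum_mul_left, corr]
  -- Relabelling `n` as `n + l` moves the shift from `c` to the multiplier, which creates the
  -- discrete gradient `m (n + l) - m n`.
  have e2 : ∑' n, (m n : ℂ) * q n * conj (c (n + k)) =
      ∑' l, v l * corr c c (k + l) (fun n => m (n + l)) := by
    simp only [← q2]
    rw [s2.tsum_comm]
    simp only [tsum_mul_left, corr]
    refine tsum_congr fun l => ?_
    congr 1
    rw [← (Equiv.addRight l).tsum_eq]
    refine tsum_congr fun n => ?_
    simp only [Equiv.coe_addRight, add_sub_cancel_right]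
    rw [show n + l + k = n + (k + l) by abel]
  have t1 : Summable fun n => (m n : ℂ) * c n * conj (q (n + k)) := by
    simp only [← q1]; exact s1.prod_symm.prod
  have t2 : Summable fun n => (m n : ℂ) * q n * conj (c (n + k)) := by
    simp only [← q2]; exact s2.prod_symm.prod
  have hb : ∀ (m' : (Fin 2 → ℤ) → ℝ), (∀ n, |m' n| ≤ A) →
      Summable fun l => v l * corr c c (k + l) m' := fun m' hm' => by
    refine Summable.of_norm_bounded (hv.mul_right (A * (ellTwo c * ellTwo c))) fun l => ?_
    rw [norm_mul]
    exact mul_le_mul_of_nonneg_left (norm_corr_le hc hc _ hm') (norm_nonneg _)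
  have hb2 : Summable fun l => v l * corr c c (k + l) (fun n => m (n + l)) := by
    refine Summable.of_norm_bounded (hv.mul_right (A * (ellTwo c * ellTwo c))) fun l => ?_
    rw [norm_mul]
    exact mul_le_mul_of_nonneg_left (norm_corr_le hc hc _ fun n => hm (n + l)) (norm_nonneg _)
  have e3 : ∑' l, v l * corr c c (k + l) (fun n => m (n + l) - m n) =
      ∑' n, (m n : ℂ) * q n * conj (c (n + k)) - ∑' n, (m n : ℂ) * c n * conj (q (n + k)) := by
    rw [e1, e2, ← hb2.tsum_sub (hb m hm)]
    refine tsum_congr fun l => ?_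
    rw [corr_sub hc hc _ (fun n => hm (n + l)) hm]
    ring
  rw [e3, ← t2.tsum_sub t1, ← tsum_mul_left, corr, corr, corr,
    ← (summable_corr hc hr k hm).tsum_sub (summable_corr hr hc k hm),
    ← Summable.tsum_add ((t2.sub t1).mul_left _)
      ((summable_corr hc hr k hm).sub (summable_corr hr hc k hm))]
  -- Termwise: the equation at `n` times `conj (c (n + k))` is compared with the conjugate equation
  -- at `n + k` times `c n`. The energy `1/2` cancels in the difference.
  refine tsum_congr fun n => ?_
  have h1 := congrArg conj (heq (n + k))
  have h2 := heq n
  simp only [map_add, map_mul, Complex.conj_ofReal] at h1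
  rw [← h1, ← h2]
  push_cast
  ring

/-! ### Cutoff functions of one real variable -/

/-- The Lorentzian cutoff `δ² / (δ² + w²)`. -/
noncomputable def cutoff (δ w : ℝ) : ℝ := δ ^ 2 / (δ ^ 2 + w ^ 2)

/-- The square root of the Lorentzian cutoff. -/
noncomputable def rootCutoff (δ w : ℝ) : ℝ := δ / √(δ ^ 2 + w ^ 2)

/-- The function `w / (δ² + w²)`, so that `w * resolvent δ w = 1 - cutoff δ w`. -/
noncomputable def resolvent (δ w : ℝ) : ℝ := w / (δ ^ 2 + w ^ 2)

/-- A bounded function with derivative `cutoff δ - δ * cutoff 1`. -/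
noncomputable def virial (δ w : ℝ) : ℝ := δ * (Real.arctan (w / δ) - Real.arctan w)

variable {δ : ℝ}

theorem cutoff_nonneg (δ w : ℝ) : 0 ≤ cutoff δ w := by unfold cutoff; positivity

theorem cutoff_le_one (δ w : ℝ) : cutoff δ w ≤ 1 :=
  div_le_one_of_le₀ (by nlinarith [sq_nonneg w]) (by positivity)

theorem abs_cutoff_le (δ w : ℝ) : |cutoff δ w| ≤ 1 := by
  rw [abs_of_nonneg (cutoff_nonneg δ w)]; exact cutoff_le_one δ w

theorem rootCutoff_nonneg (hδ : 0 < δ) (w : ℝ) : 0 ≤ rootCutoff δ w := by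
  unfold rootCutoff; positivity

theorem rootCutoff_sq (w : ℝ) : rootCutoff δ w ^ 2 = cutoff δ w := by
  rw [rootCutoff, cutoff, div_pow, Real.sq_sqrt (by positivity)]

theorem rootCutoff_le_one (hδ : 0 < δ) (w : ℝ) : rootCutoff δ w ≤ 1 := by
  rw [← sq_le_one_iff₀ (rootCutoff_nonneg hδ w), rootCutoff_sq]
  exact cutoff_le_one δ w

theorem mul_resolvent (hδ : 0 < δ) (w : ℝ) : w * resolvent δ w = 1 - cutoff δ w := by
  unfold resolvent cutoff
  have : δ ^ 2 + w ^ 2 ≠ 0 := by positivity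
  field_simp
  ring

theorem abs_resolvent_le (hδ : 0 < δ) (w : ℝ) : |resolvent δ w| ≤ 1 / δ := by
  unfold resolvent
  rw [abs_div, abs_of_pos (by positivity : 0 < δ ^ 2 + w ^ 2), div_le_div_iff₀ (by positivity) hδ,
    ← sq_abs w]
  nlinarith [sq_nonneg (|w| - δ), abs_nonneg w]

/-- The gain of a second power of `δ` over the sup bound is what makes the error at the frequency `j
• p` decay like `1 / |j|`. -/
theorem abs_resolvent_sub_le (hδ : 0 < δ) (a b : ℝ) :
    |resolvent δ a - resolvent δ b| ≤ 1 / δ ^ 2 * |a - b| := by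
  have ha : 0 < δ ^ 2 + a ^ 2 := by positivity
  have hb : 0 < δ ^ 2 + b ^ 2 := by positivity
  have e : resolvent δ a - resolvent δ b =
      (δ ^ 2 - a * b) / ((δ ^ 2 + a ^ 2) * (δ ^ 2 + b ^ 2)) * (a - b) := by
    unfold resolvent
    field_simp
    ring
  rw [e, abs_mul]
  refine mul_le_mul_of_nonneg_right ?_ (abs_nonneg _)
  rw [abs_div, abs_of_pos (mul_pos ha hb), div_le_div_iff₀ (mul_pos ha hb) (by positivity), one_mul]
  have h1 : |δ ^ 2 - a * b| ≤ δ ^ 2 + a ^ 2 + b ^ 2 := by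
    rw [abs_le]; constructor <;> nlinarith [sq_nonneg (a - b), sq_nonneg (a + b), sq_nonneg δ]
  calc |δ ^ 2 - a * b| * δ ^ 2 ≤ (δ ^ 2 + a ^ 2 + b ^ 2) * δ ^ 2 := by gcongr
    _ ≤ _ := by nlinarith [mul_nonneg (sq_nonneg a) (sq_nonneg b)]

/-- The square root must itself be slowly varying: positivity of the limit measures comes from
applying it to both factors of a correlation. -/
theorem abs_rootCutoff_sub_le (hδ : 0 < δ) (a b : ℝ) :
    |rootCutoff δ a - rootCutoff δ b| ≤ 1 / δ * |a - b| := by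
  have key : ∀ x y : ℝ, √(δ ^ 2 + x ^ 2) ≤ √(δ ^ 2 + y ^ 2) + |x - y| := fun x y => by
    rw [Real.sqrt_le_left (by positivity)]
    have h2 : |y| ≤ √(δ ^ 2 + y ^ 2) := Real.abs_le_sqrt (by nlinarith [sq_nonneg δ])
    have h3 := Real.sq_sqrt (by positivity : 0 ≤ δ ^ 2 + y ^ 2)
    have h4 : y * (x - y) ≤ |y| * |x - y| := by rw [← abs_mul]; exact le_abs_self _
    have h5 := mul_le_mul_of_nonneg_right h2 (abs_nonneg (x - y))
    have h6 := sq_abs (x - y)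
    nlinarith
  have hl : ∀ x : ℝ, δ ≤ √(δ ^ 2 + x ^ 2) := fun x => Real.le_sqrt_of_sq_le (by nlinarith [sq_nonneg x])
  have ha := hl a
  have hb := hl b
  have e : rootCutoff δ a - rootCutoff δ b =
      δ / (√(δ ^ 2 + a ^ 2) * √(δ ^ 2 + b ^ 2)) * (√(δ ^ 2 + b ^ 2) - √(δ ^ 2 + a ^ 2)) := by
    unfold rootCutoff
    have : √(δ ^ 2 + a ^ 2) ≠ 0 := by positivity
    have : √(δ ^ 2 + b ^ 2) ≠ 0 := by positivity
    field_simp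
  rw [e, abs_mul]
  refine mul_le_mul ?_ ?_ (abs_nonneg _) (by positivity)
  · rw [abs_of_nonneg (by positivity), div_le_div_iff₀ (by positivity) hδ, one_mul]
    exact mul_le_mul ha hb hδ.le (by positivity)
  · have h1 := key a b
    have h2 := key b a
    rw [abs_sub_comm b a] at h2
    rw [abs_le]; constructor <;> linarith

theorem abs_cutoff_sub_le (hδ : 0 < δ) (a b : ℝ) :
    |cutoff δ a - cutoff δ b| ≤ 2 / δ * |a - b| := by
  rw [← rootCutoff_sq, ← rootCutoff_sq, sq_sub_sq, abs_mul]
  have h1 := abs_rootCutoff_sub_le hδ a b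
  have h2 : |rootCutoff δ a + rootCutoff δ b| ≤ 2 := by
    rw [abs_of_nonneg (add_nonneg (rootCutoff_nonneg hδ a) (rootCutoff_nonneg hδ b))]
    linarith [rootCutoff_le_one hδ a, rootCutoff_le_one hδ b]
  calc _ ≤ 2 * (1 / δ * |a - b|) := mul_le_mul h2 h1 (abs_nonneg _) (by norm_num)
    _ = _ := by ring

theorem hasDerivAt_virial (hδ : 0 < δ) (w : ℝ) :
    HasDerivAt (virial δ) (cutoff δ w - δ * cutoff 1 w) w := by
  have h1 := ((hasDerivAt_id w).div_const δ).arctan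
  have h2 := (h1.sub (Real.hasDerivAt_arctan w)).const_mul δ
  refine h2.congr_deriv ?_
  unfold cutoff
  simp only [id]
  have : δ ^ 2 + w ^ 2 ≠ 0 := by positivity
  have : 1 + w ^ 2 ≠ 0 := by positivity
  field_simp

theorem abs_virial_le (hδ : 0 < δ) (w : ℝ) : |virial δ w| ≤ δ * Real.pi := by
  rw [virial, abs_mul, abs_of_pos hδ]
  refine mul_le_mul_of_nonneg_left ?_ hδ.le
  have h1 := Real.arctan_lt_pi_div_two (w / δ)
  have h2 := Real.neg_pi_div_two_lt_arctan (w / δ)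
  have h3 := Real.arctan_lt_pi_div_two w
  have h4 := Real.neg_pi_div_two_lt_arctan w
  rw [abs_le]; constructor <;> linarith

theorem virial_neg (δ w : ℝ) : virial δ (-w) = -virial δ w := by
  simp only [virial, neg_div, Real.arctan_neg]; ring

/-- The two arctangents have the same limits at infinity, and for `w > 0` their difference is at
most `π/2 - arctan w = arctan w⁻¹ < w⁻¹`. A single arctangent would leave a product growing linearly
in `w`; subtracting the second one costs only the term `δ * cutoff 1` in the derivative. -/
theorem abs_virial_mul_le (hδ : 0 < δ) (hδ1 : δ ≤ 1) (w : ℝ) : |virial δ w * w| ≤ δ := by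
  have key : ∀ w : ℝ, 0 < w → |virial δ w * w| ≤ δ := fun w hw => by
    have h1 : Real.arctan w ≤ Real.arctan (w / δ) :=
      Real.arctan_mono (by rw [le_div_iff₀ hδ]; nlinarith)
    have h2 := Real.arctan_lt_pi_div_two (w / δ)
    have h3 := Real.arctan_inv_of_pos hw
    have h4 : Real.arctan w⁻¹ < w⁻¹ := by
      have := Real.lt_tan (Real.arctan_pos.2 (inv_pos.2 hw)) (Real.arctan_lt_pi_div_two w⁻¹)
      rwa [Real.tan_arctan] at this
    have h5 : (Real.arctan (w / δ) - Real.arctan w) * w ≤ 1 := by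
      rw [← inv_mul_cancel₀ hw.ne']
      exact mul_le_mul_of_nonneg_right (by linarith) hw.le
    rw [virial, mul_assoc, abs_mul, abs_of_pos hδ,
      abs_of_nonneg (mul_nonneg (by linarith) hw.le)]
    nlinarith
  rcases lt_trichotomy w 0 with hw | hw | hw
  · have := key (-w) (by linarith)
    rwa [virial_neg, neg_mul_neg] at this
  · subst hw; simp [hδ.le]
  · exact key w hw

theorem abs_virial_sub_le (hδ : 0 < δ) (hδ1 : δ ≤ 1) (a b : ℝ) :
    |virial δ a - virial δ b| ≤ 2 * |a - b| := by
  refine convex_univ.norm_image_sub_le_of_norm_hasDerivWithin_le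
    (fun x _ => (hasDerivAt_virial hδ x).hasDerivWithinAt) (fun x _ => ?_) (mem_univ b) (mem_univ a)
  have h1 := cutoff_nonneg δ x
  have h2 := cutoff_le_one δ x
  have h3 := cutoff_nonneg 1 x
  have h4 := cutoff_le_one 1 x
  rw [Real.norm_eq_abs, abs_le]
  constructor <;> nlinarith

theorem abs_virial_taylor (hδ : 0 < δ) (w t : ℝ) :
    |virial δ (w + t) - virial δ w - t * (cutoff δ w - δ * cutoff 1 w)| ≤
      (2 / δ + 2 * δ) * t ^ 2 := by
  have hd : ∀ x ∈ uIcc w (w + t), HasDerivWithinAt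
      (fun x => virial δ x - x * (cutoff δ w - δ * cutoff 1 w))
      ((cutoff δ x - δ * cutoff 1 x) - 1 * (cutoff δ w - δ * cutoff 1 w)) (uIcc w (w + t)) x :=
    fun x _ => ((hasDerivAt_virial hδ x).sub ((hasDerivAt_id x).mul_const _)).hasDerivWithinAt
  have hb : ∀ x ∈ uIcc w (w + t),
      ‖(cutoff δ x - δ * cutoff 1 x) - 1 * (cutoff δ w - δ * cutoff 1 w)‖ ≤
        (2 / δ + 2 * δ) * |t| := fun x hx => by
    have h0 : |x - w| ≤ |t| := by
      have := abs_sub_left_of_mem_uIcc hx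
      simpa using this
    have h1 := abs_cutoff_sub_le hδ x w
    have h2 := abs_cutoff_sub_le one_pos x w
    rw [Real.norm_eq_abs]
    have e : (cutoff δ x - δ * cutoff 1 x) - 1 * (cutoff δ w - δ * cutoff 1 w) =
      (cutoff δ x - cutoff δ w) - δ * (cutoff 1 x - cutoff 1 w) := by ring
    rw [e]
    refine (abs_sub _ _).trans ?_
    rw [abs_mul, abs_of_pos hδ]
    calc _ ≤ 2 / δ * |x - w| + δ * (2 / 1 * |x - w|) := by gcongr
      _ = (2 / δ + 2 * δ) * |x - w| := by ring
      _ ≤ _ := by gcongr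
  have := (convex_uIcc w (w + t)).norm_image_sub_le_of_norm_hasDerivWithin_le hd hb
    left_mem_uIcc right_mem_uIcc
  rw [Real.norm_eq_abs, Real.norm_eq_abs] at this
  calc _ = |virial δ (w + t) - (w + t) * (cutoff δ w - δ * cutoff 1 w) -
      (virial δ w - w * (cutoff δ w - δ * cutoff 1 w))| := by congr 1; ring
    _ ≤ _ := this
    _ = (2 / δ + 2 * δ) * t ^ 2 := by rw [add_sub_cancel_left, mul_assoc, ← sq, sq_abs]

/-! ### Lattice vectors and momenta -/

/-- The Euclidean scalar product of two lattice vectors. -/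
def dot (n k : Fin 2 → ℤ) : ℝ := n 0 * k 0 + n 1 * k 1

/-- The determinant of two lattice vectors. -/
def cross (n k : Fin 2 → ℤ) : ℤ := n 0 * k 1 - n 1 * k 0

/-- The momentum of the mode `n` in the direction `k`, at the scale `η⁻¹`. -/
noncomputable def freq (η : ℝ) (k n : Fin 2 → ℤ) : ℝ := 4 * Real.pi ^ 2 * η * dot n k

theorem dot_self_nonneg (n : Fin 2 → ℤ) : 0 ≤ dot n n := by
  unfold dot; nlinarith [mul_self_nonneg (n 0 : ℝ), mul_self_nonneg (n 1 : ℝ)]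

theorem dot_add (n l k : Fin 2 → ℤ) : dot (n + l) k = dot n k + dot l k := by
  simp only [dot, Pi.add_apply]; push_cast; ring

theorem freq_add (η : ℝ) (k n l : Fin 2 → ℤ) : freq η k (n + l) = freq η k n + freq η k l := by
  simp only [freq, dot_add]; ring

theorem freq_smul (η : ℝ) (j : ℤ) (p n : Fin 2 → ℤ) : freq η (j • p) n = j * freq η p n := by
  simp only [freq, dot, Pi.smul_apply, smul_eq_mul]; push_cast; ring

theorem abs_coord_le (n : Fin 2 → ℤ) (i : Fin 2) : |(n i : ℝ)| ≤ ‖n‖ := by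
  have := norm_le_pi_norm n i
  rwa [Int.norm_eq_abs] at this

theorem abs_dot_le (n k : Fin 2 → ℤ) : |dot n k| ≤ 2 * (‖n‖ * ‖k‖) := by
  unfold dot
  refine (abs_add_le _ _).trans ?_
  rw [abs_mul, abs_mul]
  have := mul_le_mul (abs_coord_le n 0) (abs_coord_le k 0) (abs_nonneg _) (norm_nonneg _)
  have := mul_le_mul (abs_coord_le n 1) (abs_coord_le k 1) (abs_nonneg _) (norm_nonneg _)
  linarith

theorem abs_freq_le {η : ℝ} (hη : 0 < η) (k n : Fin 2 → ℤ) :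
    |freq η k n| ≤ 8 * Real.pi ^ 2 * ‖k‖ * (η * ‖n‖) := by
  rw [freq, abs_mul, abs_of_pos (by positivity)]
  calc _ ≤ 4 * Real.pi ^ 2 * η * (2 * (‖n‖ * ‖k‖)) :=
        mul_le_mul_of_nonneg_left (abs_dot_le n k) (by positivity)
    _ = _ := by ring

/-- Cramer's rule recovers `n` from its products with `p` and `q`, and the determinant, a nonzero
integer, has absolute value at least 1. -/
theorem dot_self_le_of_cross_ne_zero {p q : Fin 2 → ℤ} (h : cross p q ≠ 0) (n : Fin 2 → ℤ) :
    dot n n ≤ 2 * (dot p p + dot q q) * (dot n p ^ 2 + dot n q ^ 2) := by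
  have h1 : (1 : ℝ) ≤ (cross p q : ℝ) ^ 2 := by
    rw [← sq_abs]
    have : (1 : ℝ) ≤ |(cross p q : ℝ)| := by exact_mod_cast Int.one_le_abs h
    nlinarith
  have e : (cross p q : ℝ) ^ 2 * dot n n =
      (dot n p * q 1 - dot n q * p 1) ^ 2 + (dot n q * p 0 - dot n p * q 0) ^ 2 := by
    simp only [cross, dot]; push_cast; ring
  have h2 : dot n n ≤ (cross p q : ℝ) ^ 2 * dot n n := by nlinarith [dot_self_nonneg n]
  rw [e] at h2
  refine h2.trans ?_
  have hp : dot p p = (p 0 : ℝ) ^ 2 + (p 1 : ℝ) ^ 2 := by simp only [dot]; ring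
  have hq : dot q q = (q 0 : ℝ) ^ 2 + (q 1 : ℝ) ^ 2 := by simp only [dot]; ring
  rw [hp, hq]
  generalize dot n p = x
  generalize dot n q = y
  nlinarith [sq_nonneg (x * q 1 + y * p 1), sq_nonneg (y * p 0 + x * q 0), sq_nonneg (x * p 0),
    sq_nonneg (x * p 1), sq_nonneg (y * q 0), sq_nonneg (y * q 1)]

/-! ### Quasimodes in Fourier variables and their localization -/

/-- The Fourier coefficients `c` of a quasimode on the torus, with effective Planck constant `η`
and potential with Fourier coefficients `v`: normalization, frequency escape, and the commutator
relation. -/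
structure FourierQuasimode {ι : Type*} (U : Filter ι) (v : (Fin 2 → ℤ) → ℂ)
    (c : ι → (Fin 2 → ℤ) → ℂ) (η : ι → ℝ) : Prop where
  summable_sq : ∀ i, Summable fun n => ‖c i n‖ ^ 2
  ellTwo_eq : ∀ i, ellTwo (c i) = 1
  eta_pos : ∀ i, 0 < η i
  eta_lim : Tendsto η U (𝓝 0)
  summable_pot : Summable fun l => ‖v l‖ * (1 + ‖l‖) ^ 2
  escape : Tendsto (fun i => ∑' n, ‖c i n‖ ^ 2 / (1 + η i ^ 2 * dot n n)) U (𝓝 0)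
  commutator : ∃ ρ : ι → ℝ, Tendsto ρ U (𝓝 0) ∧
    ∀ (i : ι) (k : Fin 2 → ℤ) (m : (Fin 2 → ℤ) → ℝ) (A : ℝ), (∀ n, |m n| ≤ A) →
      ‖corr (c i) (c i) k (fun n => m n * (freq (η i) k n + 2 * Real.pi ^ 2 * η i * dot k k)) -
        (η i : ℂ)⁻¹ * ∑' l, v l * corr (c i) (c i) (k + l) (fun n => m (n + l) - m n)‖ ≤ A * ρ i

variable {v : (Fin 2 → ℤ) → ℂ}

theorem summable_pot_mul_norm (h : Summable fun l : Fin 2 → ℤ => ‖v l‖ * (1 + ‖l‖) ^ 2) :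
    Summable fun l => ‖v l‖ * ‖l‖ :=
  Summable.of_nonneg_of_le (fun l => by positivity)
    (fun l => mul_le_mul_of_nonneg_left (by nlinarith [norm_nonneg l]) (norm_nonneg _)) h

theorem summable_pot_norm (h : Summable fun l : Fin 2 → ℤ => ‖v l‖ * (1 + ‖l‖) ^ 2) :
    Summable fun l => ‖v l‖ :=
  Summable.of_nonneg_of_le (fun l => by positivity)
    (fun l => le_mul_of_one_le_right (norm_nonneg _) (by nlinarith [norm_nonneg l])) h

namespace FourierQuasimode

variable {ι : Type*} {U : Filter ι} {c : ι → (Fin 2 → ℤ) → ℂ} {η : ι → ℝ}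
  (Q : FourierQuasimode U v c η)
include Q

theorem norm_corr_le_of_bound (i : ι) (k : Fin 2 → ℤ) {m : (Fin 2 → ℤ) → ℝ} {A : ℝ}
    (hm : ∀ n, |m n| ≤ A) : ‖corr (c i) (c i) k m‖ ≤ A := by
  simpa [Q.ellTwo_eq] using norm_corr_le (Q.summable_sq i) (Q.summable_sq i) k hm

/-- The commutator relation for slowly varying multipliers: the factor `η⁻¹` is absorbed by the
gradient of size `B η ‖l‖`, and the term with `dot k k` goes into `ρ`. The sequence `ρ` depends on
`k` only, not on the multiplier; `A'` serves summability alone. -/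
theorem norm_corr_mul_freq_le (k : Fin 2 → ℤ) : ∃ ρ : ι → ℝ, Tendsto ρ U (𝓝 0) ∧
    ∀ (i : ι) (m : (Fin 2 → ℤ) → ℝ) (A A' B : ℝ), (∀ n, |m n| ≤ A) →
      (∀ n, |m n * freq (η i) k n| ≤ A') → (∀ n l, |m (n + l) - m n| ≤ B * (η i * ‖l‖)) →
      ‖corr (c i) (c i) k (fun n => m n * freq (η i) k n)‖ ≤
        B * (∑' l, ‖v l‖ * ‖l‖) + A * ρ i := by
  obtain ⟨ρ, hρ, h⟩ := Q.commutator
  refine ⟨fun i => ρ i + 2 * Real.pi ^ 2 * η i * dot k k, ?_, ?_⟩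
  · simpa using hρ.add ((Q.eta_lim.const_mul (2 * Real.pi ^ 2)).mul_const (dot k k))
  · intro i m A A' B hA hA' hB
    have hη := Q.eta_pos i
    have h1 := h i k m A hA
    have hcst : 0 ≤ 2 * Real.pi ^ 2 * η i * dot k k := by
      have := dot_self_nonneg k; positivity
    have hA0 : 0 ≤ A := (abs_nonneg _).trans (hA 0)
    have e : corr (c i) (c i) k (fun n => m n * (freq (η i) k n + 2 * Real.pi ^ 2 * η i * dot k k)) =
        corr (c i) (c i) k (fun n => m n * freq (η i) k n) +
          corr (c i) (c i) k (fun n => m n * (2 * Real.pi ^ 2 * η i * dot k k)) := by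
      simp only [mul_add]
      refine corr_add (Q.summable_sq i) (Q.summable_sq i) k hA'
        (A' := A * (2 * Real.pi ^ 2 * η i * dot k k)) fun n => ?_
      rw [abs_mul, abs_of_nonneg hcst]
      exact mul_le_mul_of_nonneg_right (hA n) hcst
    have h2 : ‖corr (c i) (c i) k (fun n => m n * (2 * Real.pi ^ 2 * η i * dot k k))‖ ≤
        A * (2 * Real.pi ^ 2 * η i * dot k k) :=
      Q.norm_corr_le_of_bound i k fun n => by
        rw [abs_mul, abs_of_nonneg hcst]
        exact mul_le_mul_of_nonneg_right (hA n) hcst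
    have h3 : ‖(η i : ℂ)⁻¹ * ∑' l, v l * corr (c i) (c i) (k + l) (fun n => m (n + l) - m n)‖ ≤
        B * (∑' l, ‖v l‖ * ‖l‖) := by
      have : ‖∑' l, v l * corr (c i) (c i) (k + l) (fun n => m (n + l) - m n)‖ ≤
          (η i * B) * ∑' l, ‖v l‖ * ‖l‖ := by
        refine tsum_of_norm_bounded
          ((summable_pot_mul_norm Q.summable_pot).hasSum.mul_left (η i * B)) fun l => ?_
        rw [norm_mul]
        have := Q.norm_corr_le_of_bound i (k + l) (fun n => hB n l)
        calc _ ≤ ‖v l‖ * (B * (η i * ‖l‖)) := by gcongr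
          _ = _ := by ring
      rw [norm_mul, norm_inv, Complex.norm_real, Real.norm_of_nonneg hη.le]
      calc _ ≤ (η i)⁻¹ * ((η i * B) * ∑' l, ‖v l‖ * ‖l‖) := by gcongr
        _ = _ := by field_simp
    rw [e] at h1
    set x := corr (c i) (c i) k (fun n => m n * freq (η i) k n)
    set y := corr (c i) (c i) k (fun n => m n * (2 * Real.pi ^ 2 * η i * dot k k))
    set z := (η i : ℂ)⁻¹ * ∑' l, v l * corr (c i) (c i) (k + l) (fun n => m (n + l) - m n)
    calc ‖x‖ = ‖(x + y - z) - y + z‖ := by congr 1; ring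
      _ ≤ ‖x + y - z‖ + ‖y‖ + ‖z‖ := (norm_add_le _ _).trans (by gcongr; exact norm_sub_le _ _)
      _ ≤ A * ρ i + A * (2 * Real.pi ^ 2 * η i * dot k k) + B * (∑' l, ‖v l‖ * ‖l‖) := by gcongr
      _ = _ := by ring

/-- At nonzero frequency `k`, only the modes `n` with `η n·k` bounded contribute. -/
theorem norm_corr_high_le (k : Fin 2 → ℤ) {T L : ℝ} (hT : 0 < T) :
    ∃ ρ : ι → ℝ, Tendsto ρ U (𝓝 0) ∧ ∀ (i : ι) (ψ : (Fin 2 → ℤ) → ℝ), (∀ n, |ψ n| ≤ 1) →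
      (∀ n l, |ψ (n + l) - ψ n| ≤ L * (η i * ‖l‖)) →
      ‖corr (c i) (c i) k (fun n => (1 - cutoff T (freq (η i) k n)) * ψ n)‖ ≤
        (8 * Real.pi ^ 2 * ‖k‖ / T ^ 2 + L / T) * (∑' l, ‖v l‖ * ‖l‖) + ρ i := by
  obtain ⟨ρ, hρ, h⟩ := Q.norm_corr_mul_freq_le k
  refine ⟨fun i => 1 / T * ρ i, by simpa using hρ.const_mul (1 / T), fun i ψ hψ hL => ?_⟩
  have hη := Q.eta_pos i
  have e : (fun n => (1 - cutoff T (freq (η i) k n)) * ψ n) =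
      fun n => (resolvent T (freq (η i) k n) * ψ n) * freq (η i) k n := by
    funext n
    rw [← mul_resolvent hT]; ring
  have h1 : ∀ n, |(1 - cutoff T (freq (η i) k n)) * ψ n| ≤ 1 := fun n => by
    rw [abs_mul, abs_of_nonneg (by linarith [cutoff_le_one T (freq (η i) k n)])]
    exact mul_le_one₀ (by linarith [cutoff_nonneg T (freq (η i) k n)]) (abs_nonneg _) (hψ n)
  rw [e]
  refine h i _ (1 / T) 1 _ (fun n => ?_) (fun n => ?_) (fun n l => ?_)
  · rw [abs_mul]
    calc _ ≤ 1 / T * 1 := mul_le_mul (abs_resolvent_le hT _) (hψ n) (abs_nonneg _) (by positivity)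
      _ = _ := mul_one _
  · rw [← congrFun e n]; exact h1 n
  · have h2 := abs_resolvent_sub_le hT (freq (η i) k (n + l)) (freq (η i) k n)
    have h3 : |freq (η i) k (n + l) - freq (η i) k n| ≤ 8 * Real.pi ^ 2 * ‖k‖ * (η i * ‖l‖) := by
      rw [freq_add, add_sub_cancel_left]; exact abs_freq_le hη k l
    have e2 : resolvent T (freq (η i) k (n + l)) * ψ (n + l) - resolvent T (freq (η i) k n) * ψ n =
        (resolvent T (freq (η i) k (n + l)) - resolvent T (freq (η i) k n)) * ψ (n + l) +
          resolvent T (freq (η i) k n) * (ψ (n + l) - ψ n) := by ring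
    rw [e2]
    refine (abs_add_le _ _).trans ?_
    rw [abs_mul, abs_mul]
    calc _ ≤ (1 / T ^ 2 * (8 * Real.pi ^ 2 * ‖k‖ * (η i * ‖l‖))) * 1 +
          1 / T * (L * (η i * ‖l‖)) := by
          refine add_le_add ?_ ?_
          · exact mul_le_mul (h2.trans (by gcongr)) (hψ _) (abs_nonneg _) (by positivity)
          · exact mul_le_mul (abs_resolvent_le hT _) (hL n l) (abs_nonneg _) (by positivity)
      _ = _ := by ring

/-- Independent `p` and `q` control `η n`, so the product of cutoffs is at most a constant times `1
/ (1 + η² |n|²)`, and the mass of `c` escapes from bounded `η n`. -/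
theorem tendsto_corr_cutoff_mul_cutoff {p q : Fin 2 → ℤ} (hpq : cross p q ≠ 0) (k : Fin 2 → ℤ)
    {δ T : ℝ} (hδ : 0 < δ) (hT : 0 < T) :
    Tendsto (fun i => corr (c i) (c i) k
      (fun n => cutoff δ (freq (η i) p n) * cutoff T (freq (η i) q n))) U (𝓝 0) := by
  -- The constant `κ` is chosen so that `(δ² + a²)(T² + b²) ≥ κ (1 + a² + b²)`, by comparing
  -- coefficients.
  obtain ⟨κ, hκ, h1, h2, h3⟩ : ∃ κ > 0, κ ≤ δ ^ 2 * T ^ 2 ∧ κ ≤ T ^ 2 ∧ κ ≤ δ ^ 2 :=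
    ⟨min (δ ^ 2 * T ^ 2) (min (T ^ 2) (δ ^ 2)), by positivity, min_le_left _ _,
      (min_le_right _ _).trans (min_le_left _ _), (min_le_right _ _).trans (min_le_right _ _)⟩
  set S := dot p p + dot q q with hS
  have hS0 : 0 ≤ S := add_nonneg (dot_self_nonneg p) (dot_self_nonneg q)
  set A := δ ^ 2 * T ^ 2 / κ * (1 + 2 * S) with hA
  have hA0 : 0 ≤ A := by positivity
  have hb : ∀ i n, |cutoff δ (freq (η i) p n) * cutoff T (freq (η i) q n)| ≤
      A * (1 / (1 + η i ^ 2 * dot n n)) := fun i n => by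
    have hn := dot_self_nonneg n
    have hη := Q.eta_pos i
    rw [abs_of_nonneg (mul_nonneg (cutoff_nonneg _ _) (cutoff_nonneg _ _))]
    set a := freq (η i) p n with ha
    set b := freq (η i) q n with hb
    have g1 : κ * (1 + a ^ 2 + b ^ 2) ≤ (δ ^ 2 + a ^ 2) * (T ^ 2 + b ^ 2) := by
      nlinarith [mul_nonneg (sq_nonneg a) (sq_nonneg b), sq_nonneg a, sq_nonneg b]
    have g2 : 1 + η i ^ 2 * dot n n ≤ (1 + 2 * S) * (1 + a ^ 2 + b ^ 2) := by
      have g3 := dot_self_le_of_cross_ne_zero hpq n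
      have hpi : (1 : ℝ) ≤ (4 * Real.pi ^ 2) ^ 2 := one_le_pow₀ (by nlinarith [Real.pi_gt_three])
      have g4 : η i ^ 2 * (dot n p ^ 2 + dot n q ^ 2) ≤ a ^ 2 + b ^ 2 := by
        have : a ^ 2 + b ^ 2 = (4 * Real.pi ^ 2) ^ 2 * (η i ^ 2 * (dot n p ^ 2 + dot n q ^ 2)) := by
          rw [ha, hb]; simp only [freq]; ring
        rw [this]
        exact le_mul_of_one_le_left (by positivity) hpi
      have g5 : η i ^ 2 * dot n n ≤ η i ^ 2 * (2 * S * (dot n p ^ 2 + dot n q ^ 2)) := by gcongr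
      have g6 : 2 * S * (η i ^ 2 * (dot n p ^ 2 + dot n q ^ 2)) ≤ 2 * S * (a ^ 2 + b ^ 2) := by
        gcongr
      nlinarith [sq_nonneg a, sq_nonneg b]
    have hab : cutoff δ a * cutoff T b = δ ^ 2 * T ^ 2 / ((δ ^ 2 + a ^ 2) * (T ^ 2 + b ^ 2)) := by
      rw [cutoff, cutoff, div_mul_div_comm]
    rw [hab, mul_one_div, div_le_div_iff₀ (by positivity) (by positivity), hA]
    calc δ ^ 2 * T ^ 2 * (1 + η i ^ 2 * dot n n)
        ≤ δ ^ 2 * T ^ 2 * ((1 + 2 * S) * (1 + a ^ 2 + b ^ 2)) := by gcongr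
      _ = δ ^ 2 * T ^ 2 / κ * (1 + 2 * S) * (κ * (1 + a ^ 2 + b ^ 2)) := by field_simp
      _ ≤ _ := by gcongr
  have hlim : Tendsto (fun i => A * √(∑' n, ‖c i n‖ ^ 2 / (1 + η i ^ 2 * dot n n))) U (𝓝 0) := by
    simpa using (Q.escape.sqrt).const_mul A
  refine squeeze_zero_norm (fun i => ?_) hlim
  set m : (Fin 2 → ℤ) → ℝ := fun n => cutoff δ (freq (η i) p n) * cutoff T (freq (η i) q n)
  have hden : ∀ n, 1 ≤ 1 + η i ^ 2 * dot n n := fun n => by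
    have := dot_self_nonneg n; have := sq_nonneg (η i); nlinarith
  have hesc : Summable fun n => ‖c i n‖ ^ 2 / (1 + η i ^ 2 * dot n n) :=
    Summable.of_nonneg_of_le (fun n => by have := hden n; positivity)
      (fun n => div_le_self (sq_nonneg _) (hden n)) (Q.summable_sq i)
  have hmc : ∀ n, ‖(m n : ℂ) * c i n‖ ^ 2 ≤ A ^ 2 * (‖c i n‖ ^ 2 / (1 + η i ^ 2 * dot n n)) :=
    fun n => by
      have h0 := hden n
      -- One factor of the weight is discarded, so that its square is compared with the single power
      -- appearing in `escape`.
      have hinv : (1 / (1 + η i ^ 2 * dot n n)) ^ 2 ≤ 1 / (1 + η i ^ 2 * dot n n) := by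
        have := div_le_one_of_le₀ h0 (by positivity)
        have h00 : 0 ≤ 1 / (1 + η i ^ 2 * dot n n) := by positivity
        nlinarith
      rw [norm_mul, Complex.norm_real, Real.norm_eq_abs, mul_pow]
      calc |m n| ^ 2 * ‖c i n‖ ^ 2 ≤ (A * (1 / (1 + η i ^ 2 * dot n n))) ^ 2 * ‖c i n‖ ^ 2 := by
            gcongr; exact hb i n
        _ = A ^ 2 * (1 / (1 + η i ^ 2 * dot n n)) ^ 2 * ‖c i n‖ ^ 2 := by ring
        _ ≤ A ^ 2 * (1 / (1 + η i ^ 2 * dot n n)) * ‖c i n‖ ^ 2 := by gcongr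
        _ = _ := by ring
  have hs : Summable fun n => ‖(m n : ℂ) * c i n‖ ^ 2 :=
    Summable.of_nonneg_of_le (fun n => by positivity) hmc (hesc.mul_left _)
  have e : corr (c i) (c i) k m = corr (fun n => (m n : ℂ) * c i n) (c i) k (fun _ => 1) := by
    simp [corr]
  rw [e]
  refine (norm_corr_le hs (Q.summable_sq i) k (A := 1) (by simp)).trans ?_
  rw [one_mul, Q.ellTwo_eq, mul_one, ellTwo]
  calc _ ≤ √(A ^ 2 * ∑' n, ‖c i n‖ ^ 2 / (1 + η i ^ 2 * dot n n)) := by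
        refine Real.sqrt_le_sqrt ?_
        rw [← tsum_mul_left]
        exact hs.tsum_le_tsum hmc (hesc.mul_left _)
    _ = _ := by rw [Real.sqrt_mul (sq_nonneg _), Real.sqrt_sq hA0]

end FourierQuasimode

/-! ### Limits of localized correlations -/

variable {v : (Fin 2 → ℤ) → ℂ}

theorem cutoff_mul_left {t : ℝ} (ht : t ≠ 0) (δ w : ℝ) : cutoff (t * δ) (t * w) = cutoff δ w := by
  unfold cutoff
  rw [mul_pow, mul_pow, ← mul_add, mul_div_mul_left _ _ (pow_ne_zero 2 ht)]

theorem corr_zero_re (a : (Fin 2 → ℤ) → ℂ) (ha : Summable fun n => ‖a n‖ ^ 2)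
    (m : (Fin 2 → ℤ) → ℝ) {A : ℝ} (hm : ∀ n, |m n| ≤ A) :
    HasSum (fun n => m n * ‖a n‖ ^ 2) (corr a a 0 m).re := by
  have h := Complex.hasSum_re (summable_corr ha ha 0 hm).hasSum
  refine h.congr_fun fun n => ?_
  rw [add_zero, mul_assoc, Complex.mul_conj, ← Complex.ofReal_mul, Complex.ofReal_re,
    Complex.normSq_eq_norm_sq]

/-- With `s` the sum, `2 s - 1 ≤ s²`, while `s² ≤ s + (off-diagonal terms)` because `x p ^ 2 ≤ x p`.
Applied to cutoffs, whose pairwise products vanish in the limit, it bounds the total mass. -/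
theorem sum_le_one_add_sum_offDiag {α : Type*} [DecidableEq α] (F : Finset α) (x : α → ℝ)
    (h0 : ∀ p ∈ F, 0 ≤ x p) (h1 : ∀ p ∈ F, x p ≤ 1) :
    ∑ p ∈ F, x p ≤ 1 + ∑ z ∈ F.offDiag, x z.1 * x z.2 := by
  have e1 : (∑ p ∈ F, x p) * (∑ p ∈ F, x p) =
      ∑ p ∈ F, x p * x p + ∑ z ∈ F.offDiag, x z.1 * x z.2 := by
    rw [Finset.sum_mul_sum, ← Finset.sum_product', ← Finset.diag_union_offDiag,
      Finset.sum_union (Finset.disjoint_diag_offDiag F), Finset.sum_diag]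
  have e2 : ∑ p ∈ F, x p * x p ≤ ∑ p ∈ F, x p :=
    Finset.sum_le_sum fun p hp => mul_le_of_le_one_left (h0 p hp) (h1 p hp)
  nlinarith [sq_nonneg (∑ p ∈ F, x p - 1)]

namespace FourierQuasimode

variable {ι : Type*} {U : Filter ι} {c : ι → (Fin 2 → ℤ) → ℂ} {η : ι → ℝ}
  (Q : FourierQuasimode U v c η)
include Q

theorem abs_cutoff_freq_sub_le (i : ι) (p n l : Fin 2 → ℤ) {δ : ℝ} (hδ : 0 < δ) :
    |cutoff δ (freq (η i) p (n + l)) - cutoff δ (freq (η i) p n)| ≤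
      2 / δ * (8 * Real.pi ^ 2 * ‖p‖) * (η i * ‖l‖) := by
  refine (abs_cutoff_sub_le hδ _ _).trans ?_
  rw [freq_add, add_sub_cancel_left, mul_assoc (2 / δ)]
  have := abs_freq_le (Q.eta_pos i) p l
  gcongr

/-- The correlation is split at momentum `T` along `k`. The high part tends to zero as `T` grows,
uniformly up to `o(1)`; the low part is confined in two independent directions and so vanishes in
the limit for each fixed `T`. -/
theorem tendsto_corr_cutoff_of_cross_ne_zero {k p : Fin 2 → ℤ} (hkp : cross k p ≠ 0) {δ : ℝ}
    (hδ : 0 < δ) :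
    Tendsto (fun i => corr (c i) (c i) k (fun n => cutoff δ (freq (η i) p n))) U (𝓝 0) := by
  rw [tendsto_zero_iff_norm_tendsto_zero, Metric.tendsto_nhds]
  intro ε hε
  set Cv := ∑' l, ‖v l‖ * ‖l‖ with hCv
  set L := 2 / δ * (8 * Real.pi ^ 2 * ‖p‖) with hL
  have hT : Tendsto (fun T : ℝ => (8 * Real.pi ^ 2 * ‖k‖ / T ^ 2 + L / T) * Cv) atTop (𝓝 0) := by
    have h1 : Tendsto (fun T : ℝ => 8 * Real.pi ^ 2 * ‖k‖ / T ^ 2) atTop (𝓝 0) :=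
      tendsto_const_nhds.div_atTop (tendsto_pow_atTop two_ne_zero)
    have h2 : Tendsto (fun T : ℝ => L / T) atTop (𝓝 0) := tendsto_const_nhds.div_atTop tendsto_id
    simpa using (h1.add h2).mul_const Cv
  obtain ⟨T, hTε, hT0⟩ := ((hT.eventually (gt_mem_nhds (by positivity : (0 : ℝ) < ε / 3))).and
    (eventually_gt_atTop 0)).exists
  obtain ⟨ρ, hρ, hbound⟩ := Q.norm_corr_high_le k (L := L) hT0
  have hlow := Q.tendsto_corr_cutoff_mul_cutoff hkp k hT0 hδ
  rw [tendsto_zero_iff_norm_tendsto_zero] at hlow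
  filter_upwards [hρ.eventually (gt_mem_nhds (by positivity : (0 : ℝ) < ε / 3)),
    hlow.eventually (gt_mem_nhds (by positivity : (0 : ℝ) < ε / 3))] with i h1 h2
  have h3 := hbound i (fun n => cutoff δ (freq (η i) p n)) (fun n => abs_cutoff_le _ _)
    (fun n l => Q.abs_cutoff_freq_sub_le i p n l hδ)
  have e : corr (c i) (c i) k (fun n => cutoff δ (freq (η i) p n)) =
      corr (c i) (c i) k (fun n => (1 - cutoff T (freq (η i) k n)) * cutoff δ (freq (η i) p n)) +
      corr (c i) (c i) k (fun n => cutoff T (freq (η i) k n) * cutoff δ (freq (η i) p n)) := by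
    rw [← corr_add (Q.summable_sq i) (Q.summable_sq i) k (A := 1) (A' := 1)]
    · congr 1; funext n; ring
    · intro n
      rw [abs_mul, abs_of_nonneg (sub_nonneg.2 (cutoff_le_one _ _))]
      exact mul_le_one₀ (by linarith [cutoff_nonneg T (freq (η i) k n)]) (abs_nonneg _)
        (abs_cutoff_le _ _)
    · intro n
      rw [abs_mul]
      exact mul_le_one₀ (abs_cutoff_le _ _) (abs_nonneg _) (abs_cutoff_le _ _)
  rw [dist_zero_right, norm_norm, e]
  refine (norm_add_le _ _).trans_lt ?_
  linarith

/-- Since `freq (j • p) = j * freq p`, cutting off at scale `|j| δ` along `j • p` is cutting off at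
scale `δ` along `p`. The bound `‖j • p‖ / (|j| δ)²` then decays in `j`. -/
theorem norm_corr_sub_cutoff_le {p : Fin 2 → ℤ} {j : ℤ} (hj : j ≠ 0) {δ : ℝ} (hδ : 0 < δ) :
    ∃ ρ : ι → ℝ, Tendsto ρ U (𝓝 0) ∧ ∀ i,
      ‖corr (c i) (c i) (j • p) (fun _ => 1) -
        corr (c i) (c i) (j • p) (fun n => cutoff δ (freq (η i) p n))‖ ≤
      8 * Real.pi ^ 2 * ‖p‖ / (δ ^ 2 * |(j : ℝ)|) * (∑' l, ‖v l‖ * ‖l‖) + ρ i := by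
  have hj' : (0 : ℝ) < |(j : ℝ)| := by positivity
  obtain ⟨ρ, hρ, h⟩ := Q.norm_corr_high_le (j • p) (L := 0) (T := |(j : ℝ)| * δ) (by positivity)
  refine ⟨ρ, hρ, fun i => ?_⟩
  have h1 := h i (fun _ => 1) (by simp) (by simp)
  have e : (fun n => (1 - cutoff (|(j : ℝ)| * δ) (freq (η i) (j • p) n)) * (1 : ℝ)) =
      fun n => 1 - cutoff δ (freq (η i) p n) := by
    funext n
    rw [freq_smul, mul_one]
    congr 1
    rw [← cutoff_mul_left (Int.cast_ne_zero.2 hj : (j : ℝ) ≠ 0) δ]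
    simp only [cutoff, mul_pow, sq_abs]
  rw [e, corr_sub (Q.summable_sq i) (Q.summable_sq i) _ (A := 1) (A' := 1) (by simp)
    (fun n => abs_cutoff_le _ _)] at h1
  refine h1.trans (le_of_eq ?_)
  have : ‖j • p‖ = |(j : ℝ)| * ‖p‖ := by
    rw [norm_smul, Int.norm_eq_abs]
  rw [this, zero_div, add_zero]
  field_simp

/-- The commutator relation at `k = j • p` with multiplier `virial δ` of the momentum along `p`. On
one side the momentum times the multiplier is at most `|j| δ`; on the other the difference quotient
converges to the derivative of `virial`, the multiplier of `a - δ b`. -/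
theorem norm_virial_sum_le [U.NeBot] {p : Fin 2 → ℤ} (j : ℤ) {δ : ℝ} (hδ : 0 < δ) (hδ1 : δ ≤ 1)
    {a b : (Fin 2 → ℤ) → ℂ}
    (ha : ∀ k, Tendsto (fun i => corr (c i) (c i) k (fun n => cutoff δ (freq (η i) p n))) U (𝓝 (a k)))
    (hb : ∀ k, Tendsto (fun i => corr (c i) (c i) k (fun n => cutoff 1 (freq (η i) p n))) U (𝓝 (b k))) :
    ‖∑' l, v l * ((4 * Real.pi ^ 2 * dot l p : ℝ) * (a (j • p + l) - δ * b (j • p + l)))‖ ≤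
      |(j : ℝ)| * δ := by
  obtain ⟨ρ, hρ, h⟩ := Q.commutator
  set k := j • p with hk
  set m : ι → (Fin 2 → ℤ) → ℝ := fun i n => virial δ (freq (η i) p n) with hm
  have hmb : ∀ i n, |m i n| ≤ δ * Real.pi := fun i n => abs_virial_le hδ _
  have hmf : ∀ i n, |m i n * freq (η i) k n| ≤ |(j : ℝ)| * δ := fun i n => by
    rw [hk, freq_smul, mul_left_comm, abs_mul]
    exact mul_le_mul_of_nonneg_left (abs_virial_mul_le hδ hδ1 _) (abs_nonneg _)
  have hpot := summable_pot_mul_norm Q.summable_pot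
  -- the discrete gradient of the multiplier
  have hterm : ∀ l, Tendsto (fun i => (η i : ℂ)⁻¹ * (v l * corr (c i) (c i) (k + l)
      (fun n => m i (n + l) - m i n))) U
      (𝓝 (v l * ((4 * Real.pi ^ 2 * dot l p : ℝ) * (a (k + l) - δ * b (k + l))))) := fun l => by
    set w := 4 * Real.pi ^ 2 * dot l p with hw
    have hmain : Tendsto (fun i => (w : ℂ) * (corr (c i) (c i) (k + l)
        (fun n => cutoff δ (freq (η i) p n)) - δ * corr (c i) (c i) (k + l)
        (fun n => cutoff 1 (freq (η i) p n)))) U (𝓝 ((w : ℂ) * (a (k + l) - δ * b (k + l)))) :=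
      ((ha _).sub ((hb _).const_mul _)).const_mul _
    -- Second-order Taylor error: the momentum increment is `η w`, so after division by `η` a term
    -- of order `η` remains.
    have herr : Tendsto (fun i => (η i : ℂ)⁻¹ * corr (c i) (c i) (k + l)
        (fun n => m i (n + l) - m i n) - (w : ℂ) * (corr (c i) (c i) (k + l)
        (fun n => cutoff δ (freq (η i) p n)) - δ * corr (c i) (c i) (k + l)
        (fun n => cutoff 1 (freq (η i) p n)))) U (𝓝 0) := by
      refine squeeze_zero_norm (a := fun i => (2 / δ + 2 * δ) * w ^ 2 * η i) (fun i => ?_)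
        (by simpa using Q.eta_lim.const_mul ((2 / δ + 2 * δ) * w ^ 2))
      have hη := Q.eta_pos i
      have hη' : (η i : ℂ) ≠ 0 := by exact_mod_cast hη.ne'
      have hfl : freq (η i) p l = η i * w := by rw [freq, hw]; ring
      have b1 : ∀ n, |cutoff δ (freq (η i) p n) - δ * cutoff 1 (freq (η i) p n)| ≤ 1 + δ := fun n => by
        refine (abs_sub _ _).trans ?_
        rw [abs_mul, abs_of_pos hδ]
        have := abs_cutoff_le δ (freq (η i) p n)
        have := abs_cutoff_le 1 (freq (η i) p n)
        nlinarith
      have b2 : ∀ n, |m i (n + l) - m i n| ≤ δ * Real.pi + δ * Real.pi := fun n =>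
        (abs_sub _ _).trans (add_le_add (hmb _ _) (hmb _ _))
      have e : (η i : ℂ)⁻¹ * corr (c i) (c i) (k + l)
        (fun n => m i (n + l) - m i n) - (w : ℂ) * (corr (c i) (c i) (k + l)
        (fun n => cutoff δ (freq (η i) p n)) - δ * corr (c i) (c i) (k + l)
        (fun n => cutoff 1 (freq (η i) p n))) = (η i : ℂ)⁻¹ * corr (c i) (c i) (k + l)
          (fun n => (m i (n + l) - m i n) - (η i * w) *
            (cutoff δ (freq (η i) p n) - δ * cutoff 1 (freq (η i) p n))) := by
        rw [corr_sub (Q.summable_sq i) (Q.summable_sq i) _ b2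
          (A' := |η i * w| * (1 + δ)) (fun n => by
            rw [abs_mul]; exact mul_le_mul_of_nonneg_left (b1 n) (abs_nonneg _)),
          corr_smul, corr_sub (Q.summable_sq i) (Q.summable_sq i) _ (A := 1) (A' := δ)
          (fun n => abs_cutoff_le _ _) (fun n => by
            rw [abs_mul, abs_of_pos hδ]
            exact mul_le_of_le_one_right hδ.le (abs_cutoff_le _ _)), corr_smul]
        push_cast
        field_simp
      rw [e, norm_mul, norm_inv, Complex.norm_real, Real.norm_of_nonneg hη.le]
      have b3 := Q.norm_corr_le_of_bound i (k + l) (m := fun n => (m i (n + l) - m i n) - (η i * w) *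
            (cutoff δ (freq (η i) p n) - δ * cutoff 1 (freq (η i) p n)))
            (A := (2 / δ + 2 * δ) * (η i * w) ^ 2) fun n => by
          have := abs_virial_taylor hδ (freq (η i) p n) (η i * w)
          simp only [hm]
          rwa [freq_add, hfl]
      calc _ ≤ (η i)⁻¹ * ((2 / δ + 2 * δ) * (η i * w) ^ 2) := by gcongr
        _ = _ := by field_simp
    have := (herr.add hmain).const_mul (v l)
    simp only [sub_add_cancel, zero_add] at this
    refine this.congr fun i => ?_
    ring
  -- The Lipschitz constant 2 of `virial` gives a bound in `l` independent of `i`, as dominated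
  -- convergence requires.
  have hdom : ∀ i l, ‖(η i : ℂ)⁻¹ * (v l * corr (c i) (c i) (k + l) (fun n => m i (n + l) - m i n))‖ ≤
      ‖v l‖ * ‖l‖ * (2 * (8 * Real.pi ^ 2 * ‖p‖)) := fun i l => by
    have hη := Q.eta_pos i
    rw [norm_mul, norm_mul, norm_inv, Complex.norm_real, Real.norm_of_nonneg hη.le]
    have := Q.norm_corr_le_of_bound i (k + l) (m := fun n => m i (n + l) - m i n)
      (A := 2 * (8 * Real.pi ^ 2 * ‖p‖ * (η i * ‖l‖))) fun n => by
        refine (abs_virial_sub_le hδ hδ1 _ _).trans ?_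
        rw [freq_add, add_sub_cancel_left]
        exact mul_le_mul_of_nonneg_left (abs_freq_le hη p l) (by norm_num)
    calc _ ≤ (η i)⁻¹ * (‖v l‖ * (2 * (8 * Real.pi ^ 2 * ‖p‖ * (η i * ‖l‖)))) := by gcongr
      _ = _ := by field_simp
  have hlim := tendsto_tsum_of_dominated_convergence (hpot.mul_right _) hterm
    (Eventually.of_forall hdom)
  have hup : Tendsto (fun i => |(j : ℝ)| * δ + δ * Real.pi * (2 * Real.pi ^ 2 * η i * dot k k) +
      δ * Real.pi * ρ i) U (𝓝 (|(j : ℝ)| * δ)) := by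
    have h1 := ((Q.eta_lim.const_mul (2 * Real.pi ^ 2)).mul_const (dot k k)).const_mul (δ * Real.pi)
    have h2 := hρ.const_mul (δ * Real.pi)
    simpa using (h1.const_add (|(j : ℝ)| * δ)).add h2
  refine le_of_tendsto_of_tendsto' hlim.norm hup fun i => ?_
  rw [tsum_mul_left]
  have hη := Q.eta_pos i
  have h1 := h i k (m i) _ (hmb i)
  have hcst : 0 ≤ 2 * Real.pi ^ 2 * η i * dot k k := by
    have := dot_self_nonneg k; positivity
  have h2 := Q.norm_corr_le_of_bound i k
    (m := fun n => m i n * (freq (η i) k n + 2 * Real.pi ^ 2 * η i * dot k k))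
    (A := |(j : ℝ)| * δ + δ * Real.pi * (2 * Real.pi ^ 2 * η i * dot k k)) fun n => by
      rw [mul_add]
      refine (abs_add_le _ _).trans (add_le_add (hmf i n) ?_)
      rw [abs_mul, abs_of_nonneg hcst]
      exact mul_le_mul_of_nonneg_right (hmb i n) hcst
  rw [norm_sub_rev] at h1
  have h3 := norm_le_norm_add_norm_sub' ((η i : ℂ)⁻¹ * ∑' l, v l * corr (c i) (c i) (k + l)
    (fun n => m i (n + l) - m i n)) (corr (c i) (c i) k
    (fun n => m i n * (freq (η i) k n + 2 * Real.pi ^ 2 * η i * dot k k)))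
  linarith

theorem sum_mass_le_one [U.NeBot] (F : Finset (Fin 2 → ℤ)) (hF : ∀ p ∈ F, ∀ q ∈ F, p ≠ q → cross p q ≠ 0)
    {δ : (Fin 2 → ℤ) → ℝ} (hδ : ∀ p, 0 < δ p) {a : (Fin 2 → ℤ) → ℝ}
    (ha : ∀ p ∈ F, Tendsto (fun i => corr (c i) (c i) 0 (fun n => cutoff (δ p) (freq (η i) p n))) U
      (𝓝 (a p : ℂ))) : ∑ p ∈ F, a p ≤ 1 := by
  classical
  have h1 : Tendsto (fun i => ∑ p ∈ F,
      (corr (c i) (c i) 0 (fun n => cutoff (δ p) (freq (η i) p n))).re) U (𝓝 (∑ p ∈ F, a p)) :=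
    tendsto_finsetSum _ fun p hp => by
      simpa [Function.comp_def] using (Complex.continuous_re.tendsto _).comp (ha p hp)
  have h2 : Tendsto (fun i => 1 + ∑ z ∈ F.offDiag, (corr (c i) (c i) 0
      (fun n => cutoff (δ z.1) (freq (η i) z.1 n) * cutoff (δ z.2) (freq (η i) z.2 n))).re) U
      (𝓝 (1 + ∑ z ∈ F.offDiag, 0)) := by
    refine (tendsto_finsetSum _ fun z hz => ?_).const_add 1
    rw [Finset.mem_offDiag] at hz
    simpa [Function.comp_def] using (Complex.continuous_re.tendsto _).comp
      (Q.tendsto_corr_cutoff_mul_cutoff (hF _ hz.1 _ hz.2.1 hz.2.2) 0 (hδ z.1) (hδ z.2))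
  rw [Finset.sum_const_zero, add_zero] at h2
  refine le_of_tendsto_of_tendsto' h1 h2 fun i => ?_
  have hs1 := hasSum_sum (s := F) fun p _ => corr_zero_re (c i) (Q.summable_sq i)
    (fun n => cutoff (δ p) (freq (η i) p n)) (fun n => abs_cutoff_le _ _)
  have hs2 := hasSum_sum (s := F.offDiag) fun z _ => corr_zero_re (c i) (Q.summable_sq i)
    (fun n => cutoff (δ z.1) (freq (η i) z.1 n) * cutoff (δ z.2) (freq (η i) z.2 n)) (A := 1)
    (fun n => by
      rw [abs_mul]; exact mul_le_one₀ (abs_cutoff_le _ _) (abs_nonneg _) (abs_cutoff_le _ _))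
  have hs3 : HasSum (fun n => ‖c i n‖ ^ 2) 1 := by
    have h := (Q.summable_sq i).hasSum
    have h1 := Q.ellTwo_eq i
    rw [ellTwo, Real.sqrt_eq_one] at h1
    rwa [h1] at h
  refine hasSum_le (fun n => ?_) hs1 (hs3.add hs2)
  rw [← Finset.sum_mul, ← Finset.sum_mul]
  have := mul_le_mul_of_nonneg_right (sum_le_one_add_sum_offDiag F
    (fun p => cutoff (δ p) (freq (η i) p n)) (fun _ _ => cutoff_nonneg _ _)
    (fun _ _ => cutoff_le_one _ _)) (sq_nonneg ‖c i n‖)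
  linarith

end FourierQuasimode

/-! ### Smooth functions and decay of their coefficients -/

theorem isOpenQuotientMap_toTorus : IsOpenQuotientMap toTorus := by
  have h : IsOpenQuotientMap (Pi.map fun (_ : Fin 2) (t : ℝ) => (t : UnitAddCircle)) :=
    IsOpenQuotientMap.piMap fun _ => QuotientAddGroup.isOpenQuotientMap_mk
  exact h.comp (PiLp.homeomorph 2 (fun _ : Fin 2 => ℝ)).isOpenQuotientMap

/-- The Fourier phase `y ↦ 2πi n·y` as a linear form on the plane. -/
noncomputable def phase (n : Fin 2 → ℤ) : Plane →L[ℝ] ℂ :=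
  (2 * Real.pi * Complex.I * n 0) • Complex.ofRealCLM.comp (EuclideanSpace.proj (0 : Fin 2)) +
    (2 * Real.pi * Complex.I * n 1) • Complex.ofRealCLM.comp (EuclideanSpace.proj (1 : Fin 2))

theorem phase_apply (n : Fin 2 → ℤ) (y : Plane) :
    phase n y = 2 * Real.pi * Complex.I * (n 0 * y 0 + n 1 * y 1) := by
  simp [phase]; ring

theorem mFourier_toTorus_eq_exp_phase (n : Fin 2 → ℤ) (y : Plane) :
    mFourier n (toTorus y) = Complex.exp (phase n y) := by
  rw [mFourier_toTorus, phase_apply]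

theorem hasFDerivAt_mFourier (n : Fin 2 → ℤ) (x : Torus) (y : Plane) :
    HasFDerivAt (fun y : Plane => mFourier n (x + toTorus y))
      (mFourier n (x + toTorus y) • phase n) y := by
  simp only [mFourier_add_point, mFourier_toTorus_eq_exp_phase]
  have := ((phase n).hasFDerivAt (x := y)).cexp.const_mul (mFourier n x)
  refine this.congr_fderiv ?_
  rw [smul_smul]

theorem smoothOnTorus_mFourier (n : Fin 2 → ℤ) : SmoothOnTorus (mFourier n) := by
  unfold SmoothOnTorus
  simp only [mFourier_toTorus_eq_exp_phase]
  exact (phase n).contDiff.cexp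

theorem torusLaplacian_mFourier (n : Fin 2 → ℤ) (x : Torus) :
    torusLaplacian (mFourier n) x = -(4 * Real.pi ^ 2 * dot n n : ℝ) * mFourier n x := by
  unfold torusLaplacian
  rw [InnerProductSpace.laplacian_eq_iteratedFDeriv_orthonormalBasis _
    (EuclideanSpace.basisFun (Fin 2) ℝ)]
  have h1 : fderiv ℝ (fun y : Plane => mFourier n (x + toTorus y)) =
      fun y => mFourier n (x + toTorus y) • phase n :=
    funext fun y => (hasFDerivAt_mFourier n x y).fderiv
  have h2 : fderiv ℝ (fun y : Plane => mFourier n (x + toTorus y) • phase n) 0 =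
      (mFourier n (x + toTorus 0) • phase n).smulRight (phase n) :=
    ((hasFDerivAt_mFourier n x 0).smul_const (phase n)).fderiv
  simp only [iteratedFDeriv_two_apply, h1, h2]
  simp [Fin.sum_univ_two, phase_apply, toTorus_zero, dot]
  ring_nf
  simp only [Complex.I_sq]
  ring

variable {F : Type*} [NormedAddCommGroup F] [NormedSpace ℝ F]

theorem SmoothOnTorus.continuous {f : Torus → F} (hf : SmoothOnTorus f) : Continuous f :=
  isOpenQuotientMap_toTorus.isQuotientMap.continuous_iff.2 (ContDiff.continuous hf)

/-- The partial derivative of a function on the torus. -/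
noncomputable def partialDeriv (i : Fin 2) (f : Torus → F) (x : Torus) : F :=
  fderiv ℝ (fun y : Plane => f (x + toTorus y)) 0 (EuclideanSpace.single i 1)

theorem partialDeriv_toTorus (i : Fin 2) (f : Torus → F) (y : Plane) :
    partialDeriv i f (toTorus y) =
      fderiv ℝ (fun y : Plane => f (toTorus y)) y (EuclideanSpace.single i 1) := by
  unfold partialDeriv
  simp only [← toTorus_add]
  rw [fderiv_comp_add_left (f := fun y => f (toTorus y)), add_zero]

theorem SmoothOnTorus.partialDeriv {f : Torus → F} (hf : SmoothOnTorus f) (i : Fin 2) :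
    SmoothOnTorus (partialDeriv i f) := by
  unfold SmoothOnTorus
  simp only [partialDeriv_toTorus]
  exact (ContDiff.fderiv_right (m := ∞) hf (by simp)).clm_apply contDiff_const

theorem SmoothOnTorus.hasDerivAt {f : Torus → F} (hf : SmoothOnTorus f) (i : Fin 2) (x : Torus)
    (t : ℝ) : HasDerivAt (fun t : ℝ => f (x + toTorus (t • EuclideanSpace.single i 1)))
      (Torus.partialDeriv i f (x + toTorus (t • EuclideanSpace.single i 1))) t := by
  obtain ⟨y, rfl⟩ := toTorus_surjective x
  simp only [← toTorus_add, partialDeriv_toTorus]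
  have h1 : HasFDerivAt (fun y : Plane => f (toTorus y)) _ (y + t • EuclideanSpace.single i 1) :=
    ((ContDiff.differentiable hf (by simp)) _).hasFDerivAt
  have h2 : HasDerivAt (fun t : ℝ => y + t • (EuclideanSpace.single i 1 : Plane))
      (EuclideanSpace.single i 1) t := by
    simpa using ((hasDerivAt_id t).smul_const (EuclideanSpace.single i 1 : Plane)).const_add y
  exact h1.comp_hasDerivAt t h2

theorem exists_bound {f : Torus → ℂ} (hf : Continuous f) : ∃ C, ∀ x, ‖f x‖ ≤ C := by
  obtain ⟨C, hC⟩ := isCompact_univ.exists_bound_of_continuousOn hf.continuousOn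
  exact ⟨C, fun x => hC x (mem_univ x)⟩

theorem integrable_of_continuous (μ : Measure Torus) [IsFiniteMeasure μ] {f : Torus → ℂ}
    (hf : Continuous f) : Integrable f μ := integrable_continuousMap μ ⟨f, hf⟩

/-- In place of integration by parts, the coefficient of the translate `f (· + E t)` is
differentiated at `t = 0` in two ways: under the integral, and after moving the translation onto the
character. -/
theorem coeff_partialDeriv {f : Torus → ℂ} (hf : SmoothOnTorus f) (i : Fin 2) (n : Fin 2 → ℤ) :
    coeff (partialDeriv i f) n = 2 * Real.pi * Complex.I * n i * coeff f n := by
  set E : ℝ → Torus := fun t => toTorus (t • EuclideanSpace.single i 1) with hE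
  have hc := SmoothOnTorus.continuous hf
  have hc' := SmoothOnTorus.continuous (SmoothOnTorus.partialDeriv hf i)
  obtain ⟨C, hC⟩ := exists_bound hc'
  have h1 : HasDerivAt (fun t : ℝ => ∫ x, f (x + E t) * mFourier (-n) x)
      (∫ x, partialDeriv i f (x + E 0) * mFourier (-n) x) 0 := by
    refine (hasDerivAt_integral_of_dominated_loc_of_deriv_le (s := univ) (bound := fun _ => C)
      (F' := fun t x => partialDeriv i f (x + E t) * mFourier (-n) x) univ_mem
      (Eventually.of_forall fun t => ?_) ?_ ?_ ?_ (integrable_const C) ?_).2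
    · exact Continuous.aestronglyMeasurable (by fun_prop)
    · exact integrable_of_continuous _ (by fun_prop)
    · exact Continuous.aestronglyMeasurable (by fun_prop)
    · refine Eventually.of_forall fun x t _ => ?_
      rw [norm_mul, norm_mFourier_apply, mul_one]
      exact hC _
    · exact Eventually.of_forall fun x t _ => (SmoothOnTorus.hasDerivAt hf i x t).mul_const _
  have h2 : ∀ t, ∫ x, f (x + E t) * mFourier (-n) x = mFourier n (E t) * coeff f n := fun t => by
    rw [coeff, ← integral_const_mul, ← integral_add_right_eq_self
      (fun x => mFourier n (E t) * (f x * mFourier (-n) x)) (E t)]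
    refine integral_congr_ae (Eventually.of_forall fun x => ?_)
    have : mFourier n (E t) * mFourier (-n) (E t) = 1 := by
      rw [← mFourier_add]; simp [mFourier_zero]
    simp only [mFourier_add_point]
    linear_combination -(f (x + E t) * mFourier (-n) x) * this
  have h3 : HasDerivAt (fun t : ℝ => mFourier n (E t) * coeff f n)
      (2 * Real.pi * Complex.I * n i * coeff f n) 0 := by
    refine HasDerivAt.mul_const ?_ _
    have := SmoothOnTorus.hasDerivAt (smoothOnTorus_mFourier n) i 0 0
    simp only [zero_add, zero_smul, toTorus_zero] at this
    refine this.congr_deriv ?_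
    rw [partialDeriv, (hasFDerivAt_mFourier n 0 0).fderiv]
    fin_cases i <;> simp [toTorus_zero, phase_apply, mFourier]
  simp only [h2] at h1
  have h4 := h1.unique h3
  have h0 : E 0 = 0 := by simp [hE, toTorus_zero]
  simpa [h0, coeff] using h4

theorem exists_coeff_decay (i : Fin 2) (N : ℕ) : ∀ {f : Torus → ℂ}, SmoothOnTorus f →
    ∃ C, ∀ n, |(n i : ℝ)| ^ N * ‖coeff f n‖ ≤ C := by
  induction N with
  | zero =>
    intro f hf
    obtain ⟨C, hC⟩ := exists_bound (SmoothOnTorus.continuous hf)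
    refine ⟨C, fun n => ?_⟩
    rw [pow_zero, one_mul, coeff]
    refine (norm_integral_le_of_norm_le_const (C := C) (Eventually.of_forall fun x => ?_)).trans ?_
    · rw [norm_mul, norm_mFourier_apply, mul_one]; exact hC x
    · simp
  | succ N ih =>
    intro f hf
    obtain ⟨C, hC⟩ := ih (SmoothOnTorus.partialDeriv hf i)
    refine ⟨C, fun n => le_trans ?_ (hC n)⟩
    rw [coeff_partialDeriv hf, pow_succ, mul_assoc]
    refine mul_le_mul_of_nonneg_left ?_ (by positivity)
    have h1 : ‖(2 * Real.pi * Complex.I * n i : ℂ)‖ = 2 * Real.pi * |(n i : ℝ)| := by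
      simp [abs_of_pos Real.pi_pos]
    rw [norm_mul, h1]
    refine mul_le_mul_of_nonneg_right ?_ (norm_nonneg _)
    exact le_mul_of_one_le_left (abs_nonneg _) (by nlinarith [Real.pi_gt_three])

theorem summable_coeff {f : Torus → ℂ} (hf : SmoothOnTorus f) :
    Summable fun l => ‖coeff f l‖ * (1 + ‖l‖) ^ 2 := by
  -- Five powers: two for the weight `(1 + ‖l‖) ^ 2`, and three for summability over the plane
  -- lattice.
  obtain ⟨C0, h0⟩ := exists_coeff_decay 0 5 hf
  obtain ⟨C1, h1⟩ := exists_coeff_decay 1 5 hf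
  have hs := (EisensteinSeries.summable_one_div_norm_rpow (k := 3) (by norm_num)).mul_left
    (4 * (C0 + C1))
  refine Summable.of_norm_bounded_eventually hs ?_
  rw [eventually_cofinite]
  refine (finite_singleton (0 : Fin 2 → ℤ)).subset fun l hl => ?_
  by_contra hne
  refine hl ?_
  have hl1 : 1 ≤ ‖l‖ := by
    obtain ⟨i, hi⟩ := Function.ne_iff.mp (hne : l ≠ 0)
    refine le_trans ?_ (abs_coord_le l i)
    exact_mod_cast Int.one_le_abs hi
  have hC0 : 0 ≤ C0 := le_trans (by positivity) (h0 l)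
  have hC1 : 0 ≤ C1 := le_trans (by positivity) (h1 l)
  have hmax : ‖l‖ ^ 5 * ‖coeff f l‖ ≤ C0 + C1 := by
    have : ‖l‖ = max |(l 0 : ℝ)| |(l 1 : ℝ)| := by
      refine le_antisymm ?_ (max_le (abs_coord_le l 0) (abs_coord_le l 1))
      refine (pi_norm_le_iff_of_nonneg (by positivity)).2 fun i => ?_
      rw [Int.norm_eq_abs]
      fin_cases i
      · exact le_max_left _ _
      · exact le_max_right _ _
    rw [this]
    rcases max_choice |(l 0 : ℝ)| |(l 1 : ℝ)| with h | h <;> rw [h]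
    · linarith [h0 l]
    · linarith [h1 l]
  rw [Real.norm_of_nonneg (by positivity), Real.rpow_neg (by positivity),
    show (3 : ℝ) = ((3 : ℕ) : ℝ) by norm_num, Real.rpow_natCast, ← div_eq_mul_inv,
    le_div_iff₀ (by positivity)]
  calc ‖coeff f l‖ * (1 + ‖l‖) ^ 2 * ‖l‖ ^ 3 ≤ ‖coeff f l‖ * (2 * ‖l‖) ^ 2 * ‖l‖ ^ 3 := by
        gcongr; linarith
    _ = 4 * (‖l‖ ^ 5 * ‖coeff f l‖) := by ring
    _ ≤ _ := by gcongr

/-! ### From the equation on the torus to Fourier variables -/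

theorem integrable_Lp (u : Lp ℂ 2 (volume : Measure Torus)) : Integrable u volume :=
  (Lp.memLp u).integrable (by norm_num)

theorem integrable_Lp_mul (u : Lp ℂ 2 (volume : Measure Torus)) {f : Torus → ℂ}
    (hf : Continuous f) : Integrable (fun x => u x * f x) volume := by
  obtain ⟨C, hC⟩ := exists_bound hf
  exact (integrable_Lp u).mul_bdd hf.aestronglyMeasurable (Eventually.of_forall hC)

theorem hasSum_coeff_mul {V : Torus → ℂ} (hV : Continuous V) (hs : Summable fun l => ‖coeff V l‖)
    (u : Lp ℂ 2 (volume : Measure Torus)) (n : Fin 2 → ℤ) :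
    HasSum (fun l => coeff V l * coeff u (n - l)) (coeff (fun x => u x * V x) n) := by
  have h := hasSum_integral_of_summable_integral_norm (μ := (volume : Measure Torus))
    (F := fun l x => u x * (coeff V l * mFourier (-(n - l)) x))
    (fun l => integrable_Lp_mul u (by fun_prop)) ?_
  · have e : ∀ l, ∫ x, u x * (coeff V l * mFourier (-(n - l)) x) =
        coeff V l * coeff u (n - l) := fun l => by
      rw [coeff, coeff, ← integral_const_mul]
      refine integral_congr_ae (Eventually.of_forall fun x => ?_)
      ring
    simp only [e] at h
    convert! h using 1
    refine integral_congr_ae (Eventually.of_forall fun x => ?_)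
    have h2 := hasSum_apply_of_summable_coeff (f := ⟨V, hV⟩) hs x
    have h3 := ((h2.mul_left (u x)).mul_right (mFourier (-n) x)).tsum_eq
    simp only [ContinuousMap.coe_mk] at h3
    simp only
    rw [← h3]
    refine tsum_congr fun l => ?_
    rw [show -(n - l) = l + -n by abel, mFourier_add]
    ring
  · have e : ∀ l, ∫ x, ‖u x * (coeff V l * mFourier (-(n - l)) x)‖ =
        ‖coeff V l‖ * ∫ x, ‖u x‖ := fun l => by
      rw [← integral_const_mul]
      refine integral_congr_ae (Eventually.of_forall fun x => ?_)
      simp only [norm_mul, norm_mFourier_apply]; ring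
    simp only [e]
    exact hs.mul_right _

theorem exists_Lp_mul {V : Torus → ℂ} (hV : Continuous V) {C : ℝ} (hC : ∀ x, ‖V x‖ ≤ C)
    (u : Lp ℂ 2 (volume : Measure Torus)) : ∃ w : Lp ℂ 2 (volume : Measure Torus),
      (∀ n, coeff w n = coeff (fun x => u x * V x) n) ∧ ‖w‖ ≤ C * ‖u‖ ∧
        w =ᵐ[volume] fun x => u x * V x := by
  have hb : ∀ x, ‖u x * V x‖ ≤ C * ‖u x‖ := fun x => by
    rw [norm_mul, mul_comm]; exact mul_le_mul_of_nonneg_right (hC x) (norm_nonneg _)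
  have hm : MemLp (fun x => u x * V x) 2 volume :=
    (Lp.memLp u).of_le_mul (((Lp.memLp u).1).mul hV.aestronglyMeasurable) (Eventually.of_forall hb)
  refine ⟨hm.toLp, fun n => ?_, ?_, hm.coeFn_toLp⟩
  · refine integral_congr_ae ?_
    filter_upwards [hm.coeFn_toLp] with x hx
    rw [hx]
  · refine Lp.norm_le_mul_norm_of_ae_le_mul ?_
    filter_upwards [hm.coeFn_toLp] with x hx
    rw [hx]; exact hb x

theorem ellTwo_coeff (u : Lp ℂ 2 (volume : Measure Torus)) : ellTwo (coeff u) = ‖u‖ := by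
  rw [ellTwo, (hasSum_sq_coeff u).tsum_eq, Real.sqrt_sq (norm_nonneg _)]

theorem coeff_neg_of_real (V : Torus → ℝ) (l : Fin 2 → ℤ) :
    coeff (fun x => (V x : ℂ)) (-l) = conj (coeff (fun x => (V x : ℂ)) l) := by
  rw [coeff, coeff, ← integral_conj]
  refine integral_congr_ae (Eventually.of_forall fun x => ?_)
  simp [conj_mFourier]

theorem smoothOnTorus_ofReal {V : Torus → ℝ} (hV : SmoothOnTorus V) :
    SmoothOnTorus fun x => (V x : ℂ) :=
  Complex.ofRealCLM.contDiff.comp hV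

/-- The equation in Fourier variables. -/
theorem coeff_eq_of_solves {V : Torus → ℝ} (hV : SmoothOnTorus V) {h e : ℝ}
    {u r : Lp ℂ 2 (volume : Measure Torus)} (hu : SolvesWithRemainder V h e u r)
    (n : Fin 2 → ℤ) :
    ((2 * Real.pi ^ 2 * h ^ 2 * dot n n - 1 / 2 : ℝ) : ℂ) * coeff u n +
      ((e ^ 2 : ℝ) : ℂ) * coeff (fun x => u x * (V x : ℂ)) n = coeff r n := by
  have hVc := SmoothOnTorus.continuous (smoothOnTorus_ofReal hV)
  have h1 := hu (mFourier (-n)) (smoothOnTorus_mFourier (-n))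
  have hd : dot (-n) (-n) = dot n n := by simp [dot]
  have e1 : ∫ x, u x * (-((h : ℂ) ^ 2 / 2) * torusLaplacian (mFourier (-n)) x +
      (e : ℂ) ^ 2 * (V x : ℂ) * mFourier (-n) x) =
      2 * Real.pi ^ 2 * h ^ 2 * dot n n * coeff u n +
        (e : ℂ) ^ 2 * coeff (fun x => u x * (V x : ℂ)) n := by
    rw [coeff, coeff, ← integral_const_mul, ← integral_const_mul, ← integral_add]
    · refine integral_congr_ae (Eventually.of_forall fun x => ?_)
      simp only [torusLaplacian_mFourier, hd]
      push_cast
      ring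
    · exact (integrable_Lp_mul u (mFourier (-n)).continuous).const_mul _
    · refine Integrable.const_mul ?_ _
      simp only [mul_assoc]
      exact integrable_Lp_mul u (f := fun x => (V x : ℂ) * mFourier (-n) x) (by fun_prop)
  have e2 : ∫ x, ((1 / 2 : ℂ) * u x + r x) * mFourier (-n) x = 1 / 2 * coeff u n + coeff r n := by
    rw [coeff, coeff, ← integral_const_mul, ← integral_add]
    · refine integral_congr_ae (Eventually.of_forall fun x => ?_)
      ring
    · exact (integrable_Lp_mul u (mFourier (-n)).continuous).const_mul _
    · exact integrable_Lp_mul r (mFourier (-n)).continuous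
  rw [e1, e2] at h1
  push_cast
  linear_combination h1

/-- Where the kinetic energy is below `1/4`, its distance to `1/2` is at least `1/4` and the
equation bounds `c` by `r` and `e² q`. Elsewhere `η² |n|²` is at least of order `e⁻²`, so the weight
itself is small. -/
theorem sum_escape_le {c r q : (Fin 2 → ℤ) → ℂ} {h e C : ℝ} (hh : 0 < h) (he : 0 < e)
    (hc : HasSum (fun n => ‖c n‖ ^ 2) 1) {R : ℝ} (hr : HasSum (fun n => ‖r n‖ ^ 2) (R ^ 2))
    {S : ℝ} (hq : HasSum (fun n => ‖q n‖ ^ 2) (S ^ 2)) (hS0 : 0 ≤ S) (hS : S ≤ C)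
    (heq : ∀ n, ((2 * Real.pi ^ 2 * h ^ 2 * dot n n - 1 / 2 : ℝ) : ℂ) * c n +
      ((e ^ 2 : ℝ) : ℂ) * q n = r n) :
    ∑' n, ‖c n‖ ^ 2 / (1 + (h * e⁻¹) ^ 2 * dot n n) ≤
      32 * R ^ 2 + 32 * e ^ 4 * C ^ 2 + 8 * Real.pi ^ 2 * e ^ 2 := by
  have hb : ∀ n, ‖c n‖ ^ 2 / (1 + (h * e⁻¹) ^ 2 * dot n n) ≤
      32 * ‖r n‖ ^ 2 + 32 * e ^ 4 * ‖q n‖ ^ 2 + 8 * Real.pi ^ 2 * e ^ 2 * ‖c n‖ ^ 2 := fun n => by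
    have hn := dot_self_nonneg n
    set p := 2 * Real.pi ^ 2 * h ^ 2 * dot n n with hp
    have hp0 : 0 ≤ p := by positivity
    have h1 : (p - 1 / 2) ^ 2 * ‖c n‖ ^ 2 ≤ 2 * ‖r n‖ ^ 2 + 2 * e ^ 4 * ‖q n‖ ^ 2 := by
      have e1 : ((p - 1 / 2 : ℝ) : ℂ) * c n = r n - ((e ^ 2 : ℝ) : ℂ) * q n := by
        rw [← heq n]; ring
      have e2 : |p - 1 / 2| * ‖c n‖ ≤ ‖r n‖ + e ^ 2 * ‖q n‖ := by
        rw [← Real.norm_eq_abs, ← Complex.norm_real, ← norm_mul, e1]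
        refine (norm_sub_le _ _).trans ?_
        rw [norm_mul, Complex.norm_real, Real.norm_of_nonneg (by positivity)]
      rw [← sq_abs, ← mul_pow]
      have e3 := pow_le_pow_left₀ (by positivity) e2 2
      nlinarith [sq_nonneg (‖r n‖ - e ^ 2 * ‖q n‖)]
    have e4 : (h * e⁻¹) ^ 2 * dot n n = p / (2 * Real.pi ^ 2 * e ^ 2) := by
      rw [hp]; field_simp
    rw [e4]
    by_cases hp4 : p < 1 / 4
    · have h2 : ‖c n‖ ^ 2 / (1 + p / (2 * Real.pi ^ 2 * e ^ 2)) ≤ ‖c n‖ ^ 2 :=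
        div_le_self (by positivity) (le_add_of_nonneg_right (by positivity))
      have h3 : (1 : ℝ) / 16 ≤ (p - 1 / 2) ^ 2 := by nlinarith
      have h4 := mul_le_mul_of_nonneg_right h3 (sq_nonneg ‖c n‖)
      have h5 : 0 ≤ 8 * Real.pi ^ 2 * e ^ 2 * ‖c n‖ ^ 2 := by positivity
      linarith
    · have h2 : ‖c n‖ ^ 2 / (1 + p / (2 * Real.pi ^ 2 * e ^ 2)) ≤
          8 * Real.pi ^ 2 * e ^ 2 * ‖c n‖ ^ 2 := by
        rw [div_le_iff₀ (by positivity)]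
        have h3 : 1 ≤ 8 * Real.pi ^ 2 * e ^ 2 * (1 + p / (2 * Real.pi ^ 2 * e ^ 2)) := by
          have : 8 * Real.pi ^ 2 * e ^ 2 * (1 + p / (2 * Real.pi ^ 2 * e ^ 2)) =
              8 * Real.pi ^ 2 * e ^ 2 + 4 * p := by field_simp; ring
          rw [this]
          have : 0 ≤ 8 * Real.pi ^ 2 * e ^ 2 := by positivity
          linarith
        nlinarith [sq_nonneg ‖c n‖]
      have h5 : 0 ≤ 32 * ‖r n‖ ^ 2 + 32 * e ^ 4 * ‖q n‖ ^ 2 := by positivity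
      linarith
  have hsum := ((hr.mul_left 32).add (hq.mul_left (32 * e ^ 4))).add
    (hc.mul_left (8 * Real.pi ^ 2 * e ^ 2))
  have hle : ∑' n, ‖c n‖ ^ 2 / (1 + (h * e⁻¹) ^ 2 * dot n n) ≤ 32 * R ^ 2 + 32 * e ^ 4 * S ^ 2 +
      8 * Real.pi ^ 2 * e ^ 2 * 1 := by
    rw [← hsum.tsum_eq]
    refine Summable.tsum_le_tsum hb ?_ hsum.summable
    exact Summable.of_nonneg_of_le (fun n => by have := dot_self_nonneg n; positivity) hb
      hsum.summable
  have : S ^ 2 ≤ C ^ 2 := by gcongr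
  have : 32 * e ^ 4 * S ^ 2 ≤ 32 * e ^ 4 * C ^ 2 := by gcongr
  linarith

/-- The commutator identity is divided by `h e`: the kinetic difference becomes the momentum at
scale `η = h / e`, the potential term gets the factor `e² / (h e) = η⁻¹`, and the remainder `‖r‖ /
(h e)` tends to zero by hypothesis. -/
theorem fourierQuasimode_of_isQuasimode {ι : Type*} {l : Filter ι} {h e : ι → ℝ}
    (h_pos : ∀ i, 0 < h i) (e_pos : ∀ i, 0 < e i) (h_lim : Tendsto h l (𝓝 0))
    (e_lim : Tendsto e l (𝓝 0)) (he_lim : Tendsto (fun i => h i * (e i)⁻¹) l (𝓝 0))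
    {V : Torus → ℝ} (hV : SmoothOnTorus V) {u : ι → Lp ℂ 2 (volume : Measure Torus)}
    (hu : ∀ i, ‖u i‖ = 1) (hquasi : IsQuasimode V l h e u) :
    FourierQuasimode l (coeff fun x => (V x : ℂ)) (fun i => coeff (u i))
      (fun i => h i * (e i)⁻¹) := by
  obtain ⟨r, hr, hro⟩ := hquasi
  have hVs := smoothOnTorus_ofReal hV
  have hVc := SmoothOnTorus.continuous hVs
  have hpot := summable_coeff hVs
  have hsv := summable_pot_norm hpot
  obtain ⟨C, hC⟩ := exists_bound hVc
  have hratio : Tendsto (fun i => ‖r i‖ / (h i * e i)) l (𝓝 0) := hro.tendsto_div_nhds_zero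
  have hsq : ∀ w : Lp ℂ 2 (volume : Measure Torus), Summable fun n => ‖coeff w n‖ ^ 2 :=
    fun w => (hasSum_sq_coeff w).summable
  refine ⟨fun i => hsq _, fun i => by rw [ellTwo_coeff, hu],
    fun i => mul_pos (h_pos i) (inv_pos.2 (e_pos i)), he_lim, hpot, ?_, ?_⟩
  · have hr0 : Tendsto (fun i => ‖r i‖) l (𝓝 0) := by
      have := (hratio.mul h_lim).mul e_lim
      simp only [mul_zero] at this
      refine this.congr fun i => ?_
      have := (h_pos i).ne'
      have := (e_pos i).ne'
      field_simp
    have hlim : Tendsto (fun i => 32 * ‖r i‖ ^ 2 + 32 * e i ^ 4 * C ^ 2 + 8 * Real.pi ^ 2 * e i ^ 2)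
        l (𝓝 0) := by
      have := (((hr0.pow 2).const_mul 32).add (((e_lim.pow 4).const_mul 32).mul_const (C ^ 2))).add
        ((e_lim.pow 2).const_mul (8 * Real.pi ^ 2))
      simpa using this
    refine squeeze_zero (fun i => tsum_nonneg fun n => ?_) (fun i => ?_) hlim
    · have := dot_self_nonneg n; positivity
    · obtain ⟨w, hw, hwn, -⟩ := exists_Lp_mul hVc hC (u i)
      have hc := hasSum_sq_coeff (u i)
      rw [hu, one_pow] at hc
      refine sum_escape_le (h_pos i) (e_pos i) hc (hasSum_sq_coeff (r i)) (hasSum_sq_coeff w)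
        (norm_nonneg _) (by simpa [hu] using hwn) fun n => ?_
      rw [hw]
      exact coeff_eq_of_solves hV (hr i) n
  · refine ⟨fun i => 2 * (‖r i‖ / (h i * e i)), by simpa using hratio.const_mul 2, ?_⟩
    intro i k m A hm
    have hh := h_pos i
    have he := e_pos i
    have hc := hsq (u i)
    have hr' := hsq (r i)
    have key := corr_commutator hc hr' hsv (coeff_neg_of_real V)
      (p := fun n => 2 * Real.pi ^ 2 * h i ^ 2 * dot n n) (ε := e i ^ 2) (fun n => by
        rw [(hasSum_coeff_mul hVc hsv (u i) n).tsum_eq]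
        exact coeff_eq_of_solves hV (hr i) n) k hm
    set P := h i * e i with hP
    have hP0 : 0 < P := mul_pos hh he
    have e1 : (fun n => m n * (2 * Real.pi ^ 2 * h i ^ 2 * dot (n + k) (n + k) -
        2 * Real.pi ^ 2 * h i ^ 2 * dot n n)) = fun n => P *
        (m n * (freq (h i * (e i)⁻¹) k n + 2 * Real.pi ^ 2 * (h i * (e i)⁻¹) * dot k k)) := by
      funext n
      have : dot (n + k) (n + k) = dot n n + 2 * dot n k + dot k k := by
        simp only [dot, Pi.add_apply]; push_cast; ring
      rw [this, freq, hP]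
      field_simp
      ring
    rw [e1, corr_smul] at key
    have hbd : ‖corr (coeff (u i)) (coeff (r i)) k m - corr (coeff (r i)) (coeff (u i)) k m‖ ≤
        A * (2 * ‖r i‖) := by
      refine (norm_sub_le _ _).trans ?_
      have h1 := norm_corr_le hc hr' k hm
      have h2 := norm_corr_le hr' hc k hm
      rw [ellTwo_coeff, ellTwo_coeff, hu] at h1 h2
      linarith
    set x := corr (coeff (u i)) (coeff (u i)) k
      (fun n => m n * (freq (h i * (e i)⁻¹) k n + 2 * Real.pi ^ 2 * (h i * (e i)⁻¹) * dot k k))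
    set s := ∑' l, coeff (fun x => (V x : ℂ)) l *
      corr (coeff (u i)) (coeff (u i)) (k + l) (fun n => m (n + l) - m n)
    set d := corr (coeff (u i)) (coeff (r i)) k m - corr (coeff (r i)) (coeff (u i)) k m
    have e2 : x - ((h i * (e i)⁻¹ : ℝ) : ℂ)⁻¹ * s = (P : ℂ)⁻¹ * d := by
      have hPc : (P : ℂ) ≠ 0 := by exact_mod_cast hP0.ne'
      have hhc : (h i : ℂ) ≠ 0 := by exact_mod_cast hh.ne'
      have hec : (e i : ℂ) ≠ 0 := by exact_mod_cast he.ne'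
      have : d = P * x - (e i ^ 2 : ℝ) * s := by rw [key]; ring
      rw [this, hP]
      push_cast
      field_simp
    rw [e2, norm_mul, norm_inv, Complex.norm_real, Real.norm_of_nonneg hP0.le]
    calc P⁻¹ * ‖d‖ ≤ P⁻¹ * (A * (2 * ‖r i‖)) := by gcongr
      _ = _ := by rw [hP]; ring

/-! ### Limit measures and concentration measures -/

/-- The Fourier-Stieltjes coefficients of a measure. -/
noncomputable def hat (μ : Measure Torus) (k : Fin 2 → ℤ) : ℂ := ∫ x, mFourier k x ∂μ

theorem norm_hat_le (μ : Measure Torus) [IsFiniteMeasure μ] (k : Fin 2 → ℤ) :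
    ‖hat μ k‖ ≤ μ.real univ := by
  refine (norm_integral_le_of_norm_le_const (C := 1)
    (Eventually.of_forall fun x => (norm_mFourier_apply k x).le)).trans ?_
  rw [one_mul]

theorem hat_zero (μ : Measure Torus) [IsFiniteMeasure μ] : hat μ 0 = μ.real univ := by
  simp [hat, mFourier_zero]

/-- The measure `|w|² dx`. -/
noncomputable def densityMeasure (w : Lp ℂ 2 (volume : Measure Torus)) : Measure Torus :=
  volume.withDensity fun x => ‖w x‖ₑ ^ 2

theorem measurable_enorm_sq (w : Lp ℂ 2 (volume : Measure Torus)) :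
    Measurable fun x => ‖w x‖ₑ ^ 2 :=
  (Lp.stronglyMeasurable w).measurable.enorm.pow_const 2

theorem hat_densityMeasure (w : Lp ℂ 2 (volume : Measure Torus)) (k : Fin 2 → ℤ) :
    hat (densityMeasure w) k = corr (coeff w) (coeff w) k fun _ => 1 := by
  obtain ⟨w', hw', -, hae⟩ := exists_Lp_mul (V := mFourier k) (mFourier k).continuous (C := 1)
    (fun x => (norm_mFourier_apply k x).le) w
  rw [hat, densityMeasure, integral_withDensity_eq_integral_toReal_smul (measurable_enorm_sq w)
    (Eventually.of_forall fun x => by simp)]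
  have h := hasSum_inner_coeff w' w
  have e1 : ∫ x, w' x * conj (w x) = ∫ x, (‖w x‖ₑ ^ 2).toReal • mFourier k x := by
    refine integral_congr_ae ?_
    filter_upwards [hae] with x hx
    rw [hx, mul_right_comm, Complex.mul_conj, Complex.normSq_eq_norm_sq]
    simp
  rw [← e1, ← h.tsum_eq, corr, ← (Equiv.addRight k).tsum_eq]
  refine tsum_congr fun n => ?_
  simp only [Equiv.coe_addRight, Complex.ofReal_one, one_mul, hw']
  congr 1
  refine integral_congr_ae (Eventually.of_forall fun x => ?_)
  simp only
  rw [mul_assoc, ← mFourier_add]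
  congr 2
  abel_nf

theorem densityMeasure_univ (w : Lp ℂ 2 (volume : Measure Torus)) :
    densityMeasure w univ = ENNReal.ofReal (‖w‖ ^ 2) := by
  rw [densityMeasure, withDensity_apply _ MeasurableSet.univ, Measure.restrict_univ]
  have h2 := eLpNorm_nnreal_pow_eq_lintegral (f := (w : Torus → ℂ)) (μ := volume)
    (p := 2) (by norm_num)
  have h3 : ‖w‖ = (eLpNorm w ((2 : ℝ≥0) : ℝ≥0∞) volume).toReal := by
    rw [Lp.norm_def]; rfl
  rw [h3, ENNReal.ofReal_pow ENNReal.toReal_nonneg, ENNReal.ofReal_toReal]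
  · have : ((2 : ℝ≥0) : ℝ) = ((2 : ℕ) : ℝ) := by norm_num
    simp only [this, ENNReal.rpow_natCast] at h2
    exact h2.symm
  · exact (Lp.memLp w).2.ne

instance isFiniteMeasure_densityMeasure (w : Lp ℂ 2 (volume : Measure Torus)) :
    IsFiniteMeasure (densityMeasure w) :=
  ⟨by rw [densityMeasure_univ]; exact ENNReal.ofReal_lt_top⟩

theorem tendsto_hat {ι : Type*} {U : Filter ι} {μ : ι → FiniteMeasure Torus} {ν : FiniteMeasure Torus}
    (h : Tendsto μ U (𝓝 ν)) (k : Fin 2 → ℤ) :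
    Tendsto (fun i => hat (μ i) k) U (𝓝 (hat ν k)) :=
  (FiniteMeasure.tendsto_iff_forall_integral_rclike_tendsto ℂ).1 h
    (BoundedContinuousFunction.mkOfCompact (mFourier k))

variable {ι : Type*} {v : (Fin 2 → ℤ) → ℂ} {η : ι → ℝ}
  {u : ι → Lp ℂ 2 (volume : Measure Torus)}

/-- Positivity: a squared slowly varying multiplier has a limit which is a measure. -/
theorem FourierQuasimode.exists_measure {U : Ultrafilter ι}
    (Q : FourierQuasimode (U : Filter ι) v (fun i => coeff (u i)) η)
    {s : ι → (Fin 2 → ℤ) → ℝ} {L : ℝ} (hs : ∀ i n, |s i n| ≤ 1)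
    (hL : ∀ i n l, |s i (n + l) - s i n| ≤ L * (η i * ‖l‖)) :
    ∃ μ : Measure Torus, IsFiniteMeasure μ ∧ ∀ k, Tendsto
      (fun i => corr (coeff (u i)) (coeff (u i)) k fun n => s i n ^ 2) U (𝓝 (hat μ k)) := by
  have hle : ∀ i n, ‖(s i n : ℂ) * coeff (u i) n‖ ^ 2 ≤ ‖coeff (u i) n‖ ^ 2 := fun i n => by
    rw [norm_mul, Complex.norm_real]
    exact pow_le_pow_left₀ (by positivity) (mul_le_of_le_one_left (norm_nonneg _) (hs i n)) 2
  have hsum : ∀ i, Summable fun n => ‖(s i n : ℂ) * coeff (u i) n‖ ^ 2 := fun i =>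
    Summable.of_nonneg_of_le (fun n => by positivity) (hle i) (Q.summable_sq i)
  choose w hw using fun i => exists_coeff_eq _ (hsum i)
  have hwn : ∀ i, ‖w i‖ ≤ 1 := fun i => by
    refine le_trans ?_ (Q.ellTwo_eq i).le
    rw [← ellTwo_coeff, ellTwo, ellTwo]
    refine Real.sqrt_le_sqrt ?_
    simp only [hw]
    exact (hsum i).tsum_le_tsum (hle i) (Q.summable_sq i)
  set μ : ι → FiniteMeasure Torus := fun i => ⟨densityMeasure (w i), inferInstance⟩ with hμ
  have hmem : ∀ i, μ i ∈ {μ : FiniteMeasure Torus | μ.mass ≤ 1} := fun i => by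
    rw [mem_ofPred_eq, ← ENNReal.coe_le_coe, FiniteMeasure.ennreal_mass]
    change densityMeasure (w i) univ ≤ _
    rw [densityMeasure_univ, ENNReal.coe_one, ENNReal.ofReal_le_one]
    exact pow_le_one₀ (norm_nonneg _) (hwn i)
  obtain ⟨ν, -, hν⟩ := (isCompact_setOfPred_finiteMeasure_le_of_compactSpace (E := Torus) 1).ultrafilter_le_nhds
    (U.map μ) (by
      rw [le_principal_iff]
      exact Filter.mem_map.2 (Filter.univ_mem' hmem))
  refine ⟨ν, inferInstance, fun k => ?_⟩
  have h1 : Tendsto (fun i => hat (μ i) k) U (𝓝 (hat ν k)) := tendsto_hat hν k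
  -- The density `|w|²` carries the multiplier `s n * s (n + k)`, which differs from `s n ^ 2` by
  -- `O(η)` because `s` varies slowly.
  have h2 : Tendsto (fun i => hat (μ i) k - corr (coeff (u i)) (coeff (u i)) k fun n => s i n ^ 2)
      U (𝓝 0) := by
    refine squeeze_zero_norm (a := fun i => L * (η i * ‖k‖)) (fun i => ?_)
      (by simpa using (Q.eta_lim.mul_const ‖k‖).const_mul L)
    have e : hat (μ i) k - (corr (coeff (u i)) (coeff (u i)) k fun n => s i n ^ 2) =
        corr (coeff (u i)) (coeff (u i)) k fun n => s i n * s i (n + k) - s i n ^ 2 := by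
      rw [corr_sub (Q.summable_sq i) (Q.summable_sq i) k (A := 1) (A' := 1)]
      · congr 1
        change hat (densityMeasure (w i)) k = _
        rw [hat_densityMeasure]
        refine tsum_congr fun n => ?_
        simp only [hw, map_mul, Complex.conj_ofReal]
        push_cast
        ring
      · intro n
        rw [abs_mul]; exact mul_le_one₀ (hs i n) (abs_nonneg _) (hs i _)
      · intro n
        rw [abs_pow]; exact pow_le_one₀ (abs_nonneg _) (hs i n)
    rw [e]
    refine Q.norm_corr_le_of_bound i k fun n => ?_
    rw [sq, ← mul_sub, abs_mul]
    exact (mul_le_of_le_one_left (abs_nonneg _) (hs i n)).trans (hL i n k)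
  simpa using h1.sub h2

theorem FourierQuasimode.exists_cutoff_measure {U : Ultrafilter ι}
    (Q : FourierQuasimode (U : Filter ι) v (fun i => coeff (u i)) η) (p : Fin 2 → ℤ) (δ : ℝ) :
    ∃ μ : Measure Torus, IsFiniteMeasure μ ∧ (0 < δ → ∀ k, Tendsto
      (fun i => corr (coeff (u i)) (coeff (u i)) k fun n => cutoff δ (freq (η i) p n)) U
        (𝓝 (hat μ k))) := by
  by_cases hδ : 0 < δ
  · obtain ⟨μ, h1, h2⟩ := Q.exists_measure (s := fun i n => rootCutoff δ (freq (η i) p n))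
      (L := 1 / δ * (8 * Real.pi ^ 2 * ‖p‖)) (fun i n => by
        rw [abs_of_nonneg (rootCutoff_nonneg hδ _)]; exact rootCutoff_le_one hδ _)
      (fun i n l => by
        refine (abs_rootCutoff_sub_le hδ _ _).trans ?_
        rw [freq_add, add_sub_cancel_left, mul_assoc (1 / δ)]
        have := abs_freq_le (Q.eta_pos i) p l
        gcongr)
    refine ⟨μ, h1, fun _ => ?_⟩
    simpa only [rootCutoff_sq] using h2
  · exact ⟨0, inferInstance, fun h => absurd h hδ⟩

/-- The concentration measures `μ p δ` of a limit measure `ν` near the momenta orthogonal to the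
lattice vectors `p`, at the scales `δ`. -/
structure ConcentrationMeasures (v : (Fin 2 → ℤ) → ℂ) (ν : Measure Torus)
    (μ : (Fin 2 → ℤ) → ℝ → Measure Torus) : Prop where
  summable_pot : Summable fun l => ‖v l‖ * (1 + ‖l‖) ^ 2
  finite : ∀ p δ, IsFiniteMeasure (μ p δ)
  hat_of_cross : ∀ {p δ}, 0 < δ → ∀ {k}, cross k p ≠ 0 → hat (μ p δ) k = 0
  regular : ∃ C, 0 ≤ C ∧ ∀ p (j : ℤ) δ, j ≠ 0 → 0 < δ →
    ‖hat ν (j • p) - hat (μ p δ) (j • p)‖ ≤ C * (‖p‖ / (δ ^ 2 * |(j : ℝ)|))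
  sum_mass : ∀ (F : Finset (Fin 2 → ℤ)) (δ : (Fin 2 → ℤ) → ℝ), (∀ p, 0 < δ p) →
    (∀ p ∈ F, ∀ q ∈ F, p ≠ q → cross p q ≠ 0) → ∑ p ∈ F, (μ p (δ p)).real univ ≤ 1
  virial : ∀ p (j : ℤ) δ, 0 < δ → δ ≤ 1 →
    ‖∑' l, v l * ((4 * Real.pi ^ 2 * dot l p : ℝ) *
      (hat (μ p δ) (j • p + l) - δ * hat (μ p 1) (j • p + l)))‖ ≤ |(j : ℝ)| * δ

/-- Passing to an ultrafilter makes all the correlations converge at once, for every `p`, `δ` and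
`k`, without extracting subsequences. -/
theorem FourierQuasimode.exists_concentrationMeasures {l : Filter ι}
    (Q : FourierQuasimode l v (fun i => coeff (u i)) η) (hu : ∀ i, ‖u i‖ = 1)
    {ν : ProbabilityMeasure Torus}
    (hν : MapClusterPt ν l fun i => positionMeasure (u i) (hu i)) :
    ∃ μ, ConcentrationMeasures v ν μ := by
  obtain ⟨U, hUl, hUν⟩ := mapClusterPt_iff_ultrafilter.1 hν
  have Q : FourierQuasimode (U : Filter ι) v (fun i => coeff (u i)) η := by
    obtain ⟨ρ, hρ, h⟩ := Q.commutator
    exact ⟨Q.summable_sq, Q.ellTwo_eq, Q.eta_pos, Q.eta_lim.mono_left hUl, Q.summable_pot,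
      Q.escape.mono_left hUl, ρ, hρ.mono_left hUl, h⟩
  choose μ hfin hμ using fun p δ => Q.exists_cutoff_measure p δ
  have hνlim : ∀ k, Tendsto (fun i => corr (coeff (u i)) (coeff (u i)) k fun _ => 1) U
      (𝓝 (hat ν k)) := fun k => by
    have h1 := (ProbabilityMeasure.tendsto_nhds_iff_toFiniteMeasure_tendsto_nhds _).1 hUν
    refine (tendsto_hat h1 k).congr fun i => ?_
    exact hat_densityMeasure (u i) k
  refine ⟨μ, Q.summable_pot, hfin, fun {p δ} hδ {k} hk => ?_, ?_, ?_, ?_⟩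
  · exact tendsto_nhds_unique (hμ p δ hδ k) (Q.tendsto_corr_cutoff_of_cross_ne_zero hk hδ)
  · refine ⟨8 * Real.pi ^ 2 * ∑' l, ‖v l‖ * ‖l‖,
      mul_nonneg (by positivity) (tsum_nonneg fun l => by positivity), fun p j δ hj hδ => ?_⟩
    obtain ⟨ρ, hρ, h⟩ := Q.norm_corr_sub_cutoff_le (p := p) hj hδ
    have h1 := ((hνlim (j • p)).sub (hμ p δ hδ (j • p))).norm
    have h2 := hρ.const_add (8 * Real.pi ^ 2 * ‖p‖ / (δ ^ 2 * |(j : ℝ)|) * ∑' l, ‖v l‖ * ‖l‖)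
    rw [add_zero] at h2
    exact (le_of_tendsto_of_tendsto' h1 h2 h).trans (le_of_eq (by ring))
  · intro F δ hδ hF
    refine Q.sum_mass_le_one F hF hδ fun p _ => ?_
    have := hμ p (δ p) (hδ p) 0
    have := hfin p (δ p)
    rwa [← hat_zero]
  · intro p j δ hδ hδ1
    exact Q.norm_virial_sum_le j hδ hδ1 (hμ p δ hδ) (hμ p 1 one_pos)

/-! ### The averaged potential against the concentration measures -/

theorem summable_series {d : (Fin 2 → ℤ) → ℂ} (hd : Summable fun l => ‖d l‖) (x : Torus) :
    Summable fun l => d l * mFourier l x :=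
  Summable.of_norm (by simpa [norm_mFourier_apply] using hd)

/-- An absolutely convergent Fourier series. -/
noncomputable def series (d : (Fin 2 → ℤ) → ℂ) (x : Torus) : ℂ := ∑' l, d l * mFourier l x

theorem continuous_series {d : (Fin 2 → ℤ) → ℂ} (hd : Summable fun l => ‖d l‖) :
    Continuous (series d) :=
  continuous_tsum (fun l => by fun_prop) hd fun l x => by
    rw [norm_mul, norm_mFourier_apply, mul_one]

theorem hasSum_integral_series {d : (Fin 2 → ℤ) → ℂ} (hd : Summable fun l => ‖d l‖)
    (μ : Measure Torus) [IsFiniteMeasure μ] {f : Torus → ℂ} (hf : Continuous f) :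
    HasSum (fun l => d l * ∫ x, f x * mFourier l x ∂μ) (∫ x, f x * series d x ∂μ) := by
  have h := hasSum_integral_of_summable_integral_norm (μ := μ)
    (F := fun l x => f x * (d l * mFourier l x))
    (fun l => integrable_of_continuous μ (by fun_prop)) ?_
  · have e : ∀ l, ∫ x, f x * (d l * mFourier l x) ∂μ = d l * ∫ x, f x * mFourier l x ∂μ :=
      fun l => by
        rw [← integral_const_mul]
        exact integral_congr_ae (Eventually.of_forall fun x => by ring)
    simp only [e, tsum_mul_left] at h
    exact h
  · have e : ∀ l, ∫ x, ‖f x * (d l * mFourier l x)‖ ∂μ = ‖d l‖ * ∫ x, ‖f x‖ ∂μ := fun l => by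
      rw [← integral_const_mul]
      refine integral_congr_ae (Eventually.of_forall fun x => ?_)
      simp only [norm_mul, norm_mFourier_apply]; ring
    simp only [e]
    exact hd.mul_right _

/-- The Fourier coefficients of the derivative in the direction `p` of the average of the potential
along the directions orthogonal to `p`. -/
noncomputable def slopeCoeff (v : (Fin 2 → ℤ) → ℂ) (p l : Fin 2 → ℤ) : ℂ :=
  if cross l p = 0 then v l * (4 * Real.pi ^ 2 * dot l p : ℝ) else 0

/-- A lattice vector is primitive when its parallel lattice vectors are its multiples. -/
def IsPrimitive (p : Fin 2 → ℤ) : Prop := p ≠ 0 ∧ ∀ k, cross k p = 0 → ∃ j : ℤ, k = j • p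

variable {v : (Fin 2 → ℤ) → ℂ}

theorem norm_potential_slope_le (v : (Fin 2 → ℤ) → ℂ) (p l : Fin 2 → ℤ) :
    ‖v l * (4 * Real.pi ^ 2 * dot l p : ℝ)‖ ≤ 8 * Real.pi ^ 2 * ‖p‖ * (‖v l‖ * ‖l‖) := by
  rw [norm_mul, Complex.norm_real, Real.norm_eq_abs, abs_mul, abs_of_pos (by positivity)]
  calc _ ≤ ‖v l‖ * (4 * Real.pi ^ 2 * (2 * (‖l‖ * ‖p‖))) := by gcongr; exact abs_dot_le l p
    _ = _ := by ring

theorem norm_slopeCoeff_le (v : (Fin 2 → ℤ) → ℂ) (p l : Fin 2 → ℤ) :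
    ‖slopeCoeff v p l‖ ≤ 8 * Real.pi ^ 2 * ‖p‖ * (‖v l‖ * ‖l‖) := by
  unfold slopeCoeff
  split_ifs
  · exact norm_potential_slope_le v p l
  · rw [norm_zero]; positivity

theorem summable_slopeCoeff (h : Summable fun l : Fin 2 → ℤ => ‖v l‖ * (1 + ‖l‖) ^ 2)
    (p : Fin 2 → ℤ) : Summable fun l => ‖slopeCoeff v p l‖ :=
  Summable.of_nonneg_of_le (fun _ => norm_nonneg _) (norm_slopeCoeff_le v p)
    ((summable_pot_mul_norm h).mul_left _)

theorem cross_add_smul (k p : Fin 2 → ℤ) (j : ℤ) : cross (j • p + k) p = cross k p := by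
  simp [cross]; ring

namespace ConcentrationMeasures

variable {ν : Measure Torus} {μ : (Fin 2 → ℤ) → ℝ → Measure Torus}
  (H : ConcentrationMeasures v ν μ)
include H

theorem mass_le_one (p : Fin 2 → ℤ) {δ : ℝ} (hδ : 0 < δ) : (μ p δ).real univ ≤ 1 := by
  simpa using H.sum_mass {p} (fun _ => δ) (fun _ => hδ) (by simp)

/-- The virial estimate. -/
theorem norm_integral_slope_le (p : Fin 2 → ℤ) (j : ℤ) {δ : ℝ} (hδ : 0 < δ) (hδ1 : δ ≤ 1) :
    ‖∫ x, mFourier (j • p) x * series (slopeCoeff v p) x ∂μ p δ‖ ≤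
      δ * (|(j : ℝ)| + ∑' l, 8 * Real.pi ^ 2 * ‖p‖ * (‖v l‖ * ‖l‖)) := by
  have := H.finite p
  have hs := summable_slopeCoeff H.summable_pot p
  have hs' := (summable_pot_mul_norm H.summable_pot).mul_left (8 * Real.pi ^ 2 * ‖p‖)
  rw [← (hasSum_integral_series hs (μ p δ) (mFourier (j • p)).continuous).tsum_eq]
  have hhat : ∀ l, ∫ x, mFourier (j • p) x * mFourier l x ∂μ p δ = hat (μ p δ) (j • p + l) :=
    fun l => integral_congr_ae (Eventually.of_forall fun x => (mFourier_add).symm)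
  have hb : ∀ {δ} (_ : 0 < δ) l, ‖v l * (4 * Real.pi ^ 2 * dot l p : ℝ) * hat (μ p δ) (j • p + l)‖ ≤
      8 * Real.pi ^ 2 * ‖p‖ * (‖v l‖ * ‖l‖) := fun {δ} hδ l => by
    rw [norm_mul]
    exact (mul_le_of_le_one_right (norm_nonneg _) ((norm_hat_le _ _).trans (H.mass_le_one p hδ))).trans
      (norm_potential_slope_le v p l)
  -- Frequencies not parallel to `p` contribute nothing to either measure, so the full potential may
  -- replace its average. The correction by `μ p 1` carries a factor `δ` and a mass at most 1.
  have e : ∀ l, slopeCoeff v p l * ∫ x, mFourier (j • p) x * mFourier l x ∂μ p δ =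
      v l * ((4 * Real.pi ^ 2 * dot l p : ℝ) *
        (hat (μ p δ) (j • p + l) - δ * hat (μ p 1) (j • p + l))) +
      δ * (v l * (4 * Real.pi ^ 2 * dot l p : ℝ) * hat (μ p 1) (j • p + l)) := fun l => by
    rw [hhat, slopeCoeff]
    split_ifs with hl
    · ring
    · rw [H.hat_of_cross hδ (k := j • p + l) (by rwa [cross_add_smul]),
        H.hat_of_cross one_pos (k := j • p + l) (by rwa [cross_add_smul])]
      ring
  have s1 : Summable fun l => v l * (4 * Real.pi ^ 2 * dot l p : ℝ) * hat (μ p 1) (j • p + l) :=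
    Summable.of_norm_bounded hs' (hb one_pos)
  have s2 : Summable fun l => v l * (4 * Real.pi ^ 2 * dot l p : ℝ) * hat (μ p δ) (j • p + l) :=
    Summable.of_norm_bounded hs' (hb hδ)
  have s3 : Summable fun l => v l * ((4 * Real.pi ^ 2 * dot l p : ℝ) *
        (hat (μ p δ) (j • p + l) - δ * hat (μ p 1) (j • p + l))) :=
    (s2.sub (s1.mul_left (δ : ℂ))).congr fun l => by ring
  simp only [e]
  rw [s3.tsum_add (s1.mul_left _), tsum_mul_left]
  refine (norm_add_le _ _).trans ?_
  rw [norm_mul, Complex.norm_real, Real.norm_of_nonneg hδ.le, mul_add, mul_comm δ |(j : ℝ)|]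
  refine add_le_add (H.virial p j δ hδ hδ1) (mul_le_mul_of_nonneg_left ?_ hδ.le)
  exact tsum_of_norm_bounded hs'.hasSum (hb one_pos)

/-- One factor of `|D|²` is expanded in Fourier series and the virial estimate applied to each term.
The growth `|j|` of that estimate is paid for by the smoothness of the potential. -/
theorem integral_slope_sq_le {p : Fin 2 → ℤ} (hp : IsPrimitive p) :
    ∃ C, ∀ δ, 0 < δ → δ ≤ 1 → ∫ x, ‖series (slopeCoeff v p) x‖ ^ 2 ∂μ p δ ≤ C * δ := by
  have hs := summable_slopeCoeff H.summable_pot p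
  have hD := continuous_series hs
  set D := series (slopeCoeff v p) with hDdef
  set C := ∑' l, 8 * Real.pi ^ 2 * ‖p‖ * (‖v l‖ * ‖l‖) with hC
  have hC0 : 0 ≤ C := tsum_nonneg fun l => by positivity
  have hp1 : 1 ≤ ‖p‖ := by
    obtain ⟨i, hi⟩ := Function.ne_iff.mp hp.1
    refine le_trans ?_ (abs_coord_le p i)
    exact_mod_cast Int.one_le_abs hi
  have hsum : Summable fun l => ‖slopeCoeff v p l‖ * (‖l‖ + C) := by
    refine Summable.of_nonneg_of_le (fun l => by positivity) (fun l => ?_)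
      (H.summable_pot.mul_left (8 * Real.pi ^ 2 * ‖p‖ * (1 + C)))
    have h1 : ‖l‖ * (‖l‖ + C) ≤ (1 + C) * (1 + ‖l‖) ^ 2 := by nlinarith [norm_nonneg l, mul_nonneg hC0 (norm_nonneg l), mul_nonneg hC0 (sq_nonneg ‖l‖)]
    calc _ ≤ 8 * Real.pi ^ 2 * ‖p‖ * (‖v l‖ * ‖l‖) * (‖l‖ + C) := by
          gcongr; exact norm_slopeCoeff_le v p l
      _ = 8 * Real.pi ^ 2 * ‖p‖ * ‖v l‖ * (‖l‖ * (‖l‖ + C)) := by ring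
      _ ≤ 8 * Real.pi ^ 2 * ‖p‖ * ‖v l‖ * ((1 + C) * (1 + ‖l‖) ^ 2) := by gcongr
      _ = _ := by ring
  refine ⟨∑' l, ‖slopeCoeff v p l‖ * (‖l‖ + C), fun δ hδ hδ1 => ?_⟩
  have := H.finite p
  have h1 := hasSum_integral_series hs (μ p δ) (f := fun x => conj (D x)) (by fun_prop)
  have e1 : ∫ x, conj (D x) * D x ∂μ p δ = (∫ x, ‖D x‖ ^ 2 ∂μ p δ : ℝ) := by
    rw [← integral_complex_ofReal]
    refine integral_congr_ae (Eventually.of_forall fun x => ?_)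
    simp only
    rw [mul_comm, Complex.mul_conj, Complex.normSq_eq_norm_sq]
  have hn : 0 ≤ ∫ x, ‖D x‖ ^ 2 ∂μ p δ := integral_nonneg fun x => by positivity
  rw [← Real.norm_of_nonneg hn, ← Complex.norm_real, ← e1, ← h1.tsum_eq]
  rw [← tsum_mul_right]
  refine tsum_of_norm_bounded (hsum.mul_right δ).hasSum fun k => ?_
  rw [norm_mul, mul_assoc]
  by_cases hk : cross k p = 0
  · refine mul_le_mul_of_nonneg_left ?_ (norm_nonneg _)
    obtain ⟨j, rfl⟩ := hp.2 k hk
    have e2 : ∫ x, conj (D x) * mFourier (j • p) x ∂μ p δ =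
        conj (∫ x, mFourier ((-j) • p) x * D x ∂μ p δ) := by
      rw [← integral_conj]
      refine integral_congr_ae (Eventually.of_forall fun x => ?_)
      simp only [map_mul, conj_mFourier, neg_smul, neg_neg]
      ring
    rw [e2, RCLike.norm_conj]
    refine (H.norm_integral_slope_le p (-j) hδ hδ1).trans ?_
    rw [mul_comm, norm_smul, Int.norm_eq_abs, Int.cast_neg, abs_neg]
    gcongr
    exact le_mul_of_one_le_right (abs_nonneg _) hp1
  · simp [slopeCoeff, hk]

end ConcentrationMeasures

/-! ### Singular parts -/

theorem eq_singularPart_of_add_ac {α : Type*} [MeasurableSpace α] {m σ a κ : Measure α}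
    [SigmaFinite κ] [SigmaFinite a] (hσ : σ ⟂ₘ κ) (ha : a ≪ κ) (h : m = σ + a) :
    σ = m.singularPart κ := by
  refine Measure.eq_singularPart (Measure.measurable_rnDeriv a κ) hσ ?_
  rw [Measure.withDensity_rnDeriv_eq a κ ha, h]

theorem singularPart_sum {α κ : Type*} [MeasurableSpace α] [Countable κ] (m : κ → Measure α)
    (ν : Measure α) [∀ i, (m i).HaveLebesgueDecomposition ν] :
    (Measure.sum m).singularPart ν = Measure.sum fun i => (m i).singularPart ν := by
  symm
  refine Measure.eq_singularPart (f := ∑' i, (m i).rnDeriv ν)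
    (Measurable.tsum' fun i => Measure.measurable_rnDeriv _ _) ?_ ?_
  · exact Measure.MutuallySingular.sum_left.2 fun i => Measure.mutuallySingular_singularPart _ _
  · rw [withDensity_tsum fun i => Measure.measurable_rnDeriv _ _, Measure.sum_add_sum]
    congr 1
    funext i
    exact Measure.haveLebesgueDecomposition_add _ _

theorem hat_add (μ ν : Measure Torus) [IsFiniteMeasure μ] [IsFiniteMeasure ν] (k : Fin 2 → ℤ) :
    hat (μ + ν) k = hat μ k + hat ν k :=
  integral_add_measure (integrable_of_continuous _ (mFourier k).continuous)
    (integrable_of_continuous _ (mFourier k).continuous)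

theorem hat_withDensity_ofReal {g : Torus → ℝ} (hg : Measurable g) (k : Fin 2 → ℤ) :
    hat (volume.withDensity fun x => ENNReal.ofReal (g x)) k =
      ∫ x, ((max (g x) 0 : ℝ) : ℂ) * mFourier k x := by
  rw [hat, integral_withDensity_eq_integral_toReal_smul (by fun_prop)
    (Eventually.of_forall fun x => ENNReal.ofReal_lt_top)]
  refine integral_congr_ae (Eventually.of_forall fun x => ?_)
  simp only [ENNReal.toReal_ofReal', Complex.real_smul]

/-- Measures whose Fourier coefficients differ by a square summable sequence have the same singular
part. -/
theorem singularPart_eq_of_summable_sq {μ ν : Measure Torus} [IsFiniteMeasure μ] [IsFiniteMeasure ν]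
    (h : Summable fun k => ‖hat μ k - hat ν k‖ ^ 2) :
    μ.singularPart volume = ν.singularPart volume := by
  obtain ⟨G, hG⟩ := exists_coeff_eq (fun n => hat μ (-n) - hat ν (-n))
    ((Equiv.neg (Fin 2 → ℤ)).summable_iff.2 h)
  set g : Torus → ℝ := fun x => (G x).re with hg
  have hgm : Measurable g := Complex.measurable_re.comp (Lp.stronglyMeasurable G).measurable
  have hGi := integrable_Lp G
  have hgi : Integrable g volume := hGi.re
  have hGk : ∀ k, ∫ x, G x * mFourier k x = hat μ k - hat ν k := fun k => by
    have := hG (-k)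
    rwa [coeff, neg_neg] at this
  have hconj : ∀ (m : Measure Torus) k, conj (hat m (-k)) = hat m k := fun m k => by
    rw [hat, ← integral_conj]
    simp only [conj_mFourier, neg_neg, hat]
  have hgk : ∀ k, ∫ x, (g x : ℂ) * mFourier k x = hat μ k - hat ν k := fun k => by
    have e1 : ∫ x, conj (G x) * mFourier k x = hat μ k - hat ν k := by
      have := congrArg conj (hGk (-k))
      rw [← integral_conj, map_sub, hconj, hconj] at this
      simpa [conj_mFourier] using this
    have i1 : Integrable (fun x => G x * mFourier k x) volume :=
      integrable_Lp_mul G (mFourier k).continuous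
    have i2 : Integrable (fun x => conj (G x) * mFourier k x) volume := by
      have := Complex.conjCLE.toContinuousLinearMap.integrable_comp
        (integrable_Lp_mul G (mFourier (-k)).continuous)
      simpa [conj_mFourier] using this
    have e2 : ∀ x, (g x : ℂ) * mFourier k x =
        (1 / 2 : ℂ) * (G x * mFourier k x + conj (G x) * mFourier k x) := fun x => by
      have := Complex.add_conj (G x)
      rw [← add_mul, this, hg]
      push_cast; ring
    simp only [e2]
    rw [integral_const_mul, integral_add i1 i2, hGk, e1]
    ring
  have hfin : ∀ {f : Torus → ℝ}, Integrable f volume →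
      IsFiniteMeasure (volume.withDensity fun x => ENNReal.ofReal (f x)) := fun hf =>
    isFiniteMeasure_withDensity_ofReal hf.2
  have f1 := hfin hgi
  have f2 := hfin hgi.neg
  simp only [Pi.neg_apply] at f2
  -- The difference of the measures is a real `L²` density `g`; its negative and positive parts are
  -- put on opposite sides so that only positive measures appear.
  have key : μ + volume.withDensity (fun x => ENNReal.ofReal (-g x)) =
      ν + volume.withDensity (fun x => ENNReal.ofReal (g x)) := by
    refine measure_ext_of_coeff fun k => ?_
    change hat _ k = hat _ k
    have w2 : hat (volume.withDensity fun x => ENNReal.ofReal (-g x)) k =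
        ∫ x, ((max (-g x) 0 : ℝ) : ℂ) * mFourier k x := hat_withDensity_ofReal hgm.neg k
    rw [hat_add, hat_add, hat_withDensity_ofReal hgm, w2]
    have i3 : ∀ {f : Torus → ℝ}, Integrable f volume →
        Integrable (fun x => ((max (f x) 0 : ℝ) : ℂ) * mFourier k x) volume := fun hf =>
      (Integrable.ofReal (𝕜 := ℂ) hf.pos_part).mul_bdd (c := 1) (mFourier k).continuous.aestronglyMeasurable
        (Eventually.of_forall fun x => (norm_mFourier_apply k x).le)
    have e3 : (∫ x, ((max (g x) 0 : ℝ) : ℂ) * mFourier k x) -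
        ∫ x, ((max (-g x) 0 : ℝ) : ℂ) * mFourier k x = hat μ k - hat ν k := by
      have i4 : Integrable (fun x => ((max (-g x) 0 : ℝ) : ℂ) * mFourier k x) volume := i3 hgi.neg
      rw [← integral_sub (i3 hgi) i4, ← hgk]
      refine integral_congr_ae (Eventually.of_forall fun x => ?_)
      simp only
      rw [← sub_mul, ← Complex.ofReal_sub]
      congr 2
      rcases le_total (g x) 0 with h0 | h0
      · rw [max_eq_right h0, max_eq_left (by linarith)]; ring
      · rw [max_eq_left h0, max_eq_right (by linarith)]; ring
    linear_combination -e3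
  have := congrArg (fun m => Measure.singularPart m volume) key
  simpa only [Measure.singularPart_add, Measure.singularPart_withDensity, add_zero] using this

/-! ### Decomposition of the singular part over rational directions -/

/-- The primitive lattice vectors, up to sign. -/
def primitives : Set (Fin 2 → ℤ) := {p | IsPrimitive p ∧ (0 < p 0 ∨ (p 0 = 0 ∧ 0 < p 1))}

theorem isPrimitive_of_isCoprime {p : Fin 2 → ℤ} (h : IsCoprime (p 0) (p 1)) : IsPrimitive p := by
  obtain ⟨a, b, hab⟩ := h
  refine ⟨fun h0 => by simp [h0] at hab, fun k hk => ⟨a * k 0 + b * k 1, ?_⟩⟩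
  rw [cross] at hk
  funext i
  fin_cases i
  · simp only [Fin.zero_eta, Pi.smul_apply, smul_eq_mul]
    linear_combination (-k 0) * hab + b * hk
  · simp only [Fin.mk_one, Pi.smul_apply, smul_eq_mul]
    linear_combination (-k 1) * hab - a * hk

theorem cross_ne_zero_of_mem_primitives {p q : Fin 2 → ℤ} (hp : p ∈ primitives)
    (hq : q ∈ primitives) (hpq : p ≠ q) : cross p q ≠ 0 := by
  intro h
  obtain ⟨j, hj⟩ := hq.1.2 p h
  obtain ⟨i, hi⟩ := hp.1.2 q (by rw [← neg_eq_zero, ← h]; simp [cross]; ring)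
  have h1 : (i * j) • p = (1 : ℤ) • p := by rw [mul_comm, mul_smul, ← hi, ← hj, one_smul]
  have h2 : i * j = 1 := smul_left_injective ℤ hp.1.1 h1
  rcases Int.eq_one_or_neg_one_of_mul_eq_one h2 with h3 | h3
  · exact hpq (by rw [hi, h3, one_smul])
  · have hs := hq.2
    rw [hi, h3] at hs
    have hs' := hp.2
    simp only [Pi.smul_apply, smul_eq_mul] at hs
    omega

theorem exists_primitive (k : Fin 2 → ℤ) : ∃ (p : Fin 2 → ℤ) (j : ℤ), k = j • p ∧
    (k ≠ 0 → p ∈ primitives ∧ j ≠ 0) := by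
  by_cases hk : k = 0
  · exact ⟨0, 0, by simp [hk], fun h => absurd hk h⟩
  have hg : 0 < Int.gcd (k 0) (k 1) := by
    rw [Nat.pos_iff_ne_zero, Ne, Int.gcd_eq_zero_iff]
    rintro ⟨h0, h1⟩
    exact hk (funext fun i => by fin_cases i <;> simp [h0, h1])
  have hcop := Int.isCoprime_iff_gcd_eq_one.2 (Int.gcd_ediv_gcd_ediv_gcd hg)
  have d0 := Int.mul_ediv_cancel' (Int.gcd_dvd_left (k 0) (k 1))
  have d1 := Int.mul_ediv_cancel' (Int.gcd_dvd_right (k 0) (k 1))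
  set g : ℤ := (Int.gcd (k 0) (k 1) : ℤ) with hgdef
  have hg0 : g ≠ 0 := by rw [hgdef]; exact_mod_cast hg.ne'
  set a := k 0 / g
  set b := k 1 / g
  by_cases hs : 0 < a ∨ (a = 0 ∧ 0 < b)
  · refine ⟨![a, b], g, ?_, fun _ => ⟨⟨isPrimitive_of_isCoprime (by simpa using hcop), by simpa using hs⟩, hg0⟩⟩
    funext i; fin_cases i <;> simp [d0, d1]
  · refine ⟨![-a, -b], -g, ?_, fun _ => ⟨⟨isPrimitive_of_isCoprime (by simpa using hcop.neg_neg), ?_⟩,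
      neg_ne_zero.2 hg0⟩⟩
    · funext i; fin_cases i <;> simp [d0, d1]
    · have hne : ¬ (a = 0 ∧ b = 0) := by
        rintro ⟨h0, h1⟩
        rw [h0, h1] at hcop
        exact absurd hcop (by rw [isCoprime_zero_left]; exact not_isUnit_zero)
      simp only [Matrix.cons_val_zero, Matrix.cons_val_one]
      omega

theorem one_le_norm_of_ne_zero {p : Fin 2 → ℤ} (hp : p ≠ 0) : 1 ≤ ‖p‖ := by
  obtain ⟨i, hi⟩ := Function.ne_iff.mp hp
  refine le_trans ?_ (abs_coord_le p i)
  exact_mod_cast Int.one_le_abs hi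

variable {v : (Fin 2 → ℤ) → ℂ}

namespace ConcentrationMeasures

variable {ν : Measure Torus} {μ : (Fin 2 → ℤ) → ℝ → Measure Torus}
  (H : ConcentrationMeasures v ν μ)
include H

/-- Both measures have coefficients only along `p`, where each is within `O(1 / |j|)` of `ν`. The
difference is square summable. -/
theorem singularPart_eq {p : Fin 2 → ℤ} (hp : IsPrimitive p) {δ δ' : ℝ} (hδ : 0 < δ)
    (hδ' : 0 < δ') : (μ p δ).singularPart volume = (μ p δ').singularPart volume := by
  have := H.finite p
  refine singularPart_eq_of_summable_sq ?_
  have hinj : Function.Injective fun j : ℤ => j • p := smul_left_injective ℤ hp.1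
  rw [← hinj.summable_iff]
  · obtain ⟨C, hC0, hC⟩ := H.regular
    set B := C * (‖p‖ / δ ^ 2) + C * (‖p‖ / δ' ^ 2) with hB
    have hs : Summable fun j : ℤ => B ^ 2 * (1 / (j : ℝ) ^ 2) :=
      (Real.summable_one_div_int_pow.2 one_lt_two).mul_left _
    refine Summable.of_norm_bounded_eventually hs ?_
    rw [eventually_cofinite]
    refine (finite_singleton (0 : ℤ)).subset fun j hj => ?_
    by_contra hj0
    refine hj ?_
    have hj0 : j ≠ 0 := hj0
    have hj1 : (0 : ℝ) < |(j : ℝ)| := by positivity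
    have h1 := hC p j δ hj0 hδ
    have h2 := hC p j δ' hj0 hδ'
    have h3 : ‖hat (μ p δ) (j • p) - hat (μ p δ') (j • p)‖ ≤ B / |(j : ℝ)| := by
      have e : hat (μ p δ) (j • p) - hat (μ p δ') (j • p) =
        (hat ν (j • p) - hat (μ p δ') (j • p)) - (hat ν (j • p) - hat (μ p δ) (j • p)) := by ring
      rw [e]
      refine (norm_sub_le _ _).trans ((add_le_add h2 h1).trans (le_of_eq ?_))
      rw [hB]; field_simp; ring
    simp only [Function.comp_apply]
    rw [Real.norm_of_nonneg (by positivity)]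
    calc _ ≤ (B / |(j : ℝ)|) ^ 2 := by gcongr
      _ = _ := by rw [div_pow, sq_abs]; ring
  · intro k hk
    have hc : cross k p ≠ 0 := fun h => hk (by obtain ⟨j, hj⟩ := hp.2 k h; exact ⟨j, hj.symm⟩)
    rw [H.hat_of_cross hδ hc, H.hat_of_cross hδ' hc]
    simp

/-- The singular part does not depend on the scale, hence lies below `μ p ε` for every `ε > 0`, and
the integral of `|D|²` against it is at most `C ε`. -/
theorem ae_slope_eq_zero {p : Fin 2 → ℤ} (hp : IsPrimitive p) {δ : ℝ} (hδ : 0 < δ) :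
    ∀ᵐ x ∂(μ p δ).singularPart volume, series (slopeCoeff v p) x = 0 := by
  have := H.finite p
  have hs := summable_slopeCoeff H.summable_pot p
  have hD := continuous_series hs
  obtain ⟨C, hC⟩ := H.integral_slope_sq_le hp
  set σ := (μ p δ).singularPart volume with hσ
  have hi : ∀ m : Measure Torus, IsFiniteMeasure m →
      Integrable (fun x => ‖series (slopeCoeff v p) x‖ ^ 2) m := fun m _ =>
    (integrable_of_continuous m (f := fun x => ((‖series (slopeCoeff v p) x‖ ^ 2 : ℝ) : ℂ))
      (by fun_prop)).re
  have hle : ∀ ε, 0 < ε → ε ≤ 1 → ∫ x, ‖series (slopeCoeff v p) x‖ ^ 2 ∂σ ≤ C * ε :=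
    fun ε hε hε1 => by
      refine le_trans ?_ (hC ε hε hε1)
      refine integral_mono_measure ?_ (Eventually.of_forall fun x => by positivity) (hi _ (H.finite p ε))
      rw [hσ, H.singularPart_eq hp hδ hε]
      exact Measure.singularPart_le _ _
  have h0 : ∫ x, ‖series (slopeCoeff v p) x‖ ^ 2 ∂σ ≤ 0 := by
    have hlim : Tendsto (fun ε : ℝ => C * ε) (𝓝[>] 0) (𝓝 0) := by
      have : Tendsto (fun ε : ℝ => C * ε) (𝓝 0) (𝓝 (C * 0)) := tendsto_id.const_mul C
      rw [mul_zero] at this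
      exact this.mono_left nhdsWithin_le_nhds
    refine ge_of_tendsto hlim ?_
    filter_upwards [Ioo_mem_nhdsGT one_pos] with ε hε
    exact hle ε hε.1 hε.2.le
  have h1 := le_antisymm h0 (integral_nonneg fun x => by positivity)
  have h2 := (integral_eq_zero_iff_of_nonneg (fun x => by positivity) (hi σ inferInstance)).1 h1
  filter_upwards [h2] with x hx
  simpa using hx

/-- At `k = j • p` with `p` primitive and `j ≠ 0`, only the measure attached to `p` contributes to
the sum, so comparison with `ν` reduces to the bound along one line. -/
theorem exists_scales [IsFiniteMeasure ν] : ∃ δ : (Fin 2 → ℤ) → ℝ, (∀ p, 0 < δ p) ∧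
    ν.singularPart volume =
      Measure.sum (fun p : primitives => (μ p (δ p)).singularPart volume) ∧
    (Measure.sum fun p : primitives => μ p (δ p)) univ ≤ 1 := by
  have := H.finite
  obtain ⟨C, hC0, hC⟩ := H.regular
  -- Scales growing with `p` make the squared errors `‖p‖² / (δ⁴ j²)` at most `‖p‖⁻³ j⁻²`, which is
  -- summable over `(p, j)`. Large scales are harmless since the singular part does not depend on
  -- them.
  set δ : (Fin 2 → ℤ) → ℝ := fun p => (1 + ‖p‖) ^ 2 with hδ
  have hδ0 : ∀ p, 0 < δ p := fun p => by positivity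
  set N := Measure.sum fun p : primitives => μ p (δ p) with hN
  have hmass : N univ ≤ 1 := by
    rw [hN, Measure.sum_apply _ MeasurableSet.univ, ENNReal.tsum_eq_iSup_sum]
    refine iSup_le fun F => ?_
    have h1 := H.sum_mass (F.map (Function.Embedding.subtype _)) δ hδ0 (by
      intro p hp q hq hpq
      simp only [Finset.mem_map, Function.Embedding.subtype_apply] at hp hq
      obtain ⟨p, -, rfl⟩ := hp
      obtain ⟨q, -, rfl⟩ := hq
      exact cross_ne_zero_of_mem_primitives p.2 q.2 hpq)
    rw [Finset.sum_map] at h1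
    have h2 : ∑ p ∈ F, μ p (δ p) univ = ENNReal.ofReal (∑ p ∈ F, (μ p (δ p)).real univ) := by
      rw [ENNReal.ofReal_sum_of_nonneg fun p _ => measureReal_nonneg]
      exact Finset.sum_congr rfl fun p _ => (ofReal_measureReal).symm
    rw [h2]
    exact ENNReal.ofReal_le_one.2 h1
  have hNfin : IsFiniteMeasure N := ⟨hmass.trans_lt ENNReal.one_lt_top⟩
  refine ⟨δ, hδ0, ?_, hmass⟩
  rw [← singularPart_sum]
  refine singularPart_eq_of_summable_sq ?_
  have hhat : ∀ (p : primitives) (j : ℤ), j ≠ 0 → hat N (j • (p : Fin 2 → ℤ)) =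
      hat (μ p (δ p)) (j • (p : Fin 2 → ℤ)) := fun p j hj => by
    have h1 := hasSum_integral_measure
      (integrable_of_continuous N (mFourier (j • (p : Fin 2 → ℤ))).continuous)
    have h2 := hasSum_single (f := fun q : primitives => hat (μ q (δ q)) (j • (p : Fin 2 → ℤ))) p
      fun q hq => H.hat_of_cross (hδ0 q) (by
        have := cross_ne_zero_of_mem_primitives p.2 q.2 (fun h => hq (Subtype.ext h.symm))
        have e : cross (j • (p : Fin 2 → ℤ)) q = j * cross p q := by simp [cross]; ring
        rw [e]; exact mul_ne_zero hj this)
    exact h1.unique h2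
  choose P J hPJ hPJ0 using exists_primitive
  have hinj : Function.Injective fun k => (P k, J k) := fun k k' h => by
    rw [Prod.mk.injEq] at h
    rw [hPJ k, hPJ k', h.1, h.2]
  have hs := (((EisensteinSeries.summable_one_div_norm_rpow (k := 3) (by norm_num)).mul_of_nonneg
    (Real.summable_one_div_int_pow.2 one_lt_two) (fun p => by positivity)
    (fun j => by positivity)).comp_injective hinj).mul_left (C ^ 2)
  refine Summable.of_norm_bounded_eventually hs ?_
  rw [eventually_cofinite]
  refine (finite_singleton (0 : Fin 2 → ℤ)).subset fun k hk => ?_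
  by_contra hk0
  refine hk ?_
  obtain ⟨hp, hj⟩ := hPJ0 k hk0
  have hj1 : (0 : ℝ) < |(J k : ℝ)| := by positivity
  have hp1 := one_le_norm_of_ne_zero hp.1.1
  have h1 := hC (P k) (J k) (δ (P k)) hj (hδ0 _)
  have h2 : hat N (J k • P k) = hat (μ (P k) (δ (P k))) (J k • P k) := hhat ⟨P k, hp⟩ _ hj
  rw [← h2, ← hPJ k] at h1
  simp only [Function.comp_apply]
  rw [Real.norm_of_nonneg (by positivity), Real.rpow_neg (by positivity),
    show (3 : ℝ) = ((3 : ℕ) : ℝ) by norm_num, Real.rpow_natCast]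
  have h3 : (‖P k‖ / (δ (P k) ^ 2 * |(J k : ℝ)|)) ^ 2 ≤ (‖P k‖ ^ 3)⁻¹ * (1 / (J k : ℝ) ^ 2) := by
    rw [div_pow, mul_pow, sq_abs, ← one_div, div_mul_div_comm, one_mul,
      div_le_div_iff₀ (by positivity) (by positivity), hδ]
    have h4 : ‖P k‖ ^ 5 ≤ (1 + ‖P k‖) ^ 8 :=
      (pow_le_pow_left₀ (by positivity) (by linarith) 5).trans
        (pow_le_pow_right₀ (by linarith) (by norm_num))
    calc _ = ‖P k‖ ^ 5 * (J k : ℝ) ^ 2 := by ring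
      _ ≤ (1 + ‖P k‖) ^ 8 * (J k : ℝ) ^ 2 := by gcongr
      _ = _ := by ring
  calc _ ≤ (C * (‖P k‖ / (δ (P k) ^ 2 * |(J k : ℝ)|))) ^ 2 := by gcongr
    _ = C ^ 2 * (‖P k‖ / (δ (P k) ^ 2 * |(J k : ℝ)|)) ^ 2 := by ring
    _ ≤ _ := by gcongr

end ConcentrationMeasures

/-! ### Closed geodesics and the averaged potential -/

/-- The integer direction orthogonal to `p`. -/
noncomputable def perp (p : Fin 2 → ℤ) : Plane := !₂[-(p 1 : ℝ), (p 0 : ℝ)]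

theorem perp_zero (p : Fin 2 → ℤ) : perp p 0 = -(p 1 : ℝ) := rfl

theorem perp_one (p : Fin 2 → ℤ) : perp p 1 = (p 0 : ℝ) := rfl

theorem toTorus_perp (p : Fin 2 → ℤ) : toTorus (perp p) = 0 := by
  funext i
  fin_cases i
  · simp [toTorus, perp_zero]
  · simp [toTorus, perp_one]

theorem perp_ne_zero {p : Fin 2 → ℤ} (hp : p ≠ 0) : perp p ≠ 0 := by
  intro h
  refine hp (funext fun i => ?_)
  have h0 : perp p 0 = 0 := by rw [h]; rfl
  have h1 : perp p 1 = 0 := by rw [h]; rfl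
  rw [perp_zero] at h0
  rw [perp_one] at h1
  fin_cases i
  · exact Int.cast_eq_zero.1 h1
  · exact Int.cast_eq_zero.1 (neg_eq_zero.1 h0)

theorem isPeriod_perp (p : Fin 2 → ℤ) : IsPeriod (perp p) 1 :=
  ⟨one_pos, by rw [one_smul, toTorus_perp]⟩

theorem perp_mem_periodicVelocities {p : Fin 2 → ℤ} (hp : p ≠ 0) : perp p ∈ periodicVelocities :=
  ⟨perp_ne_zero hp, 1, isPeriod_perp p⟩

theorem mFourier_smul_perp (l p : Fin 2 → ℤ) (s : ℝ) :
    mFourier l (toTorus (s • perp p)) = Complex.exp (2 * Real.pi * Complex.I * (-cross l p : ℤ) * s) := by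
  rw [mFourier_toTorus]
  congr 1
  simp only [PiLp.smul_apply, perp_zero, perp_one, smul_eq_mul, cross]
  push_cast
  ring

theorem mFourier_smul_perp_of_cross {l p : Fin 2 → ℤ} (h : cross l p = 0) (s : ℝ) :
    mFourier l (toTorus (s • perp p)) = 1 := by
  rw [mFourier_smul_perp, h]; simp

end Torus

theorem AddCircle.exists_int_of_coe_eq_zero {t : ℝ} (h : (t : UnitAddCircle) = 0) :
    ∃ m : ℤ, t = m := by
  obtain ⟨m, hm⟩ := (AddCircle.coe_eq_zero_iff 1).1 h
  exact ⟨m, by simpa using hm.symm⟩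

namespace Torus

theorem exists_smul_perp_of_periodic {ξ : Plane} (hξ : ξ ∈ periodicVelocities) :
    ∃ p ∈ primitives, ∃ t : ℝ, t ≠ 0 ∧ ξ = t • perp p := by
  obtain ⟨h0, T, hT, hTξ⟩ := hξ
  obtain ⟨a, ha⟩ := AddCircle.exists_int_of_coe_eq_zero (congrFun hTξ 0)
  obtain ⟨b, hb⟩ := AddCircle.exists_int_of_coe_eq_zero (congrFun hTξ 1)
  obtain ⟨p, j, hpj, hp⟩ := exists_primitive ![b, -a]
  simp only [PiLp.smul_apply, smul_eq_mul] at ha hb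
  have hb' : (b : ℝ) = j * p 0 := by
    have := congrFun hpj 0
    simp only [Matrix.cons_val_zero, Pi.smul_apply, smul_eq_mul] at this
    exact_mod_cast this
  have ha' : (a : ℝ) = -(j * p 1) := by
    have := congrFun hpj 1
    have h3 : -a = j * p 1 := this
    have h2 : a = -(j * p 1) := by linarith
    exact_mod_cast h2
  have hξ : ξ = (T⁻¹ * j) • perp p := by
    ext i
    fin_cases i
    · simp only [Fin.zero_eta, PiLp.smul_apply, smul_eq_mul, perp_zero]
      field_simp; linarith
    · simp only [Fin.mk_one, PiLp.smul_apply, smul_eq_mul, perp_one]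
      field_simp; linarith
  have hne : (![b, -a] : Fin 2 → ℤ) ≠ 0 := by
    intro h
    rw [h] at hpj
    have h3 := congrFun h 0
    have h4 := congrFun h 1
    simp only [Matrix.cons_val_zero, Matrix.cons_val_one, Pi.zero_apply, neg_eq_zero] at h3 h4
    rw [h4] at ha
    rw [h3] at hb
    refine h0 ?_
    ext i
    fin_cases i
    · simpa [hT.ne'] using ha
    · simpa [hT.ne'] using hb
  have := (hp hne).2
  exact ⟨p, (hp hne).1, T⁻¹ * j, by positivity, hξ⟩

theorem range_geodesic_smul (x : Torus) (ξ : Plane) {t : ℝ} (ht : t ≠ 0) :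
    range (geodesic x (t • ξ)) = range (geodesic x ξ) := by
  ext y
  constructor
  · rintro ⟨s, rfl⟩
    exact ⟨s * t, by rw [geodesic, geodesic, mul_smul]⟩
  · rintro ⟨s, rfl⟩
    exact ⟨s / t, by rw [geodesic, geodesic, smul_smul, div_mul_cancel₀ _ ht]⟩

theorem exists_primitive_of_isClosedGeodesic {γ : Set Torus} (hγ : IsClosedGeodesic γ) :
    ∃ x, ∃ p ∈ primitives, γ = range (geodesic x (perp p)) := by
  obtain ⟨x, ξ, hξ, rfl⟩ := hγ
  obtain ⟨p, hp, t, ht, rfl⟩ := exists_smul_perp_of_periodic hξ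
  exact ⟨x, p, hp, range_geodesic_smul x _ ht⟩

theorem norm_exp_phase_le (m : ℤ) (s : ℝ) :
    ‖Complex.exp (2 * Real.pi * Complex.I * m * s)‖ = 1 := by
  rw [show (2 * Real.pi * Complex.I * m * s : ℂ) = ((2 * Real.pi * m * s : ℝ) : ℂ) * Complex.I by
    push_cast; ring, Complex.norm_exp_ofReal_mul_I]

theorem integral_exp_phase {m : ℤ} (hm : m ≠ 0) (T : ℝ) :
    ∫ s in (0 : ℝ)..T, Complex.exp (2 * Real.pi * Complex.I * m * s) =
      (Complex.exp (2 * Real.pi * Complex.I * m * T) - 1) / (2 * Real.pi * Complex.I * m) := by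
  rw [integral_exp_mul_complex]
  · simp
  · have : (m : ℂ) ≠ 0 := by exact_mod_cast hm
    simp [Real.pi_ne_zero, this]

/-- The mean of a phase over `[0, T]`. -/
noncomputable def meanPhase (m : ℤ) (T : ℝ) : ℂ :=
  (T : ℂ)⁻¹ * ∫ s in (0 : ℝ)..T, Complex.exp (2 * Real.pi * Complex.I * m * s)

theorem norm_meanPhase_le (m : ℤ) {T : ℝ} (hT : 0 < T) : ‖meanPhase m T‖ ≤ 1 := by
  have := intervalIntegral.norm_integral_le_of_norm_le_const (C := 1) (a := 0) (b := T)
    (f := fun s : ℝ => Complex.exp (2 * Real.pi * Complex.I * m * s))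
    (fun s _ => (norm_exp_phase_le m s).le)
  rw [meanPhase, norm_mul, norm_inv, Complex.norm_real, Real.norm_of_nonneg hT.le,
    inv_mul_le_iff₀ hT]
  simpa [abs_of_pos hT] using this

theorem meanPhase_zero {T : ℝ} (hT : 0 < T) : meanPhase 0 T = 1 := by
  have : (T : ℂ) ≠ 0 := by exact_mod_cast hT.ne'
  simp [meanPhase, this]

theorem tendsto_meanPhase {m : ℤ} (hm : m ≠ 0) : Tendsto (meanPhase m) atTop (𝓝 0) := by
  have h1 : Tendsto (fun T : ℝ => T⁻¹ * (2 / ‖(2 * Real.pi * Complex.I * m : ℂ)‖)) atTop (𝓝 0) := by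
    simpa using tendsto_inv_atTop_zero.mul_const (2 / ‖(2 * Real.pi * Complex.I * m : ℂ)‖)
  refine squeeze_zero_norm' ?_ h1
  filter_upwards [eventually_gt_atTop 0] with T hT
  rw [meanPhase, integral_exp_phase hm, norm_mul, norm_inv, Complex.norm_real,
    Real.norm_of_nonneg hT.le, norm_div]
  gcongr
  refine (norm_sub_le _ _).trans ?_
  rw [norm_exp_phase_le, norm_one]; norm_num

theorem meanPhase_one {m : ℤ} (hm : m ≠ 0) : meanPhase m 1 = 0 := by
  rw [meanPhase, integral_exp_phase hm]
  have : Complex.exp (2 * Real.pi * Complex.I * m * (1 : ℝ)) = 1 := by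
    rw [Complex.exp_eq_one_iff]
    exact ⟨m, by push_cast; ring⟩
  rw [this]; simp

/-- The Fourier coefficients of the average of the potential along the directions orthogonal
to `p`. -/
noncomputable def averageCoeff (v : (Fin 2 → ℤ) → ℂ) (p l : Fin 2 → ℤ) : ℂ :=
  if cross l p = 0 then v l else 0

theorem norm_averageCoeff_le (v : (Fin 2 → ℤ) → ℂ) (p l : Fin 2 → ℤ) :
    ‖averageCoeff v p l‖ ≤ ‖v l‖ := by
  unfold averageCoeff; split_ifs <;> simp

theorem continuous_geodesic (x : Torus) (ξ : Plane) : Continuous (geodesic x ξ) := by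
  unfold geodesic
  exact continuous_const.add (continuous_toTorus.comp (by fun_prop))

theorem series_averageCoeff_add (v : (Fin 2 → ℤ) → ℂ) (p : Fin 2 → ℤ) (x : Torus) (s : ℝ) :
    series (averageCoeff v p) (x + toTorus (s • perp p)) = series (averageCoeff v p) x := by
  refine tsum_congr fun l => ?_
  unfold averageCoeff
  split_ifs with hl
  · rw [mFourier_add_point, mFourier_smul_perp_of_cross hl, mul_one]
  · simp

theorem series_slopeCoeff_add (v : (Fin 2 → ℤ) → ℂ) (p : Fin 2 → ℤ) (x : Torus) (s : ℝ) :
    series (slopeCoeff v p) (x + toTorus (s • perp p)) = series (slopeCoeff v p) x := by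
  refine tsum_congr fun l => ?_
  unfold slopeCoeff
  split_ifs with hl
  · rw [mFourier_add_point, mFourier_smul_perp_of_cross hl, mul_one]
  · simp

section average

variable {V : Torus → ℝ} (hV : SmoothOnTorus V)
include hV

theorem hasSum_potential (x : Torus) :
    HasSum (fun l => coeff (fun x => (V x : ℂ)) l * mFourier l x) (V x : ℂ) :=
  hasSum_apply_of_summable_coeff (f := ⟨fun x => (V x : ℂ),
    SmoothOnTorus.continuous (smoothOnTorus_ofReal hV)⟩)
    (summable_pot_norm (summable_coeff (smoothOnTorus_ofReal hV))) x

theorem mean_potential_eq (x : Torus) (p : Fin 2 → ℤ) (T : ℝ) :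
    ((T⁻¹ * ∫ s in (0 : ℝ)..T, V (geodesic x (perp p) s) : ℝ) : ℂ) =
      ∑' l, coeff (fun x => (V x : ℂ)) l * mFourier l x * meanPhase (-cross l p) T := by
  set v := coeff fun x => (V x : ℂ) with hv
  have hs : Summable fun l => ‖v l‖ := summable_pot_norm (summable_coeff (smoothOnTorus_ofReal hV))
  have hterm : ∀ l s, v l * mFourier l (geodesic x (perp p) s) =
      v l * mFourier l x * Complex.exp (2 * Real.pi * Complex.I * (-cross l p : ℤ) * s) := fun l s => by
    rw [geodesic, mFourier_add_point, mFourier_smul_perp, ← mul_assoc]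
  have h := intervalIntegral.hasSum_integral_of_dominated_convergence (μ := volume) (a := 0) (b := T)
    (F := fun l s => v l * mFourier l (geodesic x (perp p) s))
    (f := fun s => (V (geodesic x (perp p) s) : ℂ)) (fun l _ => ‖v l‖)
    (fun l => ?_) (fun l => ?_) ?_ ?_ ?_
  · have h2 := h.mul_left (T : ℂ)⁻¹
    rw [intervalIntegral.integral_ofReal] at h2
    push_cast
    rw [← h2.tsum_eq]
    refine tsum_congr fun l => ?_
    simp only [hterm]
    rw [intervalIntegral.integral_const_mul, meanPhase]
    ring
  · exact (continuous_const.mul ((mFourier l).continuous.comp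
      (continuous_geodesic x _))).aestronglyMeasurable
  · refine Eventually.of_forall fun s _ => ?_
    rw [norm_mul, norm_mFourier_apply, mul_one]
  · exact Eventually.of_forall fun s _ => hs
  · exact _root_.intervalIntegrable_const
  · exact Eventually.of_forall fun s _ => hasSum_potential hV _

/-- Along the direction orthogonal to `p` the mode `l` oscillates at frequency `-cross l p`; its
mean tends to zero unless `l` is parallel to `p`. Dominated convergence sums over the modes. -/
theorem geodesicAverage_perp (x : Torus) (p : Fin 2 → ℤ) :
    geodesicAverage V x (perp p) =
      (series (averageCoeff (coeff fun x => (V x : ℂ)) p) x).re := by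
  refine Tendsto.limUnder_eq ?_
  set v := coeff fun x => (V x : ℂ) with hv
  have hs : Summable fun l => ‖v l‖ := summable_pot_norm (summable_coeff (smoothOnTorus_ofReal hV))
  have h1 : Tendsto (fun T : ℝ => ∑' l, v l * mFourier l x * meanPhase (-cross l p) T) atTop
      (𝓝 (series (averageCoeff v p) x)) := by
    refine tendsto_tsum_of_dominated_convergence hs (fun l => ?_) ?_
    · unfold averageCoeff
      split_ifs with hl
      · have : Tendsto (fun _ : ℝ => v l * mFourier l x) atTop (𝓝 (v l * mFourier l x)) :=
          tendsto_const_nhds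
        refine this.congr' ?_
        filter_upwards [eventually_gt_atTop 0] with T hT
        rw [hl, neg_zero, meanPhase_zero hT, mul_one]
      · simpa using (tendsto_meanPhase (neg_ne_zero.2 hl)).const_mul (v l * mFourier l x)
    · filter_upwards [eventually_gt_atTop 0] with T hT l
      rw [norm_mul, norm_mul, norm_mFourier_apply, mul_one]
      exact mul_le_of_le_one_right (norm_nonneg _) (norm_meanPhase_le _ hT)
  have h2 := (Complex.continuous_re.tendsto _).comp h1
  refine h2.congr' ?_
  refine Eventually.of_forall fun T => ?_
  simp only [Function.comp_apply]
  rw [← mean_potential_eq hV x p T, Complex.ofReal_re]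

/-- The differential of the averaged potential. -/
theorem hasFDerivAt_geodesicAverage (x : Torus) (p : Fin 2 → ℤ) :
    HasFDerivAt (fun y : Plane => geodesicAverage V (x + toTorus y) (perp p))
      (Complex.reCLM.comp (∑' l, (averageCoeff (coeff fun x => (V x : ℂ)) p l *
        mFourier l x) • phase l)) 0 := by
  simp only [geodesicAverage_perp hV]
  set v := coeff fun x => (V x : ℂ) with hv
  have hpot := summable_coeff (smoothOnTorus_ofReal hV)
  have hs : Summable fun l => ‖v l‖ := summable_pot_norm hpot
  have hphase : ∀ l, ‖phase l‖ ≤ 4 * Real.pi * ‖l‖ := fun l => by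
    refine ContinuousLinearMap.opNorm_le_bound _ (by positivity) fun y => ?_
    have h1 : ‖phase l y‖ = 2 * Real.pi * |(l 0 : ℝ) * y 0 + l 1 * y 1| := by
      rw [phase_apply, show (2 * Real.pi * Complex.I * ((l 0 : ℂ) * (y 0 : ℝ) + l 1 * (y 1 : ℝ)) : ℂ) =
        ((2 * Real.pi * (l 0 * y 0 + l 1 * y 1) : ℝ) : ℂ) * Complex.I by push_cast; ring,
        norm_mul, Complex.norm_I, mul_one, Complex.norm_real, Real.norm_eq_abs, abs_mul,
        abs_of_pos (by positivity)]
    have h2 : ∀ i, |y i| ≤ ‖y‖ := fun i => by simpa using PiLp.norm_apply_le y i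
    have h3 : |(l 0 : ℝ) * y 0 + l 1 * y 1| ≤ 2 * (‖l‖ * ‖y‖) := by
      refine (abs_add_le _ _).trans ?_
      rw [abs_mul, abs_mul]
      have := mul_le_mul (abs_coord_le l 0) (h2 0) (abs_nonneg _) (norm_nonneg _)
      have := mul_le_mul (abs_coord_le l 1) (h2 1) (abs_nonneg _) (norm_nonneg _)
      linarith
    rw [h1]
    calc _ ≤ 2 * Real.pi * (2 * (‖l‖ * ‖y‖)) := by gcongr
      _ = _ := by ring
  have h := hasFDerivAt_tsum (𝕜 := ℝ) (u := fun l => ‖v l‖ * ‖l‖ * (4 * Real.pi))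
    (f := fun l y => averageCoeff v p l * mFourier l (x + toTorus y))
    (f' := fun l y => (averageCoeff v p l * mFourier l (x + toTorus y)) • phase l) (x₀ := 0)
    ((summable_pot_mul_norm hpot).mul_right _)
    (fun l y => by
      have := (hasFDerivAt_mFourier l x y).const_mul (averageCoeff v p l)
      rwa [smul_smul] at this)
    (fun l y => by
      rw [norm_smul, norm_mul, norm_mFourier_apply, mul_one]
      calc _ ≤ ‖v l‖ * (4 * Real.pi * ‖l‖) := by
            gcongr
            · exact norm_averageCoeff_le v p l
            · exact hphase l
        _ = _ := by ring)
    (Summable.of_norm_bounded hs fun l => by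
      rw [norm_mul, norm_mFourier_apply, mul_one]; exact norm_averageCoeff_le v p l) 0
  simp only [toTorus_zero, add_zero] at h
  exact Complex.reCLM.hasFDerivAt.comp 0 h

/-- The modes of the average are multiples of the primitive vector `p`, so its differential at `x`
is the slope series at `x` times a fixed linear form. -/
theorem mem_criticalSet_of_slope {p : Fin 2 → ℤ} (hp : IsPrimitive p) {x : Torus}
    (hx : series (slopeCoeff (coeff fun x => (V x : ℂ)) p) x = 0) : x ∈ criticalSet V := by
  refine ⟨perp p, perp_mem_periodicVelocities hp.1, ?_⟩
  refine (hasFDerivAt_geodesicAverage hV x p).congr_fderiv ?_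
  set v := coeff fun x => (V x : ℂ) with hv
  have hpp : 0 < dot p p := by
    have h1 := dot_self_nonneg p
    refine lt_of_le_of_ne h1 fun h => hp.1 ?_
    simp only [dot] at h
    have h0 : (p 0 : ℝ) = 0 := by nlinarith [mul_self_nonneg (p 0 : ℝ), mul_self_nonneg (p 1 : ℝ)]
    have h1 : (p 1 : ℝ) = 0 := by nlinarith [mul_self_nonneg (p 0 : ℝ), mul_self_nonneg (p 1 : ℝ)]
    funext i
    fin_cases i
    · exact Int.cast_eq_zero.1 h0
    · exact Int.cast_eq_zero.1 h1
  have e : ∀ l, (averageCoeff v p l * mFourier l x) • phase l =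
      (slopeCoeff v p l * mFourier l x) • (((4 * Real.pi ^ 2 * dot p p : ℝ) : ℂ)⁻¹ • phase p) := fun l => by
    unfold averageCoeff slopeCoeff
    split_ifs with hl
    · obtain ⟨j, rfl⟩ := hp.2 l hl
      have h1 : phase (j • p) = (j : ℂ) • phase p := by
        ext y
        simp only [phase_apply, _root_.smul_apply, Pi.smul_apply, smul_eq_mul]
        push_cast; ring
      have h2 : dot (j • p) p = j * dot p p := by
        simp only [dot, Pi.smul_apply, smul_eq_mul]; push_cast; ring
      rw [h1, h2, smul_smul, smul_smul]
      congr 1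
      have h3 : (dot p p : ℂ) ≠ 0 := by exact_mod_cast hpp.ne'
      have h4 : (Real.pi : ℂ) ≠ 0 := by exact_mod_cast Real.pi_ne_zero
      push_cast
      field_simp
    · ext y; simp
  have hs := summable_slopeCoeff (summable_coeff (smoothOnTorus_ofReal hV)) p
  simp only [e]
  rw [(summable_series hs x).tsum_smul_const]
  change Complex.reCLM.comp (series (slopeCoeff v p) x • _) = 0
  rw [hx]
  ext y
  simp

theorem mem_criticalSet_add_smul_perp {p : Fin 2 → ℤ} {x : Torus} (s : ℝ)
    (hx : HasFDerivAt (fun y : Plane => geodesicAverage V (x + toTorus y) (perp p))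
      (0 : Plane →L[ℝ] ℝ) 0) (hp : p ≠ 0) : x + toTorus (s • perp p) ∈ criticalSet V := by
  refine ⟨perp p, perp_mem_periodicVelocities hp, ?_⟩
  have e : ∀ y, geodesicAverage V (x + toTorus (s • perp p) + toTorus y) (perp p) =
      geodesicAverage V (x + toTorus y) (perp p) := fun y => by
    rw [geodesicAverage_perp hV, geodesicAverage_perp hV, add_right_comm,
      series_averageCoeff_add]
  simpa only [e] using hx

theorem range_geodesic_subset_of_slope {p : Fin 2 → ℤ} (hp : IsPrimitive p) {x : Torus}
    (hx : series (slopeCoeff (coeff fun x => (V x : ℂ)) p) x = 0) :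
    range (geodesic x (perp p)) ⊆ criticalSet V := by
  rintro _ ⟨s, rfl⟩
  refine mem_criticalSet_of_slope hV hp ?_
  rw [geodesic, series_slopeCoeff_add, hx]

/-- In each rational direction there is a critical closed geodesic. -/
theorem exists_critical_geodesic {p : Fin 2 → ℤ} (hp : p ≠ 0) :
    ∃ x, range (geodesic x (perp p)) ⊆ criticalSet V := by
  have hs : Summable fun l => ‖averageCoeff (coeff fun x => (V x : ℂ)) p l‖ :=
    Summable.of_nonneg_of_le (fun _ => norm_nonneg _) (norm_averageCoeff_le _ p)
      (summable_pot_norm (summable_coeff (smoothOnTorus_ofReal hV)))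
  have hc : Continuous fun x => geodesicAverage V x (perp p) := by
    simp only [geodesicAverage_perp hV]
    exact Complex.continuous_re.comp (continuous_series hs)
  -- A maximum point of the averaged potential is critical, and the average is constant along the
  -- geodesic through it.
  obtain ⟨x, -, hx⟩ := isCompact_univ.exists_isMaxOn (univ_nonempty (α := Torus)) hc.continuousOn
  refine ⟨x, ?_⟩
  rintro _ ⟨s, rfl⟩
  refine mem_criticalSet_add_smul_perp hV s ?_ hp
  have h1 := hasFDerivAt_geodesicAverage hV x p
  have h2 : IsLocalMax (fun y : Plane => geodesicAverage V (x + toTorus y) (perp p)) 0 :=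
    Eventually.of_forall fun y => by
      simpa [toTorus_zero] using hx (mem_univ (x + toTorus y))
  have h3 := h2.hasFDerivAt_eq_zero h1
  rwa [h3] at h1

end average

/-! ### Invariance and null sets -/

theorem map_add_right_eq_of_hat {m : Measure Torus} [IsFiniteMeasure m] {τ : Torus}
    (h : ∀ k, hat m k ≠ 0 → mFourier k τ = 1) : m.map (· + τ) = m := by
  have hτ : Measurable fun x : Torus => x + τ := measurable_add_const τ
  have : IsFiniteMeasure (m.map (· + τ)) := Measure.isFiniteMeasure_map m _
  refine measure_ext_of_coeff fun k => ?_
  rw [integral_map hτ.aemeasurable (mFourier k).continuous.aestronglyMeasurable]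
  simp only [mFourier_add_point]
  rw [integral_mul_const]
  change hat m k * _ = hat m k
  by_cases hk : hat m k = 0
  · rw [hk, zero_mul]
  · rw [h k hk, mul_one]

/-- Translation preserves Lebesgue measure, so it carries the Lebesgue decomposition to itself by
uniqueness. -/
theorem singularPart_map_add_right {m : Measure Torus} [IsFiniteMeasure m] {τ : Torus}
    (h : m.map (· + τ) = m) :
    (m.singularPart volume).map (· + τ) = m.singularPart volume := by
  have hτ : Measurable fun x : Torus => x + τ := measurable_add_const τ
  have hvol : (volume : Measure Torus).map (· + τ) = volume := map_add_right_eq_self volume τ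
  set a := (volume : Measure Torus).withDensity (m.rnDeriv volume) with ha
  have hm : m = m.singularPart volume + a := m.haveLebesgueDecomposition_add volume
  have : IsFiniteMeasure (a.map (· + τ)) := Measure.isFiniteMeasure_map a _
  refine eq_singularPart_of_add_ac (a := a.map (· + τ)) ?_ ?_ ?_
  · have h1 := (MeasurableEquiv.addRight τ).measurableEmbedding.mutuallySingular_map
      (m.mutuallySingular_singularPart volume)
    rwa [MeasurableEquiv.coe_addRight, hvol] at h1
  · have h1 := (withDensity_absolutelyContinuous volume (m.rnDeriv volume)).map hτ
    rwa [hvol] at h1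
  · rw [← Measure.map_add _ _ hτ, ← hm, h]

/-- A measure invariant under a flow does not charge the fibres of a transversal character. -/
theorem measure_fibre_eq_zero {m : Measure Torus} [IsFiniteMeasure m] {ζ : Plane}
    (h : ∀ s : ℝ, m.map (· + toTorus (s • ζ)) = m) {q : Fin 2 → ℤ}
    (hq : (q 0 : ℝ) * ζ 0 + q 1 * ζ 1 ≠ 0) (z : ℂ) : m {y | mFourier q y = z} = 0 := by
  set c := (q 0 : ℝ) * ζ 0 + q 1 * ζ 1 with hc
  have hmF : ∀ s : ℝ, mFourier q (toTorus ((s / c) • ζ)) = Complex.exp (2 * Real.pi * Complex.I * s) := by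
    intro s
    rw [mFourier_toTorus]
    congr 1
    have hc' : (c : ℂ) ≠ 0 := by exact_mod_cast hq
    have : (q 0 : ℂ) * (ζ 0 : ℝ) + q 1 * (ζ 1 : ℝ) = c := by rw [hc]; push_cast; ring
    simp only [PiLp.smul_apply, smul_eq_mul]
    push_cast
    rw [show (2 * Real.pi * Complex.I * s : ℂ) = 2 * Real.pi * Complex.I * (s * (c / c)) by
      rw [div_self hc', mul_one], ← this]
    ring
  -- The flow moves the fibre through uncountably many pairwise disjoint fibres of equal measure; a
  -- finite measure charges only countably many of them.
  set A : Ioo (0 : ℝ) 1 → Set Torus := fun s =>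
    {y | mFourier q y = z * Complex.exp (2 * Real.pi * Complex.I * (s : ℝ))} with hA
  have hmeas : ∀ w : ℂ, MeasurableSet {y : Torus | mFourier q y = w} := fun w =>
    (isClosed_eq (mFourier q).continuous continuous_const).measurableSet
  have hdisj : Pairwise (Function.onFun Disjoint A) := by
    intro s t hst
    refine Set.disjoint_left.2 fun y hy hy' => hst ?_
    have hy1 : mFourier q y = z * Complex.exp (2 * Real.pi * Complex.I * (s : ℝ)) := hy
    have hy2 : mFourier q y = z * Complex.exp (2 * Real.pi * Complex.I * (t : ℝ)) := hy'
    have hz : z ≠ 0 := by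
      rintro rfl
      have := norm_mFourier_apply q y
      rw [hy1, zero_mul, norm_zero] at this
      exact zero_ne_one this
    have h3 := mul_left_cancel₀ hz (hy1.symm.trans hy2)
    obtain ⟨n, hn⟩ := Complex.exp_eq_exp_iff_exists_int.1 h3
    have h4 : ((s : ℝ) : ℂ) = (t : ℝ) + n := by
      have h5 : (2 * Real.pi * Complex.I : ℂ) ≠ 0 := by simp [Real.pi_ne_zero]
      refine mul_left_cancel₀ h5 ?_
      rw [hn]; ring
    have h5 : (s : ℝ) = t + n := by exact_mod_cast h4
    have hs := s.2
    have ht := t.2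
    have h6 : n < 1 := by
      have : (n : ℝ) < 1 := by linarith [hs.2, ht.1]
      exact_mod_cast this
    have h7 : -1 < n := by
      have : (-1 : ℝ) < n := by linarith [hs.1, ht.2]
      exact_mod_cast this
    have h8 : n = 0 := by omega
    exact Subtype.ext (by rw [h5, h8]; simp)
  have heq : ∀ s, m (A s) = m {y | mFourier q y = z} := fun s => by
    conv_lhs => rw [← h ((s : ℝ) / c)]
    rw [Measure.map_apply (measurable_add_const _) (hmeas _)]
    congr 1
    ext y
    simp only [mem_preimage, mem_ofPred_eq, mFourier_add_point, hmF]
    exact mul_left_inj' (Complex.exp_ne_zero _)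
  have hcount := Measure.countable_meas_pos_of_disjoint_iUnion (μ := m) (fun s => hmeas _) hdisj
  by_contra hne
  have huniv : {i | 0 < m (A i)} = univ := by
    refine eq_univ_of_forall fun s => ?_
    change 0 < m (A s)
    rw [heq]
    exact pos_iff_ne_zero.2 hne
  rw [huniv, countable_univ_iff, Set.countable_coe_iff] at hcount
  exact (Cardinal.Real.Ioo_countable_iff (x := (0 : ℝ)) (y := 1)).1 hcount |>.not_gt one_pos

theorem range_geodesic_subset_fibre (x : Torus) (q : Fin 2 → ℤ) :
    range (geodesic x (perp q)) ⊆ {y | mFourier q y = mFourier q x} := by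
  rintro _ ⟨s, rfl⟩
  rw [mem_ofPred_eq, geodesic, mFourier_add_point, mFourier_smul_perp_of_cross (by rw [cross]; ring), mul_one]

theorem volume_geodesic_eq_zero (x : Torus) {q : Fin 2 → ℤ} (hq : q ≠ 0) :
    volume (range (geodesic x (perp q))) = 0 := by
  refine measure_mono_null (range_geodesic_subset_fibre x q)
    (measure_fibre_eq_zero (ζ := !₂[(q 0 : ℝ), (q 1 : ℝ)])
      (fun s => map_add_right_eq_self volume _) ?_ _)
  intro h
  have h' : (q 0 : ℝ) * q 0 + q 1 * q 1 = 0 := h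
  refine hq (funext fun i => ?_)
  have h0 : (q 0 : ℝ) = 0 := by nlinarith [mul_self_nonneg (q 0 : ℝ), mul_self_nonneg (q 1 : ℝ)]
  have h1 : (q 1 : ℝ) = 0 := by nlinarith [mul_self_nonneg (q 0 : ℝ), mul_self_nonneg (q 1 : ℝ)]
  fin_cases i
  · exact Int.cast_eq_zero.1 h0
  · exact Int.cast_eq_zero.1 h1

namespace ConcentrationMeasures

variable {v : (Fin 2 → ℤ) → ℂ} {ν : Measure Torus} {μ : (Fin 2 → ℤ) → ℝ → Measure Torus}
  (H : ConcentrationMeasures v ν μ)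
include H

theorem map_add_right_eq {p : Fin 2 → ℤ} {δ : ℝ} (hδ : 0 < δ) (s : ℝ) :
    (μ p δ).map (· + toTorus (s • perp p)) = μ p δ := by
  have := H.finite
  refine map_add_right_eq_of_hat fun k hk => mFourier_smul_perp_of_cross ?_ s
  by_contra hc
  exact hk (H.hat_of_cross hδ hc)

theorem geodesic_eq_zero {p q : Fin 2 → ℤ} (hp : p ∈ primitives) (hq : q ∈ primitives) (hpq : p ≠ q)
    {δ : ℝ} (hδ : 0 < δ) (x : Torus) : μ p δ (range (geodesic x (perp q))) = 0 := by
  have := H.finite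
  refine measure_mono_null (range_geodesic_subset_fibre x q)
    (measure_fibre_eq_zero (fun s => H.map_add_right_eq hδ s) ?_ _)
  have h1 := cross_ne_zero_of_mem_primitives hp hq hpq
  rw [perp_zero, perp_one]
  intro h
  refine h1 ?_
  simp only [cross]
  have h2 : ((p 0 * q 1 - p 1 * q 0 : ℤ) : ℝ) = 0 := by push_cast; linarith
  exact_mod_cast h2

end ConcentrationMeasures

end Torus

/-! ### Barycentres and the critical hull -/

/-- A finite measure which is the barycentre of a family of finite measures lies in their closed
convex hull. -/
theorem MeasureTheory.FiniteMeasure.mem_closure_convexHull_of_barycenter {X Y : Type*}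
    [TopologicalSpace X] [MeasurableSpace X] [OpensMeasurableSpace X] [MeasurableSpace Y]
    {S : Set (FiniteMeasure X)} {τ : Measure Y} [IsProbabilityMeasure τ] {F : Y → FiniteMeasure X}
    (hF : ∀ᵐ y ∂τ, F y ∈ S) {m : FiniteMeasure X}
    (hint : ∀ φ : BoundedContinuousFunction X ℝ, Integrable (fun y => ∫ x, φ x ∂(F y : Measure X)) τ)
    (hm : ∀ φ : BoundedContinuousFunction X ℝ,
      ∫ x, φ x ∂(m : Measure X) = ∫ y, ∫ x, φ x ∂(F y : Measure X) ∂τ) :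
    m ∈ closure (convexHull ℝ≥0 S) := by
  classical
  -- Against finitely many test functions the claim is finite-dimensional: an average of points of a
  -- closed convex set stays in it. The pairs (finite set, precision) index the approximating net.
  have key : ∀ i : Finset (BoundedContinuousFunction X ℝ) × ℕ, ∃ m' ∈ convexHull ℝ≥0 S,
      ∀ φ ∈ i.1, |∫ x, φ x ∂(m' : Measure X) - ∫ x, φ x ∂(m : Measure X)| < 1 / ((i.2 : ℝ) + 1) := by
    rintro ⟨Φ, n⟩
    set T : FiniteMeasure X → (Φ → ℝ) := fun m' φ => ∫ x, φ.1 x ∂(m' : Measure X) with hT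
    have hconv : Convex ℝ (T '' convexHull ℝ≥0 S) := by
      rintro _ ⟨m₁, h₁, rfl⟩ _ ⟨m₂, h₂, rfl⟩ a b ha hb hab
      lift a to ℝ≥0 using ha
      lift b to ℝ≥0 using hb
      refine ⟨a • m₁ + b • m₂, convex_convexHull ℝ≥0 S h₁ h₂ zero_le zero_le
        (by exact_mod_cast hab), ?_⟩
      funext φ
      simp only [hT, FiniteMeasure.toMeasure_add, FiniteMeasure.toMeasure_smul, Pi.add_apply,
        Pi.smul_apply, smul_eq_mul]
      rw [integral_add_measure (φ.1.integrable _) (φ.1.integrable _),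
        integral_smul_nnreal_measure, integral_smul_nnreal_measure]
      rfl
    have hmem := hconv.closure.integral_mem (μ := τ) (f := fun y => T (F y)) isClosed_closure
      (by filter_upwards [hF] with y hy
          exact subset_closure ⟨_, subset_convexHull _ _ hy, rfl⟩)
      (Integrable.of_eval fun φ => hint φ.1)
    have e : ∫ y, T (F y) ∂τ = T m := by
      funext φ
      rw [eval_integral (fun φ : Φ => hint φ.1) φ]
      exact (hm φ.1).symm
    rw [e] at hmem
    obtain ⟨_, ⟨m', hm', rfl⟩, hd⟩ := Metric.mem_closure_iff.1 hmem (1 / ((n : ℝ) + 1)) (by positivity)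
    refine ⟨m', hm', fun φ hφ => ?_⟩
    rw [dist_comm] at hd
    exact (dist_le_pi_dist (T m') (T m) ⟨φ, hφ⟩).trans_lt hd
  choose m' hm' hclose using key
  refine mem_closure_of_tendsto (f := m') (b := atTop)
    (FiniteMeasure.tendsto_of_forall_integral_tendsto fun φ => ?_) (Eventually.of_forall hm')
  rw [Metric.tendsto_atTop]
  intro ε hε
  obtain ⟨n, hn⟩ := exists_nat_one_div_lt hε
  refine ⟨({φ}, n), fun i hi => ?_⟩
  refine ((hclose i φ (hi.1 (Finset.mem_singleton_self φ))).trans_le ?_).trans hn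
  have : (n : ℝ) ≤ i.2 := by exact_mod_cast hi.2
  gcongr

namespace Torus

theorem uniformOnGeodesic_one (x : Torus) (ξ : Plane) :
    uniformOnGeodesic x ξ 1 = (volume.restrict (Ioc (0 : ℝ) 1)).map (geodesic x ξ) := by
  rw [uniformOnGeodesic, ProbabilityTheory.cond]
  simp

/-- The uniform measure along the curve `s ↦ x + s ξ`, `0 < s ≤ 1`. -/
noncomputable def geodesicMeasure (ξ : Plane) (x : Torus) : FiniteMeasure Torus :=
  ⟨(volume.restrict (Ioc (0 : ℝ) 1)).map (geodesic x ξ), Measure.isFiniteMeasure_map _ _⟩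

theorem integral_geodesicMeasure {E : Type*} [NormedAddCommGroup E] [NormedSpace ℝ E] {φ : Torus → E}
    (hφ : Continuous φ) (ξ : Plane) (x : Torus) :
    ∫ y, φ y ∂(geodesicMeasure ξ x : Measure Torus) =
      ∫ s in Ioc (0 : ℝ) 1, φ (x + toTorus (s • ξ)) := by
  change ∫ y, φ y ∂((volume.restrict (Ioc (0 : ℝ) 1)).map (geodesic x ξ)) = _
  rw [integral_map (continuous_geodesic x ξ).aemeasurable hφ.aestronglyMeasurable]
  rfl

theorem geodesicMeasure_univ (ξ : Plane) (x : Torus) :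
    (geodesicMeasure ξ x : Measure Torus) univ = 1 := by
  change (volume.restrict (Ioc (0 : ℝ) 1)).map (geodesic x ξ) univ = 1
  rw [Measure.map_apply (continuous_geodesic x ξ).measurable MeasurableSet.univ]
  simp

theorem hat_geodesicMeasure (p k : Fin 2 → ℤ) (x : Torus) :
    hat (geodesicMeasure (perp p) x) k = mFourier k x * meanPhase (-cross k p) 1 := by
  rw [hat, integral_geodesicMeasure (mFourier k).continuous]
  simp only [mFourier_add_point, mFourier_smul_perp]
  rw [integral_const_mul, meanPhase, intervalIntegral.integral_of_le zero_le_one]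
  simp

theorem geodesicMeasure_mem {V : Torus → ℝ} {p : Fin 2 → ℤ} (hp : p ≠ 0) {x : Torus}
    (hx : range (geodesic x (perp p)) ⊆ criticalSet V) :
    geodesicMeasure (perp p) x ∈ criticalGeodesicMeasures V :=
  ⟨x, perp p, 1, perp_ne_zero hp, isPeriod_perp p, hx, (uniformOnGeodesic_one x _).symm⟩

/-- Lebesgue measure, as a finite measure. -/
noncomputable def lebesgue : FiniteMeasure Torus := ⟨volume, inferInstance⟩

/-- Long closed geodesics equidistribute, hence Lebesgue measure is in the critical hull. -/
theorem lebesgue_mem_criticalHull {V : Torus → ℝ} (hV : SmoothOnTorus V) :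
    lebesgue ∈ criticalHull V := by
  -- The orthogonal directions are `(1, n)`. A fixed mode `k ≠ 0` is parallel to `(n, -1)` for no
  -- large `n`, so its coefficient eventually vanishes.
  have hp : ∀ n : ℕ, (![(n : ℤ), -1] : Fin 2 → ℤ) ≠ 0 := fun n h => by
    have : (-1 : ℤ) = 0 := congrFun h 1
    omega
  choose x hx using fun n => exists_critical_geodesic hV (hp n)
  set F : ℕ → FiniteMeasure Torus := fun n => geodesicMeasure (perp ![(n : ℤ), -1]) (x n) with hF
  have hFmem : ∀ n, F n ∈ {μ : FiniteMeasure Torus | μ.mass ≤ 1} := fun n => by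
    have h1 : (F n : Measure Torus) univ = 1 := geodesicMeasure_univ _ _
    have h2 : ((F n).mass : ℝ≥0∞) = 1 := by rw [FiniteMeasure.ennreal_mass, h1]
    exact (ENNReal.coe_le_one_iff).1 h2.le
  obtain ⟨m, -, hm⟩ := (isCompact_setOfPred_finiteMeasure_le_of_compactSpace (E := Torus) 1).ultrafilter_le_nhds
    ((hyperfilter ℕ : Ultrafilter ℕ).map F) (by
      simp only [le_principal_iff]
      exact Eventually.of_forall (f := (hyperfilter ℕ : Filter ℕ)) hFmem)
  have hm' : Tendsto F (hyperfilter ℕ) (𝓝 m) := hm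
  have hvol : (m : Measure Torus) = volume := by
    refine measure_ext_of_coeff fun k => ?_
    have h1 := tendsto_hat hm' k
    rw [integral_mFourier]
    refine tendsto_nhds_unique h1 ?_
    have h2 : ∀ᶠ n : ℕ in atTop, hat (F n) k = if k = 0 then 1 else 0 := by
      by_cases hk : k = 0
      · refine Eventually.of_forall fun n => ?_
        rw [hat_geodesicMeasure, hk, if_pos rfl, cross]
        simp [mFourier_zero, meanPhase_zero one_pos]
      · have h3 : ∀ᶠ n : ℕ in atTop, cross k ![(n : ℤ), -1] ≠ 0 := by
          filter_upwards [eventually_gt_atTop (k 0).natAbs] with n hn h0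
          have h4 : k 0 * (-1) - k 1 * (n : ℤ) = 0 := h0
          have h5 : k 0 = (-k 1) * n := by linarith
          have h6 : k 1 = 0 := by
            by_contra h7
            rw [h5, Int.natAbs_mul, Int.natAbs_natCast] at hn
            have : 1 ≤ (-k 1).natAbs := by omega
            nlinarith
          refine hk (funext fun i => ?_)
          rw [h6] at h5
          fin_cases i
          · simpa using h5
          · exact h6
        filter_upwards [h3] with n hn
        rw [hat_geodesicMeasure, meanPhase_one (neg_ne_zero.2 hn), mul_zero, if_neg hk]
    exact tendsto_const_nhds.congr' (Eventually.mono (Nat.hyperfilter_le_atTop h2) fun n hn => hn.symm)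
  have : lebesgue = m := Subtype.ext hvol.symm
  rw [this]
  exact mem_closure_of_tendsto hm' (Eventually.of_forall fun n =>
    subset_convexHull _ _ (geodesicMeasure_mem (hp n) (hx n)))

theorem criticalHull_convex {V : Torus → ℝ} {m₁ m₂ : FiniteMeasure Torus} (h₁ : m₁ ∈ criticalHull V)
    (h₂ : m₂ ∈ criticalHull V) {a b : ℝ≥0} (hab : a + b = 1) : a • m₁ + b • m₂ ∈ criticalHull V :=
  map_mem_closure₂ (f := fun m₁ m₂ : FiniteMeasure Torus => a • m₁ + b • m₂) (by fun_prop) h₁ h₂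
    fun _ hx _ hy => convex_convexHull ℝ≥0 _ hx hy zero_le zero_le hab

/-- An invariant measure is the average of the uniform measures along the closed orbits. -/
theorem integral_integral_geodesicMeasure {σ : Measure Torus} [IsFiniteMeasure σ] {ξ : Plane}
    (h : ∀ s : ℝ, σ.map (· + toTorus (s • ξ)) = σ) {φ : Torus → ℝ} (hφ : Continuous φ) :
    ∫ x, ∫ y, φ y ∂(geodesicMeasure ξ x : Measure Torus) ∂σ = ∫ x, φ x ∂σ := by
  simp only [integral_geodesicMeasure hφ]
  obtain ⟨C, hC⟩ := isCompact_univ.exists_bound_of_continuousOn hφ.continuousOn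
  have hc : Continuous fun z : Torus × ℝ => φ (z.1 + toTorus (z.2 • ξ)) :=
    hφ.comp (continuous_fst.add (continuous_toTorus.comp (by fun_prop)))
  rw [integral_integral_swap]
  · have : ∀ s : ℝ, ∫ x, φ (x + toTorus (s • ξ)) ∂σ = ∫ x, φ x ∂σ := fun s => by
      conv_rhs => rw [← h s]
      rw [integral_map (measurable_add_const _).aemeasurable hφ.aestronglyMeasurable]
    simp [this]
  · refine Integrable.mono' (integrable_const C) hc.aestronglyMeasurable
      (Eventually.of_forall fun z => hC _ (mem_univ _))

/-- A normalized sum of invariant measures carried by critical geodesics is in the critical hull. -/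
theorem mem_criticalHull_of_sum {V : Torus → ℝ} {σ : primitives → Measure Torus} {ρ : Measure Torus}
    [IsFiniteMeasure ρ] [NeZero ρ] (hρ : ρ = Measure.sum σ)
    (hinv : ∀ (p : primitives) (s : ℝ), (σ p).map (· + toTorus (s • perp p)) = σ p)
    (hcrit : ∀ p : primitives, ∀ᵐ x ∂σ p, range (geodesic x (perp p)) ⊆ criticalSet V)
    {m : FiniteMeasure Torus} (hm : (m : Measure Torus) = (ρ univ)⁻¹ • ρ) : m ∈ criticalHull V := by
  -- The measures are placed on disjoint copies of the torus, so that each point remembers the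
  -- direction of its closed orbit.
  set N : Measure (primitives × Torus) := Measure.sum fun p => (σ p).map (Prod.mk p) with hN
  have hle : ∀ p, σ p ≤ ρ := fun p => hρ ▸ Measure.le_sum σ p
  have hfin : ∀ p, IsFiniteMeasure (σ p) := fun p => isFiniteMeasure_of_le ρ (hle p)
  have hNuniv : N univ = ρ univ := by
    rw [hN, hρ, Measure.sum_apply _ MeasurableSet.univ, Measure.sum_apply _ MeasurableSet.univ]
    refine tsum_congr fun p => ?_
    rw [Measure.map_apply measurable_prodMk_left MeasurableSet.univ, preimage_univ]
  have hNfin : IsFiniteMeasure N := ⟨hNuniv ▸ measure_lt_top ρ univ⟩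
  set τ := (ρ univ)⁻¹ • N with hτ
  have hρ0 : ρ univ ≠ 0 := by simpa using NeZero.ne ρ
  have hτp : IsProbabilityMeasure τ := ⟨by
    rw [hτ, Measure.smul_apply, hNuniv, smul_eq_mul, ENNReal.inv_mul_cancel hρ0 (measure_ne_top _ _)]⟩
  have hmeas : ∀ φ : BoundedContinuousFunction Torus ℝ, Measurable fun y : primitives × Torus =>
      ∫ x, φ x ∂(geodesicMeasure (perp y.1) y.2 : Measure Torus) := fun φ => by
    refine measurable_from_prod_countable_right fun p => ?_
    simp only [integral_geodesicMeasure φ.continuous]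
    have hc : Continuous fun z : Torus × ℝ => φ (z.1 + toTorus (z.2 • perp p)) :=
      φ.continuous.comp (continuous_fst.add (continuous_toTorus.comp (by fun_prop)))
    exact (hc.stronglyMeasurable.integral_prod_right' (ν := volume.restrict (Ioc (0 : ℝ) 1))).measurable
  have hint : ∀ (φ : BoundedContinuousFunction Torus ℝ) (κ : Measure (primitives × Torus)),
      IsFiniteMeasure κ → Integrable (fun y : primitives × Torus =>
        ∫ x, φ x ∂(geodesicMeasure (perp y.1) y.2 : Measure Torus)) κ := fun φ κ _ => by
    refine Integrable.mono' (integrable_const ‖φ‖) (hmeas φ).aestronglyMeasurable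
      (Eventually.of_forall fun y => ?_)
    refine (norm_integral_le_of_norm_le_const (C := ‖φ‖)
      (Eventually.of_forall fun x => φ.norm_coe_le_norm x)).trans ?_
    rw [measureReal_def, geodesicMeasure_univ]
    simp
  refine FiniteMeasure.mem_closure_convexHull_of_barycenter (τ := τ)
    (F := fun y : primitives × Torus => geodesicMeasure (perp y.1) y.2) ?_ (fun φ => hint φ τ inferInstance)
    fun φ => ?_
  · refine Measure.ae_smul_measure ?_ _
    rw [hN, Measure.ae_sum_iff]
    intro p
    rw [(measurableEmbedding_prodMk_left p).ae_map_iff]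
    filter_upwards [hcrit p] with x hx
    exact geodesicMeasure_mem p.2.1.1 hx
  · rw [hm, hτ, integral_smul_measure, integral_smul_measure]
    congr 1
    rw [hρ, integral_sum_measure (hρ ▸ φ.integrable ρ), hN, integral_sum_measure (hint φ N hNfin)]
    refine tsum_congr fun p => ?_
    rw [integral_map measurable_prodMk_left.aemeasurable (hmeas φ).aestronglyMeasurable,
      integral_integral_geodesicMeasure (hinv p) φ.continuous]
/-- A measure split into an integrable density and a multiple of an element of the critical hull. -/
theorem exists_decomposition {V : Torus → ℝ} (hV : SmoothOnTorus V) {ν : Measure Torus}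
    [IsProbabilityMeasure ν] (hs : ∀ m : FiniteMeasure Torus, ν.singularPart volume ≠ 0 →
      (m : Measure Torus) = (ν.singularPart volume univ)⁻¹ • ν.singularPart volume →
      m ∈ criticalHull V) :
    ∃ g : Torus → ℝ, Integrable g volume ∧ (∀ x, 0 ≤ g x) ∧ ∃ α ∈ Icc (0 : ℝ) 1,
      ∃ m ∈ criticalHull V, ∀ A : Set Torus, MeasurableSet A →
        ν.real A = (∫ x in A, g x) + α * (m : Measure Torus).real A := by
  set ρ := ν.singularPart volume with hρ
  have hle : ρ univ ≤ 1 := (Measure.singularPart_le ν volume univ).trans_eq measure_univ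
  have hdec : ∀ A, MeasurableSet A →
      ν.real A = (∫ x in A, (ν.rnDeriv volume x).toReal) + ρ.real A := fun A hA => by
    have h1 : ν A = ρ A + (volume.withDensity (ν.rnDeriv volume)) A := by
      conv_lhs => rw [ν.haveLebesgueDecomposition_add volume]
      rfl
    rw [Measure.setIntegral_toReal_rnDeriv_eq_withDensity, measureReal_def, h1,
      ENNReal.toReal_add (measure_ne_top _ _) (measure_ne_top _ _), add_comm]
    rfl
  refine ⟨fun x => (ν.rnDeriv volume x).toReal, Measure.integrable_toReal_rnDeriv,
    fun x => ENNReal.toReal_nonneg, ρ.real univ, ⟨measureReal_nonneg, ?_⟩, ?_⟩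
  · exact ENNReal.toReal_mono ENNReal.one_ne_top hle
  · by_cases h0 : ρ = 0
    · refine ⟨lebesgue, lebesgue_mem_criticalHull hV, fun A hA => ?_⟩
      rw [hdec A hA, h0]; simp
    · have hu : ρ univ ≠ 0 := by simpa using h0
      have hfin : IsFiniteMeasure ((ρ univ)⁻¹ • ρ) := ⟨by
        rw [Measure.smul_apply, smul_eq_mul, ENNReal.inv_mul_cancel hu (measure_ne_top _ _)]
        exact ENNReal.one_lt_top⟩
      refine ⟨⟨(ρ univ)⁻¹ • ρ, hfin⟩, hs _ h0 rfl, fun A hA => ?_⟩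
      rw [hdec A hA]
      congr 1
      change ρ.real A = ρ.real univ * ((ρ univ)⁻¹ • ρ).real A
      rw [measureReal_ennreal_smul_apply, ENNReal.toReal_inv, measureReal_def, measureReal_def,
        mul_inv_cancel_left₀]
      exact (ENNReal.toReal_pos hu (measure_ne_top _ _)).ne'

end Torus

/-! ### The theorem -/

open Torus in
theorem theorem1p1 {ι : Type*} (l : Filter ι) (h e : ι → ℝ)
    (h_pos : ∀ i, 0 < h i) (e_pos : ∀ i, 0 < e i)
    (h_lim : Tendsto h l (𝓝 0))
    (e_lim : Tendsto e l (𝓝 0))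
    (he_lim : Tendsto (fun i => h i * (e i)⁻¹) l (𝓝 0))
    (V : Torus → ℝ) (hV : SmoothOnTorus V)
    (u : ι → Lp ℂ 2 (volume : Measure Torus)) (hu : ∀ i, ‖u i‖ = 1)
    (hquasi : IsQuasimode V l h e u)
    (ν : ProbabilityMeasure Torus)
    (hν : MapClusterPt ν l (fun i => positionMeasure (u i) (hu i))) :
    (∀ γ : Set Torus, IsClosedGeodesic γ → (ν : Measure Torus) γ ≠ 0 → γ ⊆ criticalSet V) ∧
    (∃ f : Torus → ℝ, Integrable f volume ∧ ∃ νsing ∈ criticalHull V,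
      ∀ A : Set Torus, MeasurableSet A →
        (ν : Measure Torus).real A =
          (∫ x in A, f x) + (νsing : Measure Torus).real A) ∧
    (∃ f : Torus → ℝ, Integrable f volume ∧ (∀ x, 0 ≤ f x) ∧
      ∃ α ∈ Icc (0 : ℝ) 1, ∃ νsing ∈ criticalHull V,
        ∀ A : Set Torus, MeasurableSet A →
          (ν : Measure Torus).real A =
            (∫ x in A, f x) + α * (νsing : Measure Torus).real A) := by
  have Q := fourierQuasimode_of_isQuasimode h_pos e_pos h_lim e_lim he_lim hV hu hquasi
  obtain ⟨μ, H⟩ := Q.exists_concentrationMeasures hu hν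
  have hμfin := H.finite
  obtain ⟨δ, hδ, hsum, -⟩ := H.exists_scales
  have hinv : ∀ (p : primitives) (s : ℝ),
      ((μ p (δ p)).singularPart volume).map (· + toTorus (s • perp p)) =
        (μ p (δ p)).singularPart volume := fun p s =>
    singularPart_map_add_right (H.map_add_right_eq (hδ p) s)
  have hcrit : ∀ p : primitives, ∀ᵐ x ∂(μ p (δ p)).singularPart volume,
      range (geodesic x (perp p)) ⊆ criticalSet V := fun p => by
    filter_upwards [H.ae_slope_eq_zero p.2.1 (hδ p)] with x hx
    exact range_geodesic_subset_of_slope hV p.2.1 hx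
  have hdec := exists_decomposition hV (ν := (ν : Measure Torus)) fun m h0 hm =>
    have : NeZero ((ν : Measure Torus).singularPart volume) := ⟨h0⟩
    mem_criticalHull_of_sum hsum hinv hcrit hm
  refine ⟨?_, ?_, hdec⟩
  · intro γ hγ hνγ
    obtain ⟨x, q, hq, rfl⟩ := exists_primitive_of_isClosedGeodesic hγ
    set γ := range (geodesic x (perp q)) with hγdef
    have hvol : volume γ = 0 := volume_geodesic_eq_zero x hq.1.1
    have hsing : (ν : Measure Torus).singularPart volume γ ≠ 0 := fun h0 => by
      rw [(ν : Measure Torus).haveLebesgueDecomposition_add volume, Measure.add_apply, h0, zero_add] at hνγ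
      exact hνγ (withDensity_absolutelyContinuous _ _ hvol)
    rw [hsum, Ne, Measure.sum_apply_eq_zero] at hsing
    push Not at hsing
    obtain ⟨p, hp⟩ := hsing
    -- A measure invariant in another rational direction is transversal to `γ` and does not charge
    -- it.
    have hpq : (p : Fin 2 → ℤ) = q := by
      by_contra hne
      exact hp (Measure.absolutelyContinuous_of_le (Measure.singularPart_le _ _)
        (H.geodesic_eq_zero p.2 hq hne (hδ p) x))
    have hfreq : ∃ᶠ y in ae ((μ p (δ p)).singularPart volume), y ∈ γ := by
      rw [frequently_ae_mem_iff]; exact hp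
    obtain ⟨y, ⟨s, rfl⟩, hy⟩ := (hfreq.and_eventually (hcrit p)).exists
    refine Subset.trans ?_ hy
    rw [hpq, hγdef]
    rintro _ ⟨t, rfl⟩
    exact ⟨t - s, by
      simp only [geodesic]
      rw [add_assoc, ← toTorus_add, ← add_smul, add_sub_cancel]⟩
  · obtain ⟨g, hg, -, α, ⟨hα0, hα1⟩, m, hm, hA⟩ := hdec
    lift α to ℝ≥0 using hα0
    have hα1' : α ≤ 1 := by exact_mod_cast hα1
    -- An element of the hull has total mass 1: the missing mass `1 - α` is filled with Lebesgue
    -- measure and removed from the density, which may become negative.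
    refine ⟨fun x => g x - (1 - α), hg.sub (integrable_const _), α • m + (1 - α) • lebesgue,
      criticalHull_convex hm (lebesgue_mem_criticalHull hV) (add_tsub_cancel_of_le hα1'),
      fun A hAm => ?_⟩
    have e1 : ((α • m + (1 - α) • lebesgue : FiniteMeasure Torus) : Measure Torus).real A =
        α * (m : Measure Torus).real A + (1 - α) * (volume : Measure Torus).real A := by
      rw [FiniteMeasure.toMeasure_add, FiniteMeasure.toMeasure_smul, FiniteMeasure.toMeasure_smul,
        measureReal_add_apply, measureReal_nnreal_smul_apply, measureReal_nnreal_smul_apply,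
        NNReal.coe_sub hα1', NNReal.coe_one]
      rfl
    rw [hA A hAm, e1, integral_sub hg.integrableOn (integrable_const _)]
    simp
    ring
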